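/- Let $\Bbbk$ be an algebraically closed field and let $Y$ and $S$ be separated schemes of finite type over $\Bbbk$, with projections $p\colon Y\times S\to Y$ and $q\colon Y\times S\to S$ from their product over $\Bbbk$. For an open subset $U\subseteq S$, let $D(Y\times U)$ be the bounded derived category of coherent sheaves on $Y\times U$, and let $D_{lc}(Y\times U)\subseteq D(Y\times U)$ be the full triangulated subcategory of the complexes with left-compact support, that is, those $F$ for which there is a closed subscheme $Z\subseteq Y$, proper over $\Bbbk$, such that all cohomology sheaves of $F$ are supported in $Z\times U$. For a t-structure $(D^{\le 0},D^{\ge 0})$ on a triangulated category $D$ put $D^{\le n}=D^{\le 0}[-n]$, $D^{\ge n}=D^{\ge 0}[-n]$, $D^{[a,b]}=D^{\ge a}\cap D^{\le b}$, $D^{[-\infty,b]}=D^{\le b}$ and $D^{[a,\infty]}=D^{\ge a}$. The t-structure is bounded if $\bigcup_n D^{\le n}=\bigcup_n D^{\ge n}=D$. A functor between triangulated categories with t-structures is t-exact if it maps $D^{\le 0}$ into $D'^{\le 0}$ and $D^{\ge 0}$ into $D'^{\ge 0}$. A sheaf of t-structures on $D_{lc}(Y\times S)$ over $S$ consists of a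 bounded t-structure on $D_{lc}(Y\times U)$ for each open subset $U\subseteq S$, such that for all open subsets $j\colon U'\hookrightarrow U$ of $S$ the restriction functor $(\mathrm{id}_Y\times j)^*\colon D_{lc}(Y\times U)\to D_{lc}(Y\times U')$ is t-exact. **Theorem.** Assume that $S$ is quasi-projective over $\Bbbk$, let $L$ be an ample line bundle on $S$, and let $(D_{lc}^{\le 0}(Y\times S),D_{lc}^{\ge 0}(Y\times S))$ be a bounded t-structure on $D_{lc}(Y\times S)$ such that the functor $$D_{lc}(Y\times S)\longrightarrow D_{lc}(Y\times S),\qquad F\longmapsto F\otimes q^*L$$ is t-exact. Then this t-structure gives, by restriction, a sheaf of t-structures on $D_{lc}(Y\times S)$ over $S$: there is a sheaf of t-structures on $D_{lc}(Y\times S)$ over $S$ such that, for every open subset $U\subseteq S$, with $j_U\colon Y\times U\hookrightarrow Y\times S$ the open immersion, and for every interval $[a,b]$ with integer ends, possibly infinite on one side, $$D_{lc}^{[a,b]}(Y\times U)=\{F_0\in D_{lc}(Y\times U)\mid \text{there is } F\in D_{lc}^{[a,b]}(Y\times S)\text{ with } F_0\cong j_U^*F\}.$$ -/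

import Mathlib

open CategoryTheory Limits AlgebraicGeometry Opposite TopologicalSpace MonoidalCategory

universe u

namespace AlgebraicGeometry.Scheme.Modules
variable {X Y : Scheme.{u}}

instance restrictFunctor_additive (f : X ⟶ Y) [IsOpenImmersion f] :
    (restrictFunctor f).Additive where
  map_add := by
    intros
    ext U : 1
    rfl

instance restrictFunctor_preservesFiniteLimits (f : X ⟶ Y) [IsOpenImmersion f] :
    PreservesFiniteLimits (restrictFunctor f) := by
  have h : PreservesFiniteLimits (restrictFunctor f ⋙ toPresheaf X) := by
    let G : (Y.Opensᵒᵖ ⥤ Ab.{u}) ⥤ (X.Opensᵒᵖ ⥤ Ab.{u}) :=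
      (Functor.whiskeringLeft _ _ _).obj f.opensFunctor.op
    have e : restrictFunctor f ⋙ toPresheaf X ≅ toPresheaf Y ⋙ G := Iso.refl _
    have : PreservesFiniteLimits (toPresheaf Y ⋙ G) := by
      have : PreservesFiniteLimits G := ⟨fun _ _ _ => inferInstance⟩
      exact comp_preservesFiniteLimits _ _
    exact preservesFiniteLimits_of_natIso e.symm
  exact ⟨fun J _ _ => by
    have := reflectsLimitsOfShape_of_reflectsIsomorphisms (G := toPresheaf X) (J := J)
    exact preservesLimitsOfShape_of_reflects_of_preserves (restrictFunctor f) (toPresheaf X)⟩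

instance restrictFunctor_preservesFiniteColimits (f : X ⟶ Y) [IsOpenImmersion f] :
    PreservesFiniteColimits (restrictFunctor f) := inferInstance

/-- A sheaf of modules on `Spec R` isomorphic to the sheaf associated with a finitely generated
`R`-module. -/
def IsTildeFinite {R : CommRingCat.{u}} (M : (Spec R).Modules) : Prop :=
  ∃ N : ModuleCat.{u} R, Module.Finite R N ∧ Nonempty (M ≅ tilde N)

/-- Coherent sheaves (on locally Noetherian schemes): every point has an affine open neighbourhood
`Spec R` on which the sheaf is the one associated with a finitely generated `R`-module. -/
def isCoherent (X : Scheme.{u}) : ObjectProperty X.Modules := fun M =>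
  ∀ x : X, ∃ (R : CommRingCat.{u}) (i : Spec R ⟶ X) (_ : IsOpenImmersion i),
    x ∈ Set.range i ∧ IsTildeFinite (M.restrict i)

lemma IsTildeFinite.of_iso {R : CommRingCat.{u}} {M N : (Spec R).Modules} (e : M ≅ N)
    (h : IsTildeFinite M) : IsTildeFinite N := by
  obtain ⟨P, hP, ⟨e'⟩⟩ := h
  exact ⟨P, hP, ⟨e.symm ≪≫ e'⟩⟩

lemma isTildeFinite_iff_exists_epi {R : CommRingCat.{u}} (M : (Spec R).Modules) :
    IsTildeFinite M ↔ SheafOfModules.IsQuasicoherent (R := (Spec R).ringCatSheaf) M ∧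
      ∃ (n : ℕ) (p : (tilde.functor R).obj (ModuleCat.of R (ULift.{u} (Fin n) →₀ R)) ⟶ M), Epi p := by
  constructor
  · rintro ⟨N, hN, ⟨e⟩⟩
    have hq : SheafOfModules.IsQuasicoherent (R := (Spec R).ringCatSheaf) M :=
      (SheafOfModules.isQuasicoherent (Spec R).ringCatSheaf).prop_of_iso
        (show tilde N ≅ M from e.symm) (inferInstanceAs (tilde N).IsQuasicoherent)
    refine ⟨hq, ?_⟩
    obtain ⟨n, g, hg⟩ := Module.Finite.exists_fin' R N
    let g' : (ULift.{u} (Fin n) →₀ R) →ₗ[R] N :=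
      g ∘ₗ (Finsupp.linearEquivFunOnFinite R R (Fin n)).toLinearMap ∘ₗ
        (Finsupp.domLCongr Equiv.ulift).toLinearMap
    have hg' : Function.Surjective g' := by
      simp only [g', LinearMap.coe_comp, LinearEquiv.coe_coe]
      exact hg.comp ((LinearEquiv.surjective _).comp (LinearEquiv.surjective _))
    have : Epi (ModuleCat.ofHom g') := (ModuleCat.epi_iff_surjective _).2 hg'
    have : Epi ((tilde.functor R).map (ModuleCat.ofHom g')) := inferInstance
    let e' : (tilde.functor R).obj N ≅ M := e.symm
    exact ⟨n, (tilde.functor R).map (ModuleCat.ofHom g') ≫ e'.hom, epi_comp' this inferInstance⟩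
  · rintro ⟨hq, n, p, hp⟩
    have := (isQuasicoherent_iff_isIso_fromTildeΓ M).1 hq
    refine ⟨moduleSpecΓFunctor.obj M, ?_, ⟨(asIso M.fromTildeΓ).symm⟩⟩
    let e : (tilde.functor R).obj (moduleSpecΓFunctor.obj M) ≅ M :=
      @asIso _ _ _ _ M.fromTildeΓ this
    let q : (tilde.functor R).obj (ModuleCat.of R (ULift.{u} (Fin n) →₀ R)) ⟶
      (tilde.functor R).obj (moduleSpecΓFunctor.obj M) := p ≫ e.inv
    have hq' : Epi q := epi_comp' hp inferInstance
    obtain ⟨g, hg⟩ := (tilde.functor R).map_surjective q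
    have : Epi g := by
      rw [← hg] at hq'
      exact (tilde.functor R).epi_of_epi_map hq'
    rw [ModuleCat.epi_iff_surjective] at this
    exact Module.Finite.of_surjective g.hom this

lemma IsTildeFinite.restrict {R S : CommRingCat.{u}} {M : (Spec R).Modules} (h : IsTildeFinite M)
    (f : Spec S ⟶ Spec R) [IsOpenImmersion f] : IsTildeFinite (M.restrict f) := by
  rw [isTildeFinite_iff_exists_epi] at h ⊢
  obtain ⟨hq, n, p, hp⟩ := h
  refine ⟨isQuasicoherent_restrictFunctor f M, n, ?_⟩
  let F : SheafOfModules (Spec R).ringCatSheaf ⥤ SheafOfModules (Spec S).ringCatSheaf :=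
    restrictFunctor f
  have : PreservesColimitsOfSize.{u, u} F :=
    (restrictAdjunction f).leftAdjoint_preservesColimits
  let e : (tilde.functor S).obj (ModuleCat.of S (ULift.{u} (Fin n) →₀ S)) ≅
      (restrictFunctor f).obj ((tilde.functor R).obj (ModuleCat.of R (ULift.{u} (Fin n) →₀ R))) :=
    (tildeFinsupp _) ≪≫ (SheafOfModules.mapFreeIso F (ULift.{u} (Fin n)) (restrictUnitIso f).symm) ≪≫
    (restrictFunctor f).mapIso (tildeFinsupp _).symm
  exact ⟨e.hom ≫ (restrictFunctor f).map p, epi_comp' inferInstance inferInstance⟩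

lemma IsTildeFinite.of_range_le {M : X.Modules} {R S : CommRingCat.{u}} (i : Spec R ⟶ X) (j : Spec S ⟶ X)
    [IsOpenImmersion i] [IsOpenImmersion j] (hij : Set.range j ⊆ Set.range i)
    (h : IsTildeFinite (M.restrict i)) : IsTildeFinite (M.restrict j) := by
  let f := IsOpenImmersion.lift i j hij
  have hf : f ≫ i = j := IsOpenImmersion.lift_fac _ _ _
  have : IsOpenImmersion f := by
    have : IsOpenImmersion (f ≫ i) := by rw [hf]; infer_instance
    exact IsOpenImmersion.of_comp f i
  exact (h.restrict f).of_iso ((restrictFunctorComp f i).symm.app M ≪≫ (restrictFunctorCongr hf).app M)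


lemma exists_isTildeFinite {M : X.Modules} (hM : isCoherent X M) (x : X) (U : X.Opens) (hx : x ∈ U) :
    ∃ (R : CommRingCat.{u}) (i : Spec R ⟶ X) (_ : IsOpenImmersion i),
    x ∈ Set.range i ∧ Set.range i ⊆ (U : Set X) ∧ IsTildeFinite (M.restrict i) := by
  obtain ⟨R, i, hi, hx', h⟩ := hM x
  obtain ⟨_, ⟨W, hW, rfl⟩, hxW, hWU⟩ := X.isBasis_affineOpens.exists_subset_of_mem_open
    (show x ∈ ((U ⊓ i.opensRange : X.Opens) : Set X) from ⟨hx, hx'⟩) (U ⊓ i.opensRange).isOpen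
  have hW' : IsAffineOpen W := hW
  refine ⟨_, hW'.fromSpec, inferInstance, ?_, ?_, ?_⟩
  · rw [hW'.range_fromSpec]; exact hxW
  · rw [hW'.range_fromSpec]; exact fun y hy => (hWU hy).1
  · refine h.of_range_le i hW'.fromSpec ?_
    rw [hW'.range_fromSpec]; exact fun y hy => (hWU hy).2

lemma exists_isTildeFinite₂ {M N : X.Modules} (hM : isCoherent X M) (hN : isCoherent X N) (x : X) :
    ∃ (R : CommRingCat.{u}) (i : Spec R ⟶ X) (_ : IsOpenImmersion i),
    x ∈ Set.range i ∧ IsTildeFinite (M.restrict i) ∧ IsTildeFinite (N.restrict i) := by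
  obtain ⟨R, i, hi, hx, h⟩ := hM x
  obtain ⟨R', i', hi', hx', hU, h'⟩ := exists_isTildeFinite hN x i.opensRange hx
  exact ⟨R', i', hi', hx', h.of_range_le i i' hU, h'⟩

instance (X : Scheme.{u}) : (toPresheaf X).Additive where
  map_add := by intros; rfl

/-- Sections over an open subset, as abelian groups. -/
noncomputable def sectionsFunctor (U : X.Opens) : X.Modules ⥤ Ab.{u} :=
  toPresheaf X ⋙ (CategoryTheory.evaluation X.Opensᵒᵖ Ab.{u}).obj (op U)

instance (U : X.Opens) : (sectionsFunctor U).Additive where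
  map_add := by intros; rfl

instance (U : X.Opens) : PreservesFiniteLimits (sectionsFunctor U) :=
  have : PreservesFiniteLimits ((CategoryTheory.evaluation X.Opensᵒᵖ Ab.{u}).obj (op U)) :=
    ⟨fun _ _ _ => inferInstance⟩
  comp_preservesFiniteLimits _ _

lemma app_injective_of_mono {M N : X.Modules} (f : M ⟶ N) [Mono f] (U : X.Opens) :
    Function.Injective (f.app U) :=
  (AddCommGrpCat.mono_iff_injective ((sectionsFunctor U).map f)).1 inferInstance

lemma exists_app_eq_of_exact {S : ShortComplex X.Modules} (hS : S.Exact) [Mono S.f] (U : X.Opens)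
    (m : Γ(S.X₂, U)) (hm : S.g.app U m = 0) : ∃ k, S.f.app U k = m :=
  (ShortComplex.ab_exact_iff _).1 (hS.map_of_mono_of_preservesKernel (sectionsFunctor U)
    inferInstance inferInstance) m hm

lemma IsTildeFinite.isLocalizing {R : CommRingCat.{u}} {M : (Spec R).Modules} (h : IsTildeFinite M) :
    IsLocalizing (modulesSpecToSheaf.obj M) := by
  obtain ⟨N, _, ⟨e⟩⟩ := h
  exact isLocalizing_of_iso (modulesSpecToSheaf.mapIso e.symm) (isLocalizing_tilde N)

lemma app_smul_Spec {R : CommRingCat.{u}} {M N : (Spec R).Modules} (φ : M ⟶ N)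
    (U : (Spec R).Opens) (r : R) (m : Γ(M, U)) : φ.app U (r • m) = r • φ.app U m := by
  rw [smul_Spec_def, smul_Spec_def, Hom.app_smul]

/-- The basic open subset `D(f)` of `Spec R`. -/
def specBasicOpen {R : CommRingCat.{u}} (f : R) : (Spec R).Opens := PrimeSpectrum.basicOpen f

lemma isLocalizing_iff_sections {R : CommRingCat.{u}} (M : (Spec R).Modules) :
    IsLocalizing (modulesSpecToSheaf.obj M) ↔
      (∀ (f : R) (s : Γ(M, specBasicOpen f)), ∃ (n : ℕ) (t : Γ(M, ⊤)),
        M.presheaf.map (homOfLE le_top).op t = f ^ n • s) ∧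
      (∀ (f : R) (t : Γ(M, ⊤)), M.presheaf.map (homOfLE (le_top (a := specBasicOpen f))).op t = 0 →
        ∃ n : ℕ, f ^ n • t = 0) := by
  let φ (f : R) := ((modulesSpecToSheaf.obj M).obj.map (PrimeSpectrum.basicOpen f).leTop.op).hom
  refine ⟨fun h ↦ ?_, fun h f ↦ IsLocalizedModule.Away.mk_of_addCommGroup ?_ ?_ ?_⟩
  · have hf (f : R) : IsLocalizedModule.Away f (φ f) := h f
    refine ⟨fun f s ↦ ?_, fun f s hs ↦ ?_⟩
    · obtain ⟨n, y, hy⟩ := (hf f).surj _ _ s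
      use n, y, hy.symm
    · obtain ⟨⟨_, n, rfl⟩, hn⟩ := (IsLocalizedModule.eq_zero_iff (.powers f) (φ f)).mp hs
      use n, hn
  · exact isUnit_algebraMap_end_of_le_basicOpen f le_rfl
  · intro x
    obtain ⟨n, t, ht⟩ := h.1 _ x
    use n, t, ht.symm
  · intro x hx
    obtain ⟨n, hn⟩ := h.2 _ _ hx
    use n, hn

lemma app_map {M N : X.Modules} (φ : M ⟶ N) {U V : X.Opens} (h : U ⟶ V) (m : Γ(M, V)) :
    φ.app U (M.presheaf.map h.op m) = N.presheaf.map h.op (φ.app V m) :=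
  congr($(φ.mapPresheaf.naturality h.op) m)

lemma IsTildeFinite.kernel {R : CommRingCat.{u}} [IsNoetherianRing R] {S : ShortComplex (Spec R).Modules}
    (hS : S.Exact) [Mono S.f] (h₂ : IsTildeFinite S.X₂) (h₃ : IsTildeFinite S.X₃) :
    IsTildeFinite S.X₁ := by
  have h₁ : IsLocalizing (modulesSpecToSheaf.obj S.X₁) := by
    have H₂ := (isLocalizing_iff_sections _).1 h₂.isLocalizing
    have H₃ := (isLocalizing_iff_sections _).1 h₃.isLocalizing
    refine (isLocalizing_iff_sections _).2 ⟨fun f s => ?_, fun f t ht => ?_⟩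
    · obtain ⟨n, t, ht⟩ := H₂.1 f (S.f.app _ s)
      have h0 : S.g.app _ (S.f.app _ s) = 0 := congr(($(S.zero)).app _ s)
      obtain ⟨m, hm⟩ := H₃.2 f (S.g.app _ t) (by
        rw [← app_map, ht, app_smul_Spec, h0, smul_zero])
      obtain ⟨k, hk⟩ := exists_app_eq_of_exact hS ⊤ (f ^ m • t) (by rw [app_smul_Spec, hm])
      refine ⟨m + n, k, app_injective_of_mono S.f _ ?_⟩
      rw [app_map, hk, map_smul_Spec, ht, app_smul_Spec, pow_add, mul_smul]
    · obtain ⟨n, hn⟩ := H₂.2 f (S.f.app _ t) (by rw [← app_map, ht, map_zero])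
      exact ⟨n, app_injective_of_mono S.f _ (by rw [app_smul_Spec, hn, map_zero])⟩
  have h₁' := (isIso_fromTildeΓ_iff_isLocalizing _).2 h₁
  refine ⟨moduleSpecΓFunctor.obj S.X₁, ?_, ⟨(asIso S.X₁.fromTildeΓ).symm⟩⟩
  obtain ⟨N, hN, ⟨e⟩⟩ := h₂
  let e' : N ≅ moduleSpecΓFunctor.obj S.X₂ := tilde.toTildeΓNatIso.app N ≪≫ moduleSpecΓFunctor.mapIso e.symm
  have : Module.Finite R (moduleSpecΓFunctor.obj S.X₂) := Module.Finite.equiv e'.toLinearEquiv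
  exact Module.Finite.of_injective (moduleSpecΓFunctor.map S.f).hom (app_injective_of_mono S.f ⊤)

lemma IsTildeFinite.cokernel {R : CommRingCat.{u}} {S : ShortComplex (Spec R).Modules}
    (hS : S.Exact) [Epi S.g] (h₁ : IsTildeFinite S.X₁) (h₂ : IsTildeFinite S.X₂) :
    IsTildeFinite S.X₃ := by
  obtain ⟨A, hA, ⟨a⟩⟩ := h₁
  obtain ⟨B, hB, ⟨b⟩⟩ := h₂
  let q : (tilde.functor R).obj A ⟶ (tilde.functor R).obj B := a.inv ≫ S.f ≫ b.hom
  obtain ⟨g, hg⟩ := (tilde.functor R).map_surjective q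
  refine ⟨Limits.cokernel g, ?_, ⟨?_⟩⟩
  · exact Module.Finite.of_surjective (cokernel.π g).hom
      ((ModuleCat.epi_iff_surjective _).1 inferInstance)
  · have h := hS.gIsCokernel
    have h' := cokernelIsCokernel ((tilde.functor R).map g)
    refine (CokernelCofork.mapIsoOfIsColimit h h' (Arrow.isoMk a b ?_)) ≪≫
      (PreservesCokernel.iso (tilde.functor R) g).symm
    change a.hom ≫ (tilde.functor R).map g = S.f ≫ b.hom
    rw [hg]
    exact (Iso.hom_inv_id_assoc a _)

lemma isCoherent_of_cokernel {S : ShortComplex X.Modules} (hS : S.Exact) [Epi S.g]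
    (h₁ : isCoherent X S.X₁) (h₂ : isCoherent X S.X₂) : isCoherent X S.X₃ := by
  intro x
  obtain ⟨R, i, hi, hx, H₁, H₂⟩ := exists_isTildeFinite₂ h₁ h₂ x
  have : Epi (S.map (restrictFunctor i)).g := inferInstanceAs (Epi ((restrictFunctor i).map S.g))
  exact ⟨R, i, hi, hx, IsTildeFinite.cokernel (S := S.map (restrictFunctor i)) (hS.map _) H₁ H₂⟩

lemma isCoherent_of_kernel [IsLocallyNoetherian X] {S : ShortComplex X.Modules} (hS : S.Exact)
    [Mono S.f] (h₂ : isCoherent X S.X₂) (h₃ : isCoherent X S.X₃) : isCoherent X S.X₁ := by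
  intro x
  obtain ⟨R, i, hi, hx, H₁, H₂⟩ := exists_isTildeFinite₂ h₂ h₃ x
  have : Mono (S.map (restrictFunctor i)).f := inferInstanceAs (Mono ((restrictFunctor i).map S.f))
  have : IsNoetherianRing R := isLocallyNoetherian_Spec.1 (isLocallyNoetherian_of_isOpenImmersion i)
  exact ⟨R, i, hi, hx, IsTildeFinite.kernel (S := S.map (restrictFunctor i)) (hS.map _) H₁ H₂⟩

instance : (isCoherent X).IsClosedUnderIsomorphisms where
  of_iso e h x := by
    obtain ⟨R, i, hi, hx, H⟩ := h x
    exact ⟨R, i, hi, hx, H.of_iso ((restrictFunctor i).mapIso e)⟩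

instance [IsLocallyNoetherian X] : (isCoherent X).IsClosedUnderKernels where
  kernels_le := by
    rintro _ ⟨f, k, hk, hf⟩
    have : Mono k.ι := Fork.IsLimit.mono hk
    let S : ShortComplex X.Modules := ShortComplex.mk k.ι f k.condition
    have : Mono S.f := this
    have hS : S.Exact := S.exact_of_f_is_kernel
      (IsLimit.ofIsoLimit hk (Fork.ext (Iso.refl _) (by simp [S])))
    exact isCoherent_of_kernel hS hf.1 hf.2

instance : (isCoherent X).IsClosedUnderCokernels where
  cokernels_le := by
    rintro _ ⟨f, k, hk, hf⟩
    have : Epi k.π := Cofork.IsColimit.epi hk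
    let S : ShortComplex X.Modules := ShortComplex.mk f k.π k.condition
    have : Epi S.g := this
    have hS : S.Exact := S.exact_of_g_is_cokernel
      (IsColimit.ofIsoColimit hk (Cofork.ext (Iso.refl _) (by simp [S])))
    exact isCoherent_of_cokernel hS hf.1 hf.2

lemma isCoherent_of_isZero {M : X.Modules} (hM : IsZero M) : isCoherent X M := by
  intro x
  obtain ⟨_, ⟨W, hW, rfl⟩, hxW, -⟩ := X.isBasis_affineOpens.exists_subset_of_mem_open
    (show x ∈ ((⊤ : X.Opens) : Set X) from trivial) (⊤ : X.Opens).isOpen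
  have hW' : IsAffineOpen W := hW
  refine ⟨_, hW'.fromSpec, inferInstance, by rw [hW'.range_fromSpec]; exact hxW,
    ModuleCat.of _ PUnit, inferInstance, ⟨?_⟩⟩
  have h1 : IsZero ((restrictFunctor hW'.fromSpec).obj M) := (restrictFunctor _).map_isZero hM
  have h2 : IsZero ((tilde.functor Γ(X, W)).obj (ModuleCat.of Γ(X, W) PUnit.{u + 1})) :=
    (tilde.functor _).map_isZero (ModuleCat.isZero_of_subsingleton _)
  exact h1.iso h2

lemma isCoherent_biprod {M N : X.Modules} (hM : isCoherent X M) (hN : isCoherent X N) :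
    isCoherent X (M ⊞ N) := by
  intro x
  obtain ⟨R, i, hi, hx, ⟨A, hA, ⟨a⟩⟩, ⟨B, hB, ⟨b⟩⟩⟩ := exists_isTildeFinite₂ hM hN x
  refine ⟨R, i, hi, hx, A ⊞ B, Module.Finite.equiv (ModuleCat.biprodIsoProd A B).symm.toLinearEquiv,
    ⟨?_⟩⟩
  let a' : (restrictFunctor i).obj M ≅ (tilde.functor R).obj A := a
  let b' : (restrictFunctor i).obj N ≅ (tilde.functor R).obj B := b
  have : PreservesBinaryBiproduct M N (restrictFunctor i) :=
    preservesBinaryBiproduct_of_preservesBinaryProduct _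
  have : PreservesBinaryBiproduct A B (tilde.functor R) :=
    preservesBinaryBiproduct_of_preservesBinaryCoproduct _
  exact (restrictFunctor i).mapBiprod M N ≪≫ biprod.mapIso a' b' ≪≫
    ((tilde.functor R).mapBiprod A B).symm

instance : (isCoherent X).ContainsZero where
  exists_zero := by
    obtain ⟨Z, hZ⟩ := HasZeroObject.zero (C := X.Modules)
    exact ⟨Z, hZ, isCoherent_of_isZero hZ⟩

instance : (isCoherent X).IsClosedUnderFiniteProducts := by
  have h₀ : (isCoherent X).IsClosedUnderLimitsOfShape (Discrete.{0} PEmpty) := inferInstance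
  have h₂ : (isCoherent X).IsClosedUnderBinaryProducts := by
    refine ⟨?_⟩
    rintro M ⟨p⟩
    have e : M ≅ p.diag.obj ⟨.left⟩ ⊞ p.diag.obj ⟨.right⟩ :=
      (p.isLimit.conePointsIsoOfNatIso (BinaryBiproduct.isLimit _ _) (diagramIsoPair p.diag))
    exact (isCoherent X).prop_of_iso e.symm
      (isCoherent_biprod (p.prop_diag_obj ⟨.left⟩) (p.prop_diag_obj ⟨.right⟩))
  exact ObjectProperty.IsClosedUnderFiniteProducts.mk'


instance presheafTensorRight_additive {C : Type*} [Category* C] {R : Cᵒᵖ ⥤ CommRingCat.{u}}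
    (M : _root_.PresheafOfModules.{u} (R ⋙ forget₂ CommRingCat RingCat)) :
    (tensorRight M).Additive where
  map_add {N N' f g} := by
    ext1 U
    change (f.app U + g.app U) ▷ (show ModuleCat (R.obj U) from M.obj U) =
      (f.app U ▷ (show ModuleCat (R.obj U) from M.obj U) : (show ModuleCat (R.obj U) from N.obj U) ⊗ (show ModuleCat (R.obj U) from M.obj U) ⟶ (show ModuleCat (R.obj U) from N'.obj U) ⊗ (show ModuleCat (R.obj U) from M.obj U)) + g.app U ▷ (show ModuleCat (R.obj U) from M.obj U)
    apply MonoidalPreadditive.add_whiskerRight (C := ModuleCat (R.obj U))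

/-- The sheafification functor. -/
noncomputable def sheafificationFunctor (X : Scheme.{u}) : X.PresheafOfModules ⥤ X.Modules :=
  PresheafOfModules.sheafification (𝟙 X.ringCatSheaf.obj)

/-- The sheafification adjunction. -/
noncomputable def sheafificationAdj (X : Scheme.{u}) :
    sheafificationFunctor X ⊣ toPresheafOfModules X :=
  PresheafOfModules.sheafificationAdjunction (𝟙 X.ringCatSheaf.obj)

instance : (toPresheafOfModules X).Additive where
  map_add := rfl

instance : (sheafificationFunctor X).Additive := (sheafificationAdj X).left_adjoint_additive

/-- The functor `N ↦ N ⊗ M` on presheaves of modules. -/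
noncomputable def presheafTensor (M : X.Modules) : X.PresheafOfModules ⥤ X.PresheafOfModules :=
  tensorRight (C := _root_.PresheafOfModules (X.presheaf ⋙ forget₂ CommRingCat RingCat))
      ((toPresheafOfModules X).obj M)

instance (M : X.Modules) : (presheafTensor M).Additive := presheafTensorRight_additive (R := X.presheaf) _

/-- The functor `N ↦ N ⊗ M` on sheaves of modules: the sheafification of the presheaf tensor
product over the structure sheaf. -/
noncomputable def tensorFunctor (M : X.Modules) : X.Modules ⥤ X.Modules :=
  toPresheafOfModules X ⋙ presheafTensor M ⋙ sheafificationFunctor X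

instance (M : X.Modules) : (tensorFunctor M).Additive := by
  unfold tensorFunctor; infer_instance

/-- The canonical map from the presheaf tensor product to the tensor product. -/
noncomputable def toTensor (N M : X.Modules) :
    (presheafTensor M).obj ((toPresheafOfModules X).obj N) ⟶
      (toPresheafOfModules X).obj ((tensorFunctor M).obj N) :=
  (sheafificationAdj X).unit.app _

/-- The section `n ⊗ s` of the tensor product. -/
noncomputable def tmul {N : X.Modules} {M : X.Modules} {W : X.Opens} (n : Γ(N, W)) (s : Γ(M, W)) :
    Γ((tensorFunctor M).obj N, W) :=
  ((toTensor N M).app (op W)).hom (n ⊗ₜ[Γ(X, W)] s)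

/-- A section `s` of `M` over `V` is a frame if `r ↦ r • s` is an isomorphism from the structure
sheaf of `V` onto the restriction of `M` to `V`. -/
def IsFrame {M : X.Modules} {V : X.Opens} (s : Γ(M, V)) : Prop :=
  ∀ (W : X.Opens) (h : W ≤ V),
    Function.Bijective fun r : Γ(X, W) => r • M.presheaf.map (homOfLE h).op s

lemma tmul_add_left {N M : X.Modules} {W : X.Opens} (n n' : Γ(N, W)) (s : Γ(M, W)) :
    tmul (n + n') s = tmul n s + tmul n' s :=
  (congrArg _ (TensorProduct.add_tmul n n' s)).trans (map_add _ _ _)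

lemma tmul_smul_left {N M : X.Modules} {W : X.Opens} (r : Γ(X, W)) (n : Γ(N, W)) (s : Γ(M, W)) :
    tmul (r • n) s = r • tmul n s :=
  ((toTensor N M).app (op W)).hom.map_smul r (n ⊗ₜ[Γ(X, W)] s)

lemma map_tmul {N M : X.Modules} {W W' : X.Opens} (h : W' ⟶ W) (n : Γ(N, W)) (s : Γ(M, W)) :
    ((tensorFunctor M).obj N).presheaf.map h.op (tmul n s) =
      tmul (N.presheaf.map h.op n) (M.presheaf.map h.op s) :=
  (PresheafOfModules.naturality_apply (toTensor N M) h.op (n ⊗ₜ[Γ(X, W)] s)).symm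

lemma app_tmul {N N' M : X.Modules} (φ : N ⟶ N') {W : X.Opens} (n : Γ(N, W)) (s : Γ(M, W)) :
    ((tensorFunctor M).map φ).app W (tmul n s) = tmul (φ.app W n) s :=
  have h := (sheafificationAdj X).unit.naturality
    ((presheafTensor M).map ((toPresheafOfModules X).map φ))
  (congr(($(h).app (op W)).hom (n ⊗ₜ[Γ(X, W)] s))).symm

lemma bijective_tmul_presheaf {N M : X.Modules} {V : X.Opens} {s : Γ(M, V)} (hs : IsFrame s)
    {W : X.Opens} (h : W ≤ V) :
    Function.Bijective fun n : Γ(N, W) => n ⊗ₜ[Γ(X, W)] (M.presheaf.map (homOfLE h).op s) := by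
  let e : Γ(X, W) ≃ₗ[Γ(X, W)] Γ(M, W) := LinearEquiv.ofBijective
    (LinearMap.toSpanSingleton Γ(X, W) Γ(M, W) (M.presheaf.map (homOfLE h).op s)) (hs W h)
  convert ((TensorProduct.rid Γ(X, W) Γ(N, W)).symm.trans
    (TensorProduct.congr (LinearEquiv.refl Γ(X, W) Γ(N, W)) e)).bijective using 1
  ext n
  have : e 1 = M.presheaf.map (homOfLE h).op s := by
    simp only [e]
    exact one_smul _ _
  simp [this]

lemma w_toTensor (N M : X.Modules) : (Opens.grothendieckTopology X).W
    ((PresheafOfModules.toPresheaf _).map (toTensor N M)) := by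
  have : (PresheafOfModules.toPresheaf _).map (toTensor N M) = toSheafify (Opens.grothendieckTopology X)
      ((presheafTensor M).obj ((toPresheafOfModules X).obj N)).presheaf :=
    PresheafOfModules.toPresheaf_map_sheafificationAdjunction_unit_app (𝟙 X.ringCatSheaf.obj) _
  rw [this]
  exact GrothendieckTopology.W_toSheafify _ _

instance (N M : X.Modules) : Presheaf.IsLocallyInjective (Opens.grothendieckTopology X)
    ((PresheafOfModules.toPresheaf _).map (toTensor N M)) :=
  (w_toTensor N M).isLocallyInjective

instance (N M : X.Modules) : Presheaf.IsLocallySurjective (Opens.grothendieckTopology X)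
    ((PresheafOfModules.toPresheaf _).map (toTensor N M)) :=
  (w_toTensor N M).isLocallySurjective

lemma exists_tmul_eq_of_tmul_eq {N M : X.Modules} {W : X.Opens} {n n' : Γ(N, W)} {s : Γ(M, W)}
    (h : tmul n s = tmul n' s) (x : X) (hx : x ∈ W) :
    ∃ (U : X.Opens) (f : U ⟶ W), x ∈ U ∧
      N.presheaf.map f.op n ⊗ₜ[Γ(X, U)] M.presheaf.map f.op s =
        N.presheaf.map f.op n' ⊗ₜ[Γ(X, U)] M.presheaf.map f.op s := by
  obtain ⟨U, f, hU, hxU⟩ := Presheaf.equalizerSieve_mem (Opens.grothendieckTopology X)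
    ((PresheafOfModules.toPresheaf _).map (toTensor N M)) (X := op W)
    (n ⊗ₜ[Γ(X, W)] s) (n' ⊗ₜ[Γ(X, W)] s) h x hx
  exact ⟨U, f, hxU, hU⟩

lemma exists_toTensor_eq {N M : X.Modules} {W : X.Opens} (t : Γ((tensorFunctor M).obj N, W))
    (x : X) (hx : x ∈ W) :
    ∃ (U : X.Opens) (f : U ⟶ W) (p : TensorProduct Γ(X, U) Γ(N, U) Γ(M, U)), x ∈ U ∧
      ((toTensor N M).app (op U)).hom p = ((tensorFunctor M).obj N).presheaf.map f.op t := by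
  obtain ⟨U, f, ⟨p, hp⟩, hxU⟩ := Presheaf.imageSieve_mem (Opens.grothendieckTopology X)
    ((PresheafOfModules.toPresheaf _).map (toTensor N M)) (U := op W) t x hx
  exact ⟨U, f, p, hxU, hp⟩

lemma presheaf_map_map (N : X.Modules) {U V W : X.Opens} (f : U ⟶ V) (g : V ⟶ W) (h : U ⟶ W)
    (n : Γ(N, W)) : N.presheaf.map f.op (N.presheaf.map g.op n) = N.presheaf.map h.op n := by
  rw [show h = f ≫ g from rfl, op_comp, Functor.map_comp]
  rfl

lemma bijective_tmul {N M : X.Modules} {V : X.Opens} {s : Γ(M, V)} (hs : IsFrame s)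
    {W : X.Opens} (h : W ≤ V) :
    Function.Bijective fun n : Γ(N, W) => tmul n (M.presheaf.map (homOfLE h).op s) := by
  have hinj : ∀ (W : X.Opens) (h : W ≤ V),
      Function.Injective fun n : Γ(N, W) => tmul n (M.presheaf.map (homOfLE h).op s) := by
    intro W h n n' hn
    choose U f hx hU using fun x : W => exists_tmul_eq_of_tmul_eq hn x.1 x.2
    refine TopCat.Sheaf.eq_of_locally_eq' ⟨N.presheaf, N.isSheaf⟩ U W f
      (fun x hx' => Opens.mem_iSup.2 ⟨⟨x, hx'⟩, hx _⟩) _ _ fun x => ?_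
    refine (bijective_tmul_presheaf hs ((f x).le.trans h)).1 ?_
    have := hU x
    rwa [presheaf_map_map _ _ _ (homOfLE ((f x).le.trans h))] at this
  refine ⟨hinj W h, fun t => ?_⟩
  choose U f p hx hU using fun x : W => exists_toTensor_eq t x.1 x.2
  choose n hn using fun x => (bijective_tmul_presheaf hs ((f x).le.trans h)).2 (p x)
  have hn' : ∀ x, tmul (n x) (M.presheaf.map (homOfLE ((f x).le.trans h)).op s) =
      ((tensorFunctor M).obj N).presheaf.map (f x).op t := by
    intro x
    rw [← hU x, ← hn x]
    rfl
  obtain ⟨m, hm, -⟩ := TopCat.Sheaf.existsUnique_gluing' ⟨N.presheaf, N.isSheaf⟩ U W f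
    (fun x hx' => Opens.mem_iSup.2 ⟨⟨x, hx'⟩, hx _⟩) n (by
      intro x y
      refine hinj _ (inf_le_left.trans ((f x).le.trans h)) ?_
      have h1 := congr(((tensorFunctor M).obj N).presheaf.map (Opens.infLELeft (U x) (U y)).op $(hn' x))
      have h2 := congr(((tensorFunctor M).obj N).presheaf.map (Opens.infLERight (U x) (U y)).op $(hn' y))
      rw [presheaf_map_map _ _ _ (Opens.infLELeft (U x) (U y) ≫ f x), map_tmul,
        presheaf_map_map _ _ _ (homOfLE (inf_le_left.trans ((f x).le.trans h)))] at h1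
      rw [presheaf_map_map _ _ _ (Opens.infLELeft (U x) (U y) ≫ f x), map_tmul,
        presheaf_map_map _ _ _ (homOfLE (inf_le_left.trans ((f x).le.trans h)))] at h2
      exact h1.trans h2.symm)
  refine ⟨m, ?_⟩
  refine TopCat.Sheaf.eq_of_locally_eq' ⟨((tensorFunctor M).obj N).presheaf, Modules.isSheaf _⟩ U W f
      (fun x hx' => Opens.mem_iSup.2 ⟨⟨x, hx'⟩, hx _⟩) _ _ fun x => ?_
  rw [← hn' x, ← hm x]
  refine (map_tmul _ _ _).trans ?_
  rw [presheaf_map_map _ _ _ (homOfLE ((f x).le.trans h))]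


/-- A morphism of modules from a compatible family of linear maps. -/
noncomputable def homMk {M N : X.Modules} (φ : M.presheaf ⟶ N.presheaf)
    (hφ : ∀ (U : X.Opens) (r : Γ(X, U)) (m : Γ(M, U)), φ.app (op U) (r • m) = r • φ.app (op U) m) :
    M ⟶ N where
  val := PresheafOfModules.homMk φ fun U r m => hφ U.unop r m

/-- The morphism `n ↦ n ⊗ s` over the open subset on which `s` is defined. -/
noncomputable def restrictToTensor (N : X.Modules) {M : X.Modules} {V : X.Opens} (s : Γ(M, V)) :
    N.restrict V.ι ⟶ ((tensorFunctor M).obj N).restrict V.ι :=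
  homMk
    { app W := AddCommGrpCat.ofHom
        { toFun n := tmul (W := V.ι ''ᵁ W.unop) n
            (M.presheaf.map (homOfLE (Scheme.Opens.ι_image_le V _)).op s)
          map_zero' := (congrArg _ (TensorProduct.zero_tmul _ _)).trans (map_zero _)
          map_add' n n' := tmul_add_left _ _ _ }
      naturality := by
        intro W W' f
        ext n
        have := map_tmul (V.ι.opensFunctor.map f.unop) n
            (M.presheaf.map (homOfLE (Scheme.Opens.ι_image_le V _)).op s)
        rw [presheaf_map_map _ _ _ (homOfLE (Scheme.Opens.ι_image_le V _))] at this
        exact this.symm }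
    (fun U r n => tmul_smul_left (N := N) (W := V.ι ''ᵁ U) ((V.ι.appIso U).inv r) n _)

lemma isIso_restrictToTensor (N : X.Modules) {M : X.Modules} {V : X.Opens} {s : Γ(M, V)}
    (hs : IsFrame s) : IsIso (restrictToTensor N s) := by
  rw [Hom.isIso_iff_isIso_app]
  intro U
  exact (ConcreteCategory.isIso_iff_bijective _).2 (bijective_tmul hs _)

/-- If `s` is a frame of `M` over `V`, then `n ↦ n ⊗ s` is an isomorphism over `V`. -/
noncomputable def restrictIsoTensor {M : X.Modules} {V : X.Opens} {s : Γ(M, V)} (hs : IsFrame s) :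
    restrictFunctor V.ι ≅ tensorFunctor M ⋙ restrictFunctor V.ι :=
  NatIso.ofComponents (fun N => @asIso _ _ _ _ (restrictToTensor N s) (isIso_restrictToTensor N hs))
    (by
      intro N N' φ
      apply hom_ext
      intro U
      ext n
      exact (app_tmul φ n _).symm)

/-- The structure sheaf of `X` as a module over itself. -/
noncomputable def structureModule (X : Scheme.{u}) : X.Modules := SheafOfModules.unit X.ringCatSheaf

/-- Line bundles: sheaves of modules locally isomorphic to the structure sheaf. -/
def IsInvertible (M : X.Modules) : Prop :=
  ∀ x : X, ∃ V : X.Opens, x ∈ V ∧ Nonempty (M.restrict V.ι ≅ structureModule V)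

/-- A section of the structure sheaf as a section of `structureModule X`. -/
noncomputable def ofSection {U : X.Opens} (r : Γ(X, U)) : Γ(structureModule X, U) := r

lemma ofSection_bijective {U : X.Opens} : Function.Bijective (ofSection (X := X) (U := U)) :=
  Function.bijective_id

lemma smul_ofSection {U : X.Opens} (r s : Γ(X, U)) : r • ofSection s = ofSection (r * s) := rfl

lemma map_ofSection {U V : X.Opens} (h : U ⟶ V) (r : Γ(X, V)) :
    (structureModule X).presheaf.map h.op (ofSection r) = ofSection (X.presheaf.map h.op r) := rfl

lemma app_smul_ofSection_one {M : X.Modules} (φ : structureModule X ⟶ M) {U : X.Opens} (r : Γ(X, U)) :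
    φ.app U (ofSection r) = r • φ.app U (ofSection 1) := by
  rw [← Hom.app_smul, smul_ofSection, mul_one]

lemma exists_isFrame_of_iso {M : X.Modules} {V : X.Opens}
    (e : M.restrict V.ι ≅ structureModule V) : ∃ s : Γ(M, V), IsFrame s := by
  let s' : Γ(M, V.ι ''ᵁ ⊤) := e.inv.app ⊤ (ofSection 1)
  refine ⟨M.presheaf.map (homOfLE V.ι_image_top.ge).op s', fun W h => ?_⟩
  obtain ⟨U, rfl⟩ : ∃ U : V.toScheme.Opens, V.ι ''ᵁ U = W := ⟨V.ι ⁻¹ᵁ W, by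
    rw [Scheme.Hom.image_preimage_eq_opensRange_inf, Scheme.Opens.opensRange_ι]
    exact inf_eq_right.2 h⟩
  rw [presheaf_map_map _ _ _ (V.ι.opensFunctor.map (homOfLE (le_top : U ≤ ⊤)))]
  have hs : M.presheaf.map (V.ι.opensFunctor.map (homOfLE (le_top : U ≤ ⊤))).op s' =
      e.inv.app U (ofSection 1) := by
    have := app_map e.inv (homOfLE (le_top : U ≤ ⊤)) (ofSection 1)
    rw [map_ofSection, map_one] at this
    exact this.symm
  rw [hs]
  have key : ∀ r : Γ(X, V.ι ''ᵁ U),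
      r • (show Γ(M, V.ι ''ᵁ U) from e.inv.app U (ofSection 1)) =
      e.inv.app U (ofSection ((V.ι.appIso U).hom r)) := by
    intro r
    have h3 : (V.ι.appIso U).inv ((V.ι.appIso U).hom r) = r :=
      congr($((V.ι.appIso U).hom_inv_id) r)
    exact (congrArg (fun a : Γ(X, V.ι ''ᵁ U) => a • (show Γ(M, V.ι ''ᵁ U) from
      e.inv.app U (ofSection 1))) h3.symm).trans (app_smul_ofSection_one e.inv _).symm
  have h1 : Function.Bijective (e.inv.app U) :=
    (ConcreteCategory.isIso_iff_bijective _).1 inferInstance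
  have h2 : Function.Bijective (V.ι.appIso U).hom :=
    (ConcreteCategory.isIso_iff_bijective _).1 inferInstance
  have h3 := h1.comp (ofSection_bijective.comp h2)
  rw [Function.bijective_iff_existsUnique] at h3 ⊢
  intro b
  obtain ⟨r, hr, hr'⟩ := h3 b
  exact ⟨r, (key r).trans hr, fun r' h => hr' r' ((key r').symm.trans h)⟩


lemma isZero_iff_subsingleton (N : X.Modules) : IsZero N ↔ ∀ U : X.Opens, Subsingleton Γ(N, U) := by
  constructor
  · intro h U
    exact AddCommGrpCat.subsingleton_of_isZero ((sectionsFunctor U).map_isZero h)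
  · intro h
    rw [IsZero.iff_id_eq_zero]
    apply hom_ext
    intro U
    ext n
    exact (h U).elim _ _

lemma isZero_restrict_iff {N : X.Modules} {V : X.Opens} :
    IsZero (N.restrict V.ι) ↔ ∀ W : X.Opens, W ≤ V → Subsingleton Γ(N, W) := by
  rw [isZero_iff_subsingleton]
  constructor
  · intro h W hW
    obtain ⟨U, rfl⟩ : ∃ U : V.toScheme.Opens, V.ι ''ᵁ U = W := ⟨V.ι ⁻¹ᵁ W, by
      rw [Scheme.Hom.image_preimage_eq_opensRange_inf, Scheme.Opens.opensRange_ι]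
      exact inf_eq_right.2 hW⟩
    exact h U
  · intro h U
    exact h _ (Scheme.Opens.ι_image_le V _)

lemma isZero_of_forall_exists {N : X.Modules}
    (h : ∀ x : X, ∃ V : X.Opens, x ∈ V ∧ IsZero (N.restrict V.ι)) : IsZero N := by
  rw [isZero_iff_subsingleton]
  choose V hxV hV using h
  refine fun U => ⟨fun a b => ?_⟩
  refine TopCat.Sheaf.eq_of_locally_eq' ⟨N.presheaf, N.isSheaf⟩ (fun x : U => V x.1 ⊓ U) U
    (fun x => homOfLE inf_le_right) (fun x hx => Opens.mem_iSup.2 ⟨⟨x, hx⟩, hxV x, hx⟩) _ _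
    fun x => ?_
  exact (isZero_restrict_iff.1 (hV x.1) _ inf_le_left).elim _ _

lemma exact_of_forall_exists {S : ShortComplex X.Modules}
    (h : ∀ x : X, ∃ V : X.Opens, x ∈ V ∧ (S.map (restrictFunctor V.ι)).Exact) : S.Exact := by
  rw [ShortComplex.exact_iff_isZero_homology]
  refine isZero_of_forall_exists fun x => ?_
  obtain ⟨V, hx, hV⟩ := h x
  rw [ShortComplex.exact_iff_isZero_homology] at hV
  exact ⟨V, hx, hV.of_iso (S.mapHomologyIso (restrictFunctor V.ι)).symm⟩

lemma isCoherent_restrict {N : Y.Modules} (hN : isCoherent Y N) (f : X ⟶ Y) [IsOpenImmersion f] :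
    isCoherent X (N.restrict f) := by
  intro x
  obtain ⟨R, i, hi, hx, hU, h⟩ := exists_isTildeFinite hN (f x) f.opensRange ⟨x, rfl⟩
  let g := IsOpenImmersion.lift f i hU
  have hg : g ≫ f = i := IsOpenImmersion.lift_fac _ _ _
  have : IsOpenImmersion g := by
    have : IsOpenImmersion (g ≫ f) := by rw [hg]; infer_instance
    exact IsOpenImmersion.of_comp g f
  refine ⟨R, g, this, ?_, h.of_iso ((restrictFunctorCongr hg).symm.app N ≪≫
    (restrictFunctorComp g f).app N)⟩
  obtain ⟨y, hy⟩ := hx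
  refine ⟨y, f.isOpenEmbedding.injective ?_⟩
  rw [← hy, ← hg]
  rfl

lemma isCoherent_of_forall_exists {N : X.Modules}
    (h : ∀ x : X, ∃ V : X.Opens, x ∈ V ∧ isCoherent V (N.restrict V.ι)) : isCoherent X N := by
  intro x
  obtain ⟨V, hx, hV⟩ := h x
  obtain ⟨R, i, hi, ⟨y, hy⟩, H⟩ := hV ⟨x, hx⟩
  refine ⟨R, i ≫ V.ι, inferInstance, ⟨y, ?_⟩, H.of_iso ((restrictFunctorComp i V.ι).symm.app N)⟩
  rw [Scheme.Hom.comp_apply, hy]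
  rfl

lemma IsInvertible.exists_isFrame {M : X.Modules} (hM : IsInvertible M) (x : X) :
    ∃ (V : X.Opens) (s : Γ(M, V)), x ∈ V ∧ IsFrame s := by
  obtain ⟨V, hx, ⟨e⟩⟩ := hM x
  obtain ⟨s, hs⟩ := exists_isFrame_of_iso e
  exact ⟨V, s, hx, hs⟩

lemma IsInvertible.isCoherent_tensor {M : X.Modules} (hM : IsInvertible M) {N : X.Modules}
    (hN : isCoherent X N) : isCoherent X ((tensorFunctor M).obj N) :=
  isCoherent_of_forall_exists fun x => by
    obtain ⟨V, s, hx, hs⟩ := hM.exists_isFrame x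
    exact ⟨V, hx, (isCoherent V).prop_of_iso ((restrictIsoTensor hs).app N)
      (isCoherent_restrict hN V.ι)⟩

lemma IsInvertible.exact_tensor {M : X.Modules} (hM : IsInvertible M) {S : ShortComplex X.Modules}
    (hS : S.Exact) : (S.map (tensorFunctor M)).Exact :=
  exact_of_forall_exists fun x => by
    obtain ⟨V, s, hx, hs⟩ := hM.exists_isFrame x
    refine ⟨V, hx, ?_⟩
    have h := hS.map (restrictFunctor V.ι)
    exact ShortComplex.exact_of_iso (S.mapNatIso (restrictIsoTensor hs)) h

/-- The category of coherent sheaves, abelian if `X` is locally Noetherian. -/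
abbrev Coh (X : Scheme.{u}) := (isCoherent X).FullSubcategory

instance [IsLocallyNoetherian X] : PreservesFiniteLimits (isCoherent X).ι := by
  have := (isCoherent X).preservesKernels_ι
  apply Functor.preservesFiniteLimits_of_preservesKernels
instance [IsLocallyNoetherian X] : PreservesFiniteColimits (isCoherent X).ι := by
  have := (isCoherent X).preservesCokernels_ι
  apply Functor.preservesFiniteColimits_of_preservesCokernels

/-- Pull-back of coherent sheaves along an open immersion. -/
noncomputable def cohRestrict (f : X ⟶ Y) [IsOpenImmersion f] : Coh Y ⥤ Coh X :=
  (isCoherent X).lift ((isCoherent Y).ι ⋙ restrictFunctor f)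
    fun N => isCoherent_restrict N.property f

/-- The functor `N ↦ N ⊗ M` on coherent sheaves, for a line bundle `M`. -/
noncomputable def cohTensor {M : X.Modules} (hM : IsInvertible M) : Coh X ⥤ Coh X :=
  (isCoherent X).lift ((isCoherent X).ι ⋙ tensorFunctor M)
    fun N => hM.isCoherent_tensor N.property


instance (f : X ⟶ Y) [IsOpenImmersion f] : (cohRestrict f).Additive where
  map_add {M N a b} := by
    apply (isCoherent X).ι.map_injective
    exact (restrictFunctor f).map_add (f := a.hom) (g := b.hom)

instance {M : X.Modules} (hM : IsInvertible M) : (cohTensor hM).Additive where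
  map_add {N N' a b} := by
    apply (isCoherent X).ι.map_injective
    exact (tensorFunctor M).map_add (f := a.hom) (g := b.hom)

instance [IsLocallyNoetherian X] [IsLocallyNoetherian Y] (f : X ⟶ Y) [IsOpenImmersion f] :
    PreservesFiniteLimits (cohRestrict f) where
  preservesFiniteLimits J _ _ := by
    have : PreservesLimitsOfShape J (cohRestrict f ⋙ (isCoherent X).ι) :=
      inferInstanceAs (PreservesLimitsOfShape J ((isCoherent Y).ι ⋙ restrictFunctor f))
    have := fullyFaithful_reflectsLimits (isCoherent X).ι
    exact preservesLimitsOfShape_of_reflects_of_preserves (cohRestrict f) (isCoherent X).ι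

instance [IsLocallyNoetherian X] [IsLocallyNoetherian Y] (f : X ⟶ Y) [IsOpenImmersion f] :
    PreservesFiniteColimits (cohRestrict f) where
  preservesFiniteColimits J _ _ := by
    have : PreservesColimitsOfShape J (cohRestrict f ⋙ (isCoherent X).ι) :=
      inferInstanceAs (PreservesColimitsOfShape J ((isCoherent Y).ι ⋙ restrictFunctor f))
    have := fullyFaithful_reflectsColimits (isCoherent X).ι
    exact preservesColimitsOfShape_of_reflects_of_preserves (cohRestrict f) (isCoherent X).ι

lemma IsInvertible.preserves {M : X.Modules} (hM : IsInvertible M) :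
    PreservesFiniteLimits (tensorFunctor M) ∧ PreservesFiniteColimits (tensorFunctor M) :=
  ((Functor.exact_tfae (tensorFunctor M)).out 1 3).1 fun _ hS => hM.exact_tensor hS

instance [IsLocallyNoetherian X] {M : X.Modules} (hM : IsInvertible M) :
    PreservesFiniteLimits (cohTensor hM) where
  preservesFiniteLimits J _ _ := by
    have := hM.preserves.1
    have : PreservesLimitsOfShape J (cohTensor hM ⋙ (isCoherent X).ι) :=
      inferInstanceAs (PreservesLimitsOfShape J ((isCoherent X).ι ⋙ tensorFunctor M))
    have := fullyFaithful_reflectsLimits (isCoherent X).ι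
    exact preservesLimitsOfShape_of_reflects_of_preserves (cohTensor hM) (isCoherent X).ι

instance [IsLocallyNoetherian X] {M : X.Modules} (hM : IsInvertible M) :
    PreservesFiniteColimits (cohTensor hM) where
  preservesFiniteColimits J _ _ := by
    have := hM.preserves.2
    have : PreservesColimitsOfShape J (cohTensor hM ⋙ (isCoherent X).ι) :=
      inferInstanceAs (PreservesColimitsOfShape J ((isCoherent X).ι ⋙ tensorFunctor M))
    have := fullyFaithful_reflectsColimits (isCoherent X).ι
    exact preservesColimitsOfShape_of_reflects_of_preserves (cohTensor hM) (isCoherent X).ι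

noncomputable instance [IsLocallyNoetherian X] : HasDerivedCategory.{u + 1} (Coh X) :=
  HasDerivedCategory.standard _

/-- The support of a sheaf of modules: the points at which the stalk is nonzero. -/
def support (N : X.Modules) : Set X := {x | Nontrivial (N.presheaf.stalk x)}

lemma support_subset_iff {N : X.Modules} {V : X.Opens} :
    N.support ⊆ (V : Set X)ᶜ ↔ IsZero (N.restrict V.ι) := by
  rw [isZero_restrict_iff]
  constructor
  · intro h W hW
    refine ⟨fun a b => ?_⟩
    refine TopCat.Presheaf.section_ext ⟨N.presheaf, N.isSheaf⟩ W a b fun x hx => ?_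
    have : ¬ Nontrivial (N.presheaf.stalk x) := fun h' => h h' (hW hx)
    exact (not_nontrivial_iff_subsingleton.1 this).elim _ _
  · intro h x hx hxV
    refine (not_nontrivial_iff_subsingleton.2 (⟨fun a b => ?_⟩ : Subsingleton (N.presheaf.stalk x))) hx
    obtain ⟨W, hW, a, rfl⟩ := TopCat.Presheaf.exists_germ_eq N.presheaf a
    obtain ⟨W', hW', b, rfl⟩ := TopCat.Presheaf.exists_germ_eq N.presheaf b
    rw [← TopCat.Presheaf.germ_res_apply N.presheaf (homOfLE (inf_le_right : V ⊓ W ≤ W)) x ⟨hxV, hW⟩,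
      (h (V ⊓ W) inf_le_left).elim (N.presheaf.map (homOfLE (inf_le_right : V ⊓ W ≤ W)).op a) 0,
      ← TopCat.Presheaf.germ_res_apply N.presheaf (homOfLE (inf_le_right : V ⊓ W' ≤ W')) x ⟨hxV, hW'⟩,
      (h (V ⊓ W') inf_le_left).elim (N.presheaf.map (homOfLE (inf_le_right : V ⊓ W' ≤ W')).op b) 0,
      map_zero, map_zero]


section
variable {A B : Type*} [Category* A] [Category* B] [Abelian A] [Abelian B] [HasDerivedCategory A]
  [HasDerivedCategory B] (F : A ⥤ B) [F.Additive] [PreservesFiniteLimits F] [PreservesFiniteColimits F]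

lemma nonempty_homology_mapDerivedCategory_iso (K : DerivedCategory A) (n : ℤ) :
    Nonempty ((DerivedCategory.homologyFunctor B n).obj (F.mapDerivedCategory.obj K) ≅
      F.obj ((DerivedCategory.homologyFunctor A n).obj K)) := by
  let L := DerivedCategory.Q.objPreimage K
  let e : DerivedCategory.Q.obj L ≅ K := DerivedCategory.Q.objObjPreimageIso K
  let e₁ : F.mapDerivedCategory.obj K ≅
      DerivedCategory.Q.obj ((F.mapHomologicalComplex (ComplexShape.up ℤ)).obj L) :=
    F.mapDerivedCategory.mapIso e.symm ≪≫ F.mapDerivedCategoryFactors.app L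
  exact ⟨(DerivedCategory.homologyFunctor B n).mapIso e₁ ≪≫
    (DerivedCategory.homologyFunctorFactors B n).app _ ≪≫
    (L.sc n).mapHomologyIso F ≪≫
    F.mapIso (((DerivedCategory.homologyFunctorFactors A n).app L).symm ≪≫
      (DerivedCategory.homologyFunctor A n).mapIso e)⟩

lemma bounded_mapDerivedCategory {K : DerivedCategory A}
    (hK : DerivedCategory.TStructure.t.bounded K) :
    DerivedCategory.TStructure.t.bounded (F.mapDerivedCategory.obj K) := by
  obtain ⟨⟨a, ha⟩, ⟨b, hb⟩⟩ := hK
  refine ⟨⟨a, (DerivedCategory.isGE_iff _ _).2 fun i hi => ?_⟩,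
    ⟨b, (DerivedCategory.isLE_iff _ _).2 fun i hi => ?_⟩⟩
  · obtain ⟨e⟩ := nonempty_homology_mapDerivedCategory_iso F K i
    exact (F.map_isZero ((DerivedCategory.isGE_iff _ _).1 ha i hi)).of_iso e
  · obtain ⟨e⟩ := nonempty_homology_mapDerivedCategory_iso F K i
    exact (F.map_isZero ((DerivedCategory.isLE_iff _ _).1 hb i hi)).of_iso e
end

end AlgebraicGeometry.Scheme.Modules

namespace AlgebraicGeometry
open Scheme Modules
variable {k : Type u} [Field k]

/-- The subset `A` of `Y` is the underlying set of a closed subscheme `Z` of `Y` that is proper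
over `k`. -/
def IsProperSubset (Y : Over (Spec (.of k))) (A : Set Y.left) : Prop :=
  ∃ (Z : Scheme.{u}) (i : Z ⟶ Y.left), IsClosedImmersion i ∧ IsProper (i ≫ Y.hom) ∧ Set.range i = A

lemma isProper_coprodDesc {Z Z' S : Scheme.{u}} (f : Z ⟶ S) (g : Z' ⟶ S) [IsProper f] [IsProper g] :
    IsProper (coprod.desc f g) := by
  have h : coprod.desc f g = coprod.map f g ≫ coprod.desc (𝟙 S) (𝟙 S) := by simp
  have : IsProper (coprod.map f g) := IsZariskiLocalAtTarget.coprodMap f g ‹_› ‹_›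
  rw [h]
  infer_instance

lemma IsProperSubset.union {Y : Over (Spec (.of k))} [IsSeparated Y.hom] [LocallyOfFiniteType Y.hom]
    {A B : Set Y.left} (hA : IsProperSubset Y A) (hB : IsProperSubset Y B) :
    IsProperSubset Y (A ∪ B) := by
  obtain ⟨Z, i, hi, hZ, rfl⟩ := hA
  obtain ⟨Z', i', hi', hZ', rfl⟩ := hB
  let g := coprod.desc i i'
  have hg : IsProper (g ≫ Y.hom) := by
    rw [show g ≫ Y.hom = coprod.desc (i ≫ Y.hom) (i' ≫ Y.hom) by simp [g]]
    exact isProper_coprodDesc _ _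
  have : IsProper g := IsProper.of_comp g Y.hom
  have : Surjective g.toImage := inferInstance
  have hu : UniversallyClosed (g.imageι ≫ Y.hom) := by
    have : UniversallyClosed (g.toImage ≫ g.imageι ≫ Y.hom) := by
      rw [Hom.toImage_imageι_assoc]; infer_instance
    exact UniversallyClosed.of_comp_surjective g.toImage _
  refine ⟨g.image, g.imageι, inferInstance, ?_, ?_⟩
  · exact { }
  · have h : g.toImage ≫ g.imageι = g := Hom.toImage_imageι g
    ext y
    constructor
    · rintro ⟨z, rfl⟩
      obtain ⟨w, rfl⟩ := g.toImage.surjective z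
      rw [← Scheme.Hom.comp_apply, h]
      obtain ⟨v | v, rfl⟩ := (coprodMk Z Z').surjective w
      · exact Or.inl ⟨v, by rw [coprodMk_inl, ← Scheme.Hom.comp_apply, coprod.inl_desc]⟩
      · exact Or.inr ⟨v, by rw [coprodMk_inr, ← Scheme.Hom.comp_apply, coprod.inr_desc]⟩
    · have hr : ∀ w, g w ∈ Set.range g.imageι := fun w =>
        ⟨g.toImage w, by rw [← Scheme.Hom.comp_apply, h]⟩
      rintro (⟨v, rfl⟩ | ⟨v, rfl⟩)
      · have := hr ((coprod.inl : Z ⟶ Z ⨿ Z') v)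
        rwa [← Scheme.Hom.comp_apply, coprod.inl_desc] at this
      · have := hr ((coprod.inr : Z' ⟶ Z ⨿ Z') v)
        rwa [← Scheme.Hom.comp_apply, coprod.inr_desc] at this

lemma isProperSubset_empty (Y : Over (Spec (.of k))) : IsProperSubset Y ∅ :=
  ⟨∅, Scheme.emptyTo _, inferInstance, inferInstance, Set.range_eq_empty _⟩

lemma IsProperSubset.isClosed {Y : Over (Spec (.of k))} {A : Set Y.left} (hA : IsProperSubset Y A) :
    IsClosed A := by
  obtain ⟨Z, i, hi, -, rfl⟩ := hA
  exact i.isClosedEmbedding.isClosed_range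

section
variable {W : Scheme.{u}} [IsLocallyNoetherian W]

lemma isZero_of_forall_homology {A : Type*} [Category* A] [Abelian A] [HasDerivedCategory A]
    {K : DerivedCategory A} (h : ∀ n : ℤ, IsZero ((DerivedCategory.homologyFunctor A n).obj K)) :
    IsZero K := by
  have h₁ : K.IsLE 0 := (DerivedCategory.isLE_iff _ _).2 fun i _ => h i
  have h₂ : K.IsGE 1 := (DerivedCategory.isGE_iff _ _).2 fun i _ => h i
  exact DerivedCategory.TStructure.t.isZero K 0 1 (by lia)

lemma support_homology_subset_iff (V : W.Opens) (F : DerivedCategory (Coh W)) :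
    (∀ n : ℤ, ((DerivedCategory.homologyFunctor (Coh W) n).obj F).obj.support ⊆ (V : Set W)ᶜ) ↔
      IsZero ((cohRestrict V.ι).mapDerivedCategory.obj F) := by
  simp only [support_subset_iff]
  constructor
  · intro h
    refine isZero_of_forall_homology fun n => ?_
    obtain ⟨e⟩ := nonempty_homology_mapDerivedCategory_iso (cohRestrict V.ι) F n
    refine IsZero.of_iso ?_ e
    rw [IsZero.iff_id_eq_zero]
    exact (isCoherent V).ι.map_injective ((h n).eq_of_src _ _)
  · intro h n
    obtain ⟨e⟩ := nonempty_homology_mapDerivedCategory_iso (cohRestrict V.ι) F n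
    exact (isCoherent V).ι.map_isZero
      (((DerivedCategory.homologyFunctor (Coh V) n).map_isZero h).of_iso e.symm)

/-- The objects `F` of the derived category of coherent sheaves on `W` such that all cohomology
sheaves of `F` are supported in the preimage under `p : W ⟶ Y` of a single proper subscheme of
`Y`. -/
def IsSupportedOver (Y : Over (Spec (.of k))) (p : W ⟶ Y.left) :
    ObjectProperty (DerivedCategory (Coh W)) := fun F =>
  ∃ A : Set Y.left, IsProperSubset Y A ∧
    ∀ n : ℤ, ((DerivedCategory.homologyFunctor (Coh W) n).obj F).obj.support ⊆ p ⁻¹' A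

variable {Y : Over (Spec (.of k))} (p : W ⟶ Y.left)

lemma isSupportedOver_iff (F : DerivedCategory (Coh W)) : IsSupportedOver Y p F ↔
    ∃ V : W.Opens, IsZero ((cohRestrict V.ι).mapDerivedCategory.obj F) ∧
      ∃ A : Set Y.left, IsProperSubset Y A ∧ (V : Set W)ᶜ = p ⁻¹' A := by
  constructor
  · rintro ⟨A, hA, h⟩
    have hV : (((⟨(p ⁻¹' A)ᶜ, (hA.isClosed.preimage p.continuous).isOpen_compl⟩ : W.Opens) : Set W))ᶜ = p ⁻¹' A :=
      compl_compl _
    refine ⟨_, (support_homology_subset_iff _ F).1 ?_, A, hA, hV⟩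
    rwa [hV]
  · rintro ⟨V, h, A, hA, hV⟩
    refine ⟨A, hA, ?_⟩
    rw [← hV]
    exact (support_homology_subset_iff _ F).2 h

instance : (IsSupportedOver Y p).IsClosedUnderIsomorphisms where
  of_iso e h := by
    rw [isSupportedOver_iff] at h ⊢
    obtain ⟨V, h, hA⟩ := h
    exact ⟨V, h.of_iso ((cohRestrict V.ι).mapDerivedCategory.mapIso e.symm), hA⟩

instance [IsSeparated Y.hom] [LocallyOfFiniteType Y.hom] : (IsSupportedOver Y p).IsTriangulated where
  exists_zero := by
    obtain ⟨Z, hZ⟩ := HasZeroObject.zero (C := DerivedCategory (Coh W))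
    refine ⟨Z, hZ, (isSupportedOver_iff _ _).2 ⟨⊤, Functor.map_isZero _ hZ, ∅,
      isProperSubset_empty Y, by simp⟩⟩
  isStableUnderShiftBy a := ⟨fun F h => by
    rw [isSupportedOver_iff] at h
    obtain ⟨V, h, hA⟩ := h
    exact (isSupportedOver_iff _ _).2 ⟨V, ((shiftFunctor _ a).map_isZero h).of_iso
      (((cohRestrict V.ι).mapDerivedCategory.commShiftIso a).app F), hA⟩⟩
  ext₂' T hT h₁ h₃ := by
    refine ObjectProperty.le_isoClosure _ _ ?_
    obtain ⟨A, hA, hA'⟩ := h₁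
    obtain ⟨B, hB, hB'⟩ := h₃
    have hAB := hA.union hB
    let V : W.Opens := ⟨(p ⁻¹' (A ∪ B))ᶜ, (hAB.isClosed.preimage p.continuous).isOpen_compl⟩
    have hV : (V : Set W)ᶜ = p ⁻¹' (A ∪ B) := compl_compl _
    refine (isSupportedOver_iff _ _).2 ⟨V, ?_, A ∪ B, hAB, hV⟩
    have h := (cohRestrict V.ι).mapDerivedCategory.map_distinguished T hT
    refine Pretriangulated.Triangle.isZero₂_of_isZero₁₃ _ h ?_ ?_
    · refine (support_homology_subset_iff _ _).1 fun n => (hA' n).trans ?_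
      rw [hV]
      exact Set.preimage_mono Set.subset_union_left
    · refine (support_homology_subset_iff _ _).1 fun n => (hB' n).trans ?_
      rw [hV]
      exact Set.preimage_mono Set.subset_union_right

end

end AlgebraicGeometry

namespace AlgebraicGeometry.Scheme.Modules
variable {X Y : Scheme.{u}}

lemma IsInvertible.subsingleton_tensor {M : X.Modules} (hM : IsInvertible M) {N : X.Modules}
    {V : X.Opens} (h : IsZero (N.restrict V.ι)) : IsZero (((tensorFunctor M).obj N).restrict V.ι) := by
  rw [isZero_restrict_iff] at h ⊢
  refine fun W hW => ⟨fun a b => ?_⟩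
  choose U s hU hs using hM.exists_isFrame
  refine TopCat.Sheaf.eq_of_locally_eq' ⟨((tensorFunctor M).obj N).presheaf, Modules.isSheaf _⟩
    (fun x : W => U x.1 ⊓ W) W
    (fun x => homOfLE inf_le_right) (fun x hx => Opens.mem_iSup.2 ⟨⟨x, hx⟩, hU x, hx⟩) _ _
    fun x => ?_
  obtain ⟨a', ha⟩ := (bijective_tmul (N := N) (hs x.1) (W := U x.1 ⊓ W) inf_le_left).2
    (((tensorFunctor M).obj N).presheaf.map (homOfLE inf_le_right).op a)
  obtain ⟨b', hb⟩ := (bijective_tmul (N := N) (hs x.1) (W := U x.1 ⊓ W) inf_le_left).2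
    (((tensorFunctor M).obj N).presheaf.map (homOfLE inf_le_right).op b)
  rw [(h _ (inf_le_right.trans hW)).elim a' b'] at ha
  exact ha.symm.trans hb

lemma support_restrict (N : Y.Modules) (f : X ⟶ Y) [IsOpenImmersion f] :
    (N.restrict f).support = f ⁻¹' N.support := by
  ext x
  exact ((CategoryTheory.forget Ab).mapIso ((restrictStalkNatIso f x).app N)).toEquiv.nontrivial_congr

lemma support_congr {M N : X.Modules} (e : M ≅ N) : M.support = N.support := by
  ext x
  exact ((CategoryTheory.forget Ab).mapIso ((toPresheaf X ⋙ TopCat.Presheaf.stalkFunctor _ x).mapIso e)).toEquiv.nontrivial_congr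

lemma isIso_pullbackObjUnitToUnit {C D : Type u} [Category.{u} C] [Category.{u} D]
    {J : GrothendieckTopology C} {K : GrothendieckTopology D} {F : C ⥤ D}
    {S : Sheaf J RingCat.{u}} {R : Sheaf K RingCat.{u}} [Functor.IsContinuous F J K]
    (φ : S ⟶ (F.sheafPushforwardContinuous RingCat.{u} J K).obj R)
    [(SheafOfModules.pushforward.{u} φ).IsRightAdjoint] (h : F.Final) :
    IsIso (SheafOfModules.pullbackObjUnitToUnit φ) := inferInstance

lemma nonempty_pullback_structureModule (f : X ⟶ Y) :
    Nonempty ((pullback f).obj (structureModule Y) ≅ structureModule X) := by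
  have hF : (Opens.map f.base).Final :=
    Functor.final_of_exists_of_isFiltered _
      (fun d => ⟨⊤, ⟨homOfLE le_top⟩⟩) (fun s s' => ⟨_, 𝟙 _, rfl⟩)
  have : (SheafOfModules.pushforward.{u} f.toRingCatSheafHom).IsRightAdjoint :=
    (pullbackPushforwardAdjunction f).isRightAdjoint
  have h : @IsIso (SheafOfModules X.ringCatSheaf) _ _ _
    (SheafOfModules.pullbackObjUnitToUnit f.toRingCatSheafHom) :=
    isIso_pullbackObjUnitToUnit f.toRingCatSheafHom hF
  exact ⟨@asIso X.Modules _ _ _ (SheafOfModules.pullbackObjUnitToUnit f.toRingCatSheafHom) h⟩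

lemma IsInvertible.pullback {M : Y.Modules} (hM : IsInvertible M) (f : X ⟶ Y) :
    IsInvertible ((pullback f).obj M) := by
  intro x
  obtain ⟨V, hx, ⟨e⟩⟩ := hM (f x)
  obtain ⟨e'⟩ := nonempty_pullback_structureModule (f ∣_ V)
  refine ⟨f ⁻¹ᵁ V, hx, ⟨?_⟩⟩
  exact (restrictFunctorIsoPullback (f ⁻¹ᵁ V).ι).app _ ≪≫ (pullbackComp (f ⁻¹ᵁ V).ι f).app M ≪≫
    (pullbackCongr (morphismRestrict_ι f V).symm).app M ≪≫
    ((pullbackComp (f ∣_ V) V.ι).app M).symm ≪≫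
    (Modules.pullback (f ∣_ V)).mapIso ((restrictFunctorIsoPullback V.ι).symm.app M ≪≫ e) ≪≫ e'


/-- The tensor powers `L^{⊗ n}`. -/
noncomputable def tensorPow (L : X.Modules) : ℕ → X.Modules
  | 0 => structureModule X
  | n + 1 => (tensorFunctor L).obj (tensorPow L n)

/-- For a global section `s` of an invertible module `M`, the open subset `X_s` of the points at
which `s` generates `M`. -/
def nonvanishingLocus {M : X.Modules} (s : Γ(M, ⊤)) : X.Opens :=
  sSup {V : X.Opens | IsFrame (M.presheaf.map (homOfLE (le_top (a := V))).op s)}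

/-- Ample line bundles: `X` is quasi-compact and every point lies in an affine open subset of the
form `X_s`, with `s` a global section of a positive tensor power of `L`. -/
structure IsAmple (L : X.Modules) : Prop where
  compactSpace : CompactSpace X
  isInvertible : IsInvertible L
  exists_section (x : X) : ∃ (n : ℕ) (s : Γ(tensorPow L n, ⊤)), 1 ≤ n ∧
    x ∈ nonvanishingLocus s ∧ IsAffineOpen (nonvanishingLocus s)

end AlgebraicGeometry.Scheme.Modules

namespace AlgebraicGeometry
open Scheme Modules Triangulated
variable {k : Type u} [Field k]

/-- The projective space of dimension `n` over `k`, as a scheme over `k`. -/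
noncomputable def projSpace (k : Type u) [Field k] (n : ℕ) : Over (Spec (.of k)) :=
  letI := MvPolynomial.gradedAlgebra (σ := Fin (n + 1)) (R := k)
  Over.mk (Proj.toSpecZero (MvPolynomial.homogeneousSubmodule (Fin (n + 1)) k) ≫
    Spec.map (CommRingCat.ofHom
      (algebraMap k (MvPolynomial.homogeneousSubmodule (Fin (n + 1)) k 0))))

/-- Quasi-projective schemes over `k`: (locally closed) subschemes of a projective space over `k`. -/
def IsQuasiProjective (S : Over (Spec (.of k))) : Prop :=
  ∃ (n : ℕ) (i : S ⟶ projSpace k n), IsImmersion i.left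

/-- The fibre product `Y × T` over `k`. -/
noncomputable abbrev prodScheme (Y T : Over (Spec (.of k))) : Scheme.{u} := Limits.pullback Y.hom T.hom

/-- The first projection `p : Y × T ⟶ Y`. -/
noncomputable abbrev prodFst (Y T : Over (Spec (.of k))) : prodScheme Y T ⟶ Y.left :=
  Limits.pullback.fst Y.hom T.hom

/-- The second projection `q : Y × T ⟶ T`. -/
noncomputable abbrev prodSnd (Y T : Over (Spec (.of k))) : prodScheme Y T ⟶ T.left :=
  Limits.pullback.snd Y.hom T.hom

/-- The morphism `id × g : Y × T' ⟶ Y × T`. -/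
noncomputable def prodMap (Y : Over (Spec (.of k))) {T' T : Over (Spec (.of k))} (g : T' ⟶ T) :
    prodScheme Y T' ⟶ prodScheme Y T :=
  Limits.pullback.map _ _ _ _ (𝟙 Y.left) g.left (𝟙 _) (by simp) (by simp)

lemma prodMap_fst (Y : Over (Spec (.of k))) {T' T : Over (Spec (.of k))} (g : T' ⟶ T) :
    prodMap Y g ≫ prodFst Y T = prodFst Y T' :=
  (Limits.pullback.lift_fst _ _ _).trans (Category.comp_id _)

instance (Y : Over (Spec (.of k))) {T' T : Over (Spec (.of k))} (g : T' ⟶ T)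
    [IsOpenImmersion g.left] : IsOpenImmersion (prodMap Y g) := by
  unfold prodMap; infer_instance

variable (Y T T' S : Over (Spec (.of k)))

instance [LocallyOfFiniteType Y.hom] [LocallyOfFiniteType T.hom] : IsLocallyNoetherian (prodScheme Y T) :=
  LocallyOfFiniteType.isLocallyNoetherian (Limits.pullback.snd Y.hom T.hom ≫ T.hom)

/-- An open subset `U` of `S`, as a scheme over `k`. -/
noncomputable abbrev openOver (U : S.left.Opens) : Over (Spec (.of k)) := Over.mk (U.ι ≫ S.hom)

/-- The inclusion of an open subset `U` into `S`, over `k`. -/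
noncomputable def openIncl (U : S.left.Opens) : openOver S U ⟶ S := Over.homMk U.ι

variable {S} in
/-- The inclusion between two open subsets of `S`, over `k`. -/
noncomputable def openHomOfLE {U' U : S.left.Opens} (h : U' ≤ U) : openOver S U' ⟶ openOver S U :=
  Over.homMk (S.left.homOfLE h)

instance (U : S.left.Opens) : IsOpenImmersion (openIncl S U).left :=
  inferInstanceAs (IsOpenImmersion U.ι)

instance {U' U : S.left.Opens} (h : U' ≤ U) : IsOpenImmersion (openHomOfLE h).left :=
  inferInstanceAs (IsOpenImmersion (S.left.homOfLE h))

instance [LocallyOfFiniteType S.hom] (U : S.left.Opens) :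
    LocallyOfFiniteType (openOver S U).hom :=
  inferInstanceAs (LocallyOfFiniteType (U.ι ≫ S.hom))

section
variable [LocallyOfFiniteType Y.hom] [LocallyOfFiniteType T.hom] [LocallyOfFiniteType T'.hom]
  [LocallyOfFiniteType S.hom]

/-- The objects of `D(Coh (Y × T))` that have bounded cohomology and left-compact support, that is,
support contained in `Z × T` for some proper subscheme `Z` of `Y`. -/
def isLeftCompact : ObjectProperty (DerivedCategory (Coh (prodScheme Y T))) :=
  DerivedCategory.TStructure.t.bounded ⊓ IsSupportedOver Y (prodFst Y T)

/-- The triangulated category of bounded complexes of coherent sheaves on `Y × T` with left-compact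
support. -/
abbrev DLc := (isLeftCompact Y T).FullSubcategory

instance [IsSeparated Y.hom] : (isLeftCompact Y T).IsTriangulated := by
  unfold isLeftCompact; infer_instance


variable {T T'}

/-- The restriction functor `(id × g)^*` for an open immersion `g : T' ⟶ T`. -/
noncomputable def lcRestrict (g : T' ⟶ T) [IsOpenImmersion g.left] : DLc Y T ⥤ DLc Y T' :=
  (isLeftCompact Y T').lift
    ((isLeftCompact Y T).ι ⋙ (cohRestrict (prodMap Y g)).mapDerivedCategory) fun F => by
    refine ⟨bounded_mapDerivedCategory _ F.property.1, ?_⟩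
    obtain ⟨A, hA, h⟩ := F.property.2
    refine ⟨A, hA, fun n => ?_⟩
    obtain ⟨e⟩ := nonempty_homology_mapDerivedCategory_iso (cohRestrict (prodMap Y g)) F.obj n
    refine (support_congr ((isCoherent _).ι.mapIso e)).le.trans ?_
    refine (support_restrict _ (prodMap Y g)).le.trans ((Set.preimage_mono (h n)).trans ?_)
    rw [← prodMap_fst Y g]
    rfl

variable {Y} in
/-- The functor `F ↦ F ⊗ L` for a line bundle `L` on `Y × T`. -/
noncomputable def lcTwist {L : (prodScheme Y T).Modules} (hL : IsInvertible L) : DLc Y T ⥤ DLc Y T :=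
  (isLeftCompact Y T).lift
    ((isLeftCompact Y T).ι ⋙ (cohTensor hL).mapDerivedCategory) fun F => by
    refine ⟨bounded_mapDerivedCategory _ F.property.1, ?_⟩
    obtain ⟨A, hA, h⟩ := F.property.2
    refine ⟨A, hA, fun n => ?_⟩
    obtain ⟨e⟩ := nonempty_homology_mapDerivedCategory_iso (cohTensor hL) F.obj n
    refine (support_congr ((isCoherent _).ι.mapIso e)).le.trans ?_
    let V : (prodScheme Y T).Opens := ⟨(prodFst Y T ⁻¹' A)ᶜ,
      (hA.isClosed.preimage (prodFst Y T).continuous).isOpen_compl⟩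
    have hV : (V : Set (prodScheme Y T))ᶜ = prodFst Y T ⁻¹' A := compl_compl _
    rw [← hV]
    exact support_subset_iff.2 (hL.subsingleton_tensor (support_subset_iff.1 ((h n).trans hV.ge)))

end

section
variable {C D : Type*} [Category* C] [Preadditive C] [HasZeroObject C] [HasShift C ℤ]
  [∀ n : ℤ, (shiftFunctor C n).Additive] [Pretriangulated C]
  [Category* D] [Preadditive D] [HasZeroObject D] [HasShift D ℤ]
  [∀ n : ℤ, (shiftFunctor D n).Additive] [Pretriangulated D]

/-- A t-structure is bounded if every object is in `D^{≤ n}` for some `n` and in `D^{≥ n}` for some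
`n`. -/
def IsBoundedTStructure (t : TStructure C) : Prop :=
  (∀ X : C, ∃ n : ℤ, t.le n X) ∧ ∀ X : C, ∃ n : ℤ, t.ge n X

/-- A functor is t-exact if it maps `D^{≤ 0}` to `D^{≤ 0}` and `D^{≥ 0}` to `D^{≥ 0}`. -/
def IsTExact (t : TStructure C) (t' : TStructure D) (Φ : C ⥤ D) : Prop :=
  (∀ X : C, t.le 0 X → t'.le 0 (Φ.obj X)) ∧ ∀ X : C, t.ge 0 X → t'.ge 0 (Φ.obj X)
end

/-- A sheaf of t-structures over `S`: a bounded t-structure on the category of complexes on `Y × U`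
with left-compact support for each open subset `U` of `S`, such that the restriction functors are
t-exact. -/
structure SheafOfTStructures (Y S : Over (Spec (.of k))) [IsSeparated Y.hom]
    [LocallyOfFiniteType Y.hom] [LocallyOfFiniteType S.hom] where
  /-- The t-structure over the open subset `U`. -/
  t (U : S.left.Opens) : TStructure (DLc Y (openOver S U))
  isBounded (U : S.left.Opens) : IsBoundedTStructure (t U)
  isTExact {U' U : S.left.Opens} (h : U' ≤ U) :
    IsTExact (t U) (t U') (lcRestrict Y (openHomOfLE h))

end AlgebraicGeometry

open AlgebraicGeometry Scheme Modules Triangulated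

/-! Let `j : Y × U ⟶ Y × S` be the open immersion and `R = j^*`. Over `U` one takes the essential
images under `R` of the given `D^{≤ n}` and `D^{≥ n}`. Shifts and truncation triangles restrict, and
restriction is functorial in `U`. Two facts carry the theorem: every object over `U` is a
restriction (`exists_lcRestrict_iso`), and `Hom(RF, RG) = 0` for `F` in `D^{≤ 0}` and `G` in `D^{≥
1}`. For the second it suffices to lift a morphism `RF ⟶ RG` to some `F ⟶ G'`, where `G ⟶ G'` is an
isomorphism over `U` and `G'` is still in `D^{≥ 1}`: the lift vanishes by orthogonality
(`ofEssImage`).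

To lift, one extends coherent sheaves, complexes and morphisms of complexes from the open subscheme,
and gets a roof `F ⟵ N ⟶ G` whose left leg is an isomorphism over `U` (`exists_roof_extension`). The
fibre `C` of that leg vanishes over `U`, and the composite `C ⟶ N ⟶ G` has to be killed by a
suitable `G ⟶ G'` (`exists_killing`). By dévissage `C` may be taken to be a shifted coherent sheaf
that vanishes over `U`. If `s` is a section of a power of `q^*L` with nonvanishing locus inside `Y ×
U`, a power of `s` annihilates this sheaf, so by naturality multiplication by it, `G ⟶ G ⊗ q^*L^m`,
kills the composite. Its target stays in `D^{≥ n}` because the twist is t-exact.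

This multiplication is an isomorphism only where `s` does not vanish. As `L` is ample, finitely many
such loci cover `Y × U`, and they are treated one at a time (`exists_killing_extension`): if `G ⟶
G₁` already kills the composite and has fibre `Q`, pushing out along `Q ⟶ Q ⊗ q^*L^m` yields an
extension `G₂` of `G₁` by the twist of `Q`. It remains in `D^{≥ n}`, and `G ⟶ G₂` is an isomorphism
over the old loci, where `Q` vanishes, and over the new one.

The same lifting, with `D^{≥ n}` replaced by the bounded complexes that vanish outside `Z × S`,
shows that extensions of restrictions are restrictions; since coherent sheaves extend with control
of the support, so do bounded complexes (`exists_derived_lift`).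

On the level of sheaves, direct images enter only through two elementary conditions on sections,
`IsTorsionBounded` and `IsExtensionBounded`. Sections of powers of `L` are handled as families of
functions in local frames (`FrameCover.IsSection`), which pull back and act on sheaves without any
comparison between tensor powers and pullback. -/

namespace AlgebraicGeometry.Scheme.Modules
-- Sections over affine charts
variable {X Y : Scheme.{u}}

/-- The pullback of a section of the structure sheaf along a chart `Spec R ⟶ X`, as an element
of `R`. -/
noncomputable def chartSection {R : CommRingCat.{u}} (i : Spec R ⟶ X) {O : X.Opens}
    (hO : ⊤ ≤ i ⁻¹ᵁ O) (f : Γ(X, O)) : R :=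
  (Scheme.ΓSpecIso R).hom (i.appLE O ⊤ hO f)

lemma smul_restrict_chart {R : CommRingCat.{u}} (i : Spec R ⟶ X) [IsOpenImmersion i] (M : X.Modules)
    {O : X.Opens} (hO : ⊤ ≤ i ⁻¹ᵁ O) (f : Γ(X, O)) (V : (Spec R).Opens) (hV : i ''ᵁ V ≤ O)
    (m : Γ(M, i ''ᵁ V)) :
    (show Γ(M, i ''ᵁ V) from chartSection i hO f • (show Γ(M.restrict i, V) from m)) =
      X.presheaf.map (homOfLE hV).op f • m := by
  rw [smul_Spec_def]
  change ((i.appIso V).inv ((Spec R).presheaf.map V.leTop.op ((Scheme.ΓSpecIso R).inv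
    ((Scheme.ΓSpecIso R).hom (i.appLE O ⊤ hO f))))) • m = _
  congr 1
  have h1 : (Scheme.ΓSpecIso R).inv ((Scheme.ΓSpecIso R).hom (i.appLE O ⊤ hO f)) =
    i.appLE O ⊤ hO f := congr($((Scheme.ΓSpecIso R).hom_inv_id) _)
  rw [h1]
  have h2 : i.appLE O ⊤ hO ≫ (Spec R).presheaf.map V.leTop.op ≫ (i.appIso V).inv =
      X.presheaf.map (homOfLE hV).op := by
    rw [Scheme.Hom.appLE_map_assoc, Scheme.Hom.appLE_appIso_inv]
  exact congr($h2 f)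

lemma image_specBasicOpen_chartSection {R : CommRingCat.{u}} (i : Spec R ⟶ X) [IsOpenImmersion i]
    {O : X.Opens} (hO : ⊤ ≤ i ⁻¹ᵁ O) (f : Γ(X, O)) :
    i ''ᵁ specBasicOpen (chartSection i hO f) = X.basicOpen f ⊓ i.opensRange := by
  have h : specBasicOpen (chartSection i hO f) = i ⁻¹ᵁ X.basicOpen f := by
    rw [specBasicOpen, ← basicOpen_eq_of_affine]
    have h1 : (Scheme.ΓSpecIso R).inv (chartSection i hO f) =
      i.appLE O ⊤ hO f := congr($((Scheme.ΓSpecIso R).hom_inv_id) _)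
    rw [h1, Scheme.Hom.appLE, CommRingCat.comp_apply]
    erw [Scheme.basicOpen_res]
    rw [Scheme.preimage_basicOpen, top_inf_eq]
  rw [h, Scheme.Hom.image_preimage_eq_opensRange_inf, inf_comm]


/-- Restriction of sections of a sheaf of modules. -/
noncomputable def res (M : X.Modules) {U V : X.Opens} (h : U ≤ V) : Γ(M, V) →+ Γ(M, U) :=
  (M.presheaf.map (homOfLE h).op).hom

/-- Restriction of sections of the structure sheaf. -/
noncomputable def resO {U V : X.Opens} (h : U ≤ V) : Γ(X, V) →+* Γ(X, U) :=
  (X.presheaf.map (homOfLE h).op).hom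

section res
variable {M N : X.Modules} {U V W : X.Opens}

@[simp] lemma res_self (m : Γ(M, U)) : res M le_rfl m = m :=
  congr($(M.presheaf.map_id (op U)) m)

@[simp] lemma res_res (h : U ≤ V) (h' : V ≤ W) (m : Γ(M, W)) :
    res M h (res M h' m) = res M (h.trans h') m :=
  presheaf_map_map M (homOfLE h) (homOfLE h') _ m

@[simp] lemma resO_self (m : Γ(X, U)) : resO le_rfl m = m :=
  congr($(X.presheaf.map_id (op U)) m)

@[simp] lemma resO_resO (h : U ≤ V) (h' : V ≤ W) (m : Γ(X, W)) :
    resO h (resO h' m) = resO (h.trans h') m :=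
  congr($(X.presheaf.map_comp (homOfLE h').op (homOfLE h).op) m).symm

@[simp] lemma res_smul (h : U ≤ V) (r : Γ(X, V)) (m : Γ(M, V)) :
    res M h (r • m) = resO h r • res M h m :=
  M.map_smul (homOfLE h) r m

lemma res_resO_pow_smul (h : U ≤ V) (h' : V ≤ W) (r : Γ(X, W)) (n : ℕ) (m : Γ(M, V)) :
    res M h (resO h' r ^ n • m) = resO (h.trans h') r ^ n • res M h m := by
  rw [res_smul, map_pow, resO_resO]

lemma app_res (φ : M ⟶ N) (h : U ≤ V) (m : Γ(M, V)) :
    φ.app U (res M h m) = res N h (φ.app V m) :=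
  app_map φ (homOfLE h) m

lemma eq_of_forall_mem {a b : Γ(M, W)}
    (h : ∀ x ∈ W, ∃ (U : X.Opens) (hU : U ≤ W), x ∈ U ∧ res M hU a = res M hU b) : a = b := by
  choose U hU hx h using h
  exact TopCat.Sheaf.eq_of_locally_eq' ⟨M.presheaf, M.isSheaf⟩ (fun x : W => U x.1 x.2) W
    (fun x => homOfLE (hU _ _)) (fun x hx' => Opens.mem_iSup.2 ⟨⟨x, hx'⟩, hx _ _⟩) _ _
    fun x => h _ _

lemma exists_glue {ι : Type*} (U : ι → X.Opens) (hU : ∀ i, U i ≤ W)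
    (hW : ∀ x ∈ W, ∃ i, x ∈ U i) (s : ∀ i, Γ(M, U i))
    (hs : ∀ i j, res M (inf_le_left : U i ⊓ U j ≤ U i) (s i) = res M inf_le_right (s j)) :
    ∃ t : Γ(M, W), ∀ i, res M (hU i) t = s i := by
  obtain ⟨t, ht, -⟩ := TopCat.Sheaf.existsUnique_gluing' ⟨M.presheaf, M.isSheaf⟩ U W
    (fun i => homOfLE (hU i)) (fun x hx => Opens.mem_iSup.2 (hW x hx)) s hs
  exact ⟨t, ht⟩

lemma res_eq_zero_of_le (h : U ≤ V) (h' : V ≤ W) {m : Γ(M, W)} (hm : res M h' m = 0) :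
    res M (h.trans h') m = 0 := by
  rw [← res_res h h', hm, map_zero]

end res

lemma pow_smul_restrict_chart {R : CommRingCat.{u}} (i : Spec R ⟶ X) [IsOpenImmersion i]
    (M : X.Modules) {O : X.Opens} (hO : ⊤ ≤ i ⁻¹ᵁ O) (f : Γ(X, O)) (V : (Spec R).Opens)
    (hV : i ''ᵁ V ≤ O) (n : ℕ) (m : Γ(M, i ''ᵁ V)) :
    (show Γ(M, i ''ᵁ V) from chartSection i hO f ^ n • (show Γ(M.restrict i, V) from m)) =
      resO hV f ^ n • m := by
  have : chartSection i hO f ^ n = chartSection i hO (f ^ n) := by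
    rw [chartSection, chartSection, map_pow, map_pow]
  rw [this]
  exact (smul_restrict_chart i M hO (f ^ n) V hV m).trans (by rw [map_pow]; rfl)

section chart
variable {M : X.Modules} {R : CommRingCat.{u}} (i : Spec R ⟶ X) [IsOpenImmersion i]
  (hM : IsLocalizing (modulesSpecToSheaf.obj (M.restrict i))) {O B : X.Opens} (hO : i ''ᵁ ⊤ ≤ O) (f : Γ(X, O))
  (hB : B = X.basicOpen f ⊓ i ''ᵁ ⊤)
include hM hB

/-- Keeping `B` a variable with the equation `hB` allows it to be replaced by the image of a basic
open subset of `Spec R`, where the localization property of the chart applies verbatim. -/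
lemma exists_pow_smul_eq_zero_chart (t : Γ(M, i ''ᵁ ⊤))
    (ht : res M (hB.trans_le inf_le_right) t = 0) : ∃ n : ℕ, resO hO f ^ n • t = 0 := by
  have hO' : ⊤ ≤ i ⁻¹ᵁ O := fun x _ => hO ⟨x, trivial, rfl⟩
  obtain rfl : i ''ᵁ specBasicOpen (chartSection i hO' f) = B := by
    rw [image_specBasicOpen_chartSection, hB, Scheme.Hom.image_top_eq_opensRange]
  obtain ⟨n, hn⟩ := ((isLocalizing_iff_sections _).1 hM).2 (chartSection i hO' f) t ht
  exact ⟨n, (pow_smul_restrict_chart i M hO' f ⊤ hO n t).symm.trans hn⟩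

lemma exists_res_eq_pow_smul_chart (s : Γ(M, B)) :
    ∃ (n : ℕ) (t : Γ(M, i ''ᵁ ⊤)), res M (hB.trans_le inf_le_right) t =
      resO ((hB.trans_le inf_le_right).trans hO) f ^ n • s := by
  have hO' : ⊤ ≤ i ⁻¹ᵁ O := fun x _ => hO ⟨x, trivial, rfl⟩
  obtain rfl : i ''ᵁ specBasicOpen (chartSection i hO' f) = B := by
    rw [image_specBasicOpen_chartSection, hB, Scheme.Hom.image_top_eq_opensRange]
  obtain ⟨n, t, ht⟩ := ((isLocalizing_iff_sections _).1 hM).1 (chartSection i hO' f) s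
  exact ⟨n, t, ht.trans (pow_smul_restrict_chart i M hO' f _
    ((hB.trans_le inf_le_right).trans hO) n s)⟩

end chart

lemma exists_chart_le {M : X.Modules} (hM : isCoherent X M) {O : X.Opens} (x : X) (hx : x ∈ O) :
    ∃ (R : CommRingCat.{u}) (i : Spec R ⟶ X) (_ : IsOpenImmersion i),
      x ∈ i ''ᵁ ⊤ ∧ i ''ᵁ ⊤ ≤ O ∧ IsTildeFinite (M.restrict i) := by
  obtain ⟨R, i, hi, hxi, h, h'⟩ := exists_isTildeFinite hM x O hx
  refine ⟨R, i, hi, ?_, ?_, h'⟩ <;> rw [Scheme.Hom.image_top_eq_opensRange]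
  exacts [hxi, h]

/-! ### Torsion and extension of sections over the nonvanishing locus of a function -/

/-- Sections over a quasi-compact open subset `O` that vanish on the open subset `O_f` of a function
`f` on `O` are annihilated by a power of `f`. -/
def IsTorsionBounded (M : X.Modules) : Prop :=
  ∀ (O : X.Opens), IsCompact (O : Set X) → ∀ (f : Γ(X, O)) (t : Γ(M, O)),
    res M (X.basicOpen_le f) t = 0 → ∃ n : ℕ, f ^ n • t = 0

/-- Finitely many charts cover the quasi-compact `O`, and the largest of their exponents works for
all of them. -/
lemma isTorsionBounded_of_forall_exists {M : X.Modules}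
    (h : ∀ (O : X.Opens) (x : X), x ∈ O → ∃ (R : CommRingCat.{u}) (i : Spec R ⟶ X)
      (_ : IsOpenImmersion i), x ∈ i ''ᵁ ⊤ ∧ i ''ᵁ ⊤ ≤ O ∧
        IsLocalizing (modulesSpecToSheaf.obj (M.restrict i))) :
    IsTorsionBounded M := by
  intro O hO f t ht
  choose R i hi hxi hle hi' using fun x : O => h O x.1 x.2
  obtain ⟨s, hs⟩ := hO.elim_finite_subcover (fun x : O => ((i x ''ᵁ ⊤ : X.Opens) : Set X))
    (fun x => (i x ''ᵁ ⊤).isOpen) fun x hx => Set.mem_iUnion.2 ⟨⟨x, hx⟩, hxi _⟩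
  have key (x : O) : ∃ n : ℕ, resO (hle x) f ^ n • res M (hle x) t = 0 :=
    exists_pow_smul_eq_zero_chart (i x) (hi' x) (hle x) f rfl _ (by
      rw [res_res, ← res_res inf_le_left (X.basicOpen_le f), ht, map_zero])
  choose n hn using key
  refine ⟨s.sup n, eq_of_forall_mem fun x hx => ?_⟩
  obtain ⟨y, hy, hxy⟩ := Set.mem_iUnion₂.1 (hs hx)
  refine ⟨_, hle y, hxy, ?_⟩
  obtain ⟨k, hk⟩ := Nat.exists_eq_add_of_le' (Finset.le_sup (f := n) hy)
  rw [res_smul, map_pow, hk, pow_add, mul_smul, hn, smul_zero, map_zero]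

lemma isTorsionBounded_of_isCoherent {M : X.Modules} (hM : isCoherent X M) :
    IsTorsionBounded M :=
  isTorsionBounded_of_forall_exists fun O x hx => by
    obtain ⟨R, i, hi, h, h', h''⟩ := exists_chart_le hM (O := O) x hx
    exact ⟨R, i, hi, h, h', h''.isLocalizing⟩

/-- On a spectrum the localization property is quasi-coherence, which passes to every affine open
subset; these serve as charts. -/
lemma isTorsionBounded_of_isLocalizing {R : CommRingCat.{u}} {M : (Spec R).Modules}
    (hM : IsLocalizing (modulesSpecToSheaf.obj M)) : IsTorsionBounded M :=
  isTorsionBounded_of_forall_exists fun O x hx => by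
    obtain ⟨_, ⟨W, hW, rfl⟩, hxW, hWU⟩ :=
      (Spec R).isBasis_affineOpens.exists_subset_of_mem_open
        (show x ∈ (O : Set (Spec R)) from hx) O.isOpen
    have hW' : IsAffineOpen W := hW
    refine ⟨_, hW'.fromSpec, inferInstance, ?_, ?_, ?_⟩
    · rw [Scheme.Hom.image_top_eq_opensRange, IsAffineOpen.opensRange_fromSpec]; exact hxW
    · rw [Scheme.Hom.image_top_eq_opensRange, IsAffineOpen.opensRange_fromSpec]; exact hWU
    · rw [← isIso_fromTildeΓ_iff_isLocalizing, ← isQuasicoherent_iff_isIso_fromTildeΓ]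
      rw [← isIso_fromTildeΓ_iff_isLocalizing, ← isQuasicoherent_iff_isIso_fromTildeΓ] at hM
      exact isQuasicoherent_restrictFunctor hW'.fromSpec M

/-- The classical gluing argument: multiples of `s` extend to each of finitely many charts, and the
extensions agree on overlaps after multiplication by a further power of `f`. -/
lemma exists_res_eq_pow_smul [NoetherianSpace X] {M : X.Modules} (hM : isCoherent X M)
    {O : X.Opens} (f : Γ(X, O)) (s : Γ(M, X.basicOpen f)) :
    ∃ (n : ℕ) (t : Γ(M, O)), res M (X.basicOpen_le f) t = resO (X.basicOpen_le f) f ^ n • s := by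
  choose R i hi hxi hle hi' using fun x : O => exists_chart_le hM x.1 x.2
  obtain ⟨J, hJ⟩ := (NoetherianSpace.isCompact (O : Set X)).elim_finite_subcover
    (fun x : O => ((i x ''ᵁ ⊤ : X.Opens) : Set X))
    (fun x => (i x ''ᵁ ⊤).isOpen) fun x hx => Set.mem_iUnion.2 ⟨⟨x, hx⟩, hxi _⟩
  choose n t ht using fun x => exists_res_eq_pow_smul_chart (i x) (hi' x).isLocalizing (hle x) f rfl
    (res M inf_le_left s)
  -- A common exponent: afterwards every `t' x` restricts to the same multiple `f ^ N • s`.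
  let N := J.sup n
  obtain ⟨t', ht'⟩ : ∃ t' : ∀ x : J, Γ(M, i x ''ᵁ ⊤), ∀ x : J,
      res M (inf_le_right : X.basicOpen f ⊓ i x ''ᵁ ⊤ ≤ _) (t' x) =
      resO ((inf_le_left : X.basicOpen f ⊓ i x ''ᵁ ⊤ ≤ _).trans (X.basicOpen_le f)) f ^ N •
        res M (inf_le_left : X.basicOpen f ⊓ i x ''ᵁ ⊤ ≤ _) s := by
    refine ⟨fun x => resO (hle x) f ^ (N - n x) • t x, fun x => ?_⟩
    have : N = (N - n x) + n x := by
      have := Finset.le_sup (f := n) x.2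
      omega
    rw [res_smul, ht, map_pow, resO_resO, smul_smul, ← pow_add, ← this]
  -- Both extensions equal `f ^ N • s` where `f` is invertible, so their difference is `f`-torsion;
  -- overlaps are quasi-compact because `X` is Noetherian.
  have key (x y : J) : ∃ m : ℕ,
      resO ((inf_le_left : i x ''ᵁ ⊤ ⊓ i y ''ᵁ ⊤ ≤ _).trans (hle x)) f ^ m • (res M (inf_le_left : i x ''ᵁ ⊤ ⊓ i y ''ᵁ ⊤ ≤ _) (t' x) -
        res M inf_le_right (t' y)) = 0 := by
    generalize hf' : resO ((inf_le_left : i x ''ᵁ ⊤ ⊓ i y ''ᵁ ⊤ ≤ _).trans (hle x)) f = f'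
    have hb : X.basicOpen f' ≤ X.basicOpen f := by
      rw [← hf', resO]
      erw [Scheme.basicOpen_res]
      exact inf_le_right
    refine isTorsionBounded_of_isCoherent hM _ (NoetherianSpace.isCompact _) f' _ ?_
    have hx : X.basicOpen f' ≤ X.basicOpen f ⊓ i x ''ᵁ ⊤ :=
      le_inf hb ((X.basicOpen_le _).trans inf_le_left)
    have hy : X.basicOpen f' ≤ X.basicOpen f ⊓ i y ''ᵁ ⊤ :=
      le_inf hb ((X.basicOpen_le _).trans inf_le_right)
    have hsub : X.basicOpen f' ≤ O := hb.trans (X.basicOpen_le f)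
    have h1 : res M (hx.trans inf_le_right) (t' x) = resO hsub f ^ N • res M hb s :=
      (res_res hx inf_le_right (t' x)).symm.trans ((congrArg (res M hx) (ht' x)).trans
        ((res_resO_pow_smul _ _ _ _ _).trans
          (congrArg _ (res_res _ _ _))))
    have h2 : res M (hy.trans inf_le_right) (t' y) = resO hsub f ^ N • res M hb s :=
      (res_res hy inf_le_right (t' y)).symm.trans ((congrArg (res M hy) (ht' y)).trans
        ((res_resO_pow_smul _ _ _ _ _).trans
          (congrArg _ (res_res _ _ _))))
    rw [map_sub, sub_eq_zero]
    exact (res_res _ _ _).trans (h1.trans (h2.symm.trans (res_res _ _ _).symm))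
  choose m hm using key
  obtain ⟨K, hK⟩ : ∃ K, ∀ x y, m x y ≤ K := ⟨Finset.univ.sup fun p : J × J => m p.1 p.2,
    fun x y => Finset.le_sup (f := fun p : J × J => m p.1 p.2) (Finset.mem_univ (x, y))⟩
  obtain ⟨a, ha⟩ := exists_glue (M := M) (W := O) (fun x : J => i x ''ᵁ ⊤) (fun x => hle x)
    (fun x hx => by
      obtain ⟨y, hy, hxy⟩ := Set.mem_iUnion₂.1 (hJ hx)
      exact ⟨⟨y, hy⟩, hxy⟩)
    (fun x => resO (hle x) f ^ K • t' x) (by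
      intro x y
      obtain ⟨k, hk⟩ := Nat.exists_eq_add_of_le' (hK x y)
      rw [← sub_eq_zero]
      refine (congrArg₂ _ (res_resO_pow_smul _ _ _ _ _) (res_resO_pow_smul _ _ _ _ _)).trans ?_
      rw [← smul_sub, hk, pow_add, mul_smul]
      exact (congrArg _ (hm x y)).trans (smul_zero _))
  refine ⟨K + N, a, eq_of_forall_mem fun x hx => ?_⟩
  obtain ⟨y, hy, hxy⟩ := Set.mem_iUnion₂.1 (hJ (X.basicOpen_le f hx))
  refine ⟨X.basicOpen f ⊓ i y ''ᵁ ⊤, inf_le_left, ⟨hx, hxy⟩, ?_⟩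
  have h1 : res M (inf_le_right.trans (hle y)) a = _ :=
    (res_res (inf_le_right : X.basicOpen f ⊓ i y ''ᵁ ⊤ ≤ _) (hle y) a).symm.trans
      (congrArg (res M inf_le_right) (ha ⟨y, hy⟩))
  have h2 := (res_resO_pow_smul (inf_le_right : X.basicOpen f ⊓ i y ''ᵁ ⊤ ≤ _) (hle y) f K
    (t' ⟨y, hy⟩)).trans (congrArg _ (ht' ⟨y, hy⟩))
  refine (res_res _ _ _).trans (h1.trans (h2.trans ?_))
  refine Eq.trans ?_ (res_resO_pow_smul _ _ f (K + N) s).symm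
  rw [pow_add, mul_smul]

/-- Sections of the direct image over `O` are sections of `M` over the preimage of `O`, which is
quasi-compact since `X` is Noetherian; quasi-coherence of the direct image plays no role. -/
lemma IsTorsionBounded.pushforward [NoetherianSpace X] {M : X.Modules} (hM : IsTorsionBounded M)
    (j : X ⟶ Y) : IsTorsionBounded ((pushforward j).obj M) := by
  intro O hO f t ht
  have hb : X.basicOpen (j.app O f) = j ⁻¹ᵁ Y.basicOpen f := (Scheme.preimage_basicOpen j f).symm
  obtain ⟨n, hn⟩ := hM (j ⁻¹ᵁ O) (NoetherianSpace.isCompact _) (j.app O f) t 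
    (res_eq_zero_of_le (M := M) hb.le (j.preimage_mono (Y.basicOpen_le f)) ht)
  refine ⟨n, .trans ?_ hn⟩
  change (show Γ(M, j ⁻¹ᵁ O) from (j.app O (f ^ n)) • (show Γ(M, j ⁻¹ᵁ O) from t)) = _
  rw [map_pow]

lemma IsTorsionBounded.restrict {M : Y.Modules} (hM : IsTorsionBounded M)
    (j : X ⟶ Y) [IsOpenImmersion j] : IsTorsionBounded (M.restrict j) := by
  intro O hO f t ht
  have hb : j ''ᵁ X.basicOpen f = Y.basicOpen ((j.appIso O).inv f) :=
    Scheme.image_basicOpen j f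
  obtain ⟨n, hn⟩ := hM (j ''ᵁ O) (hO.image j.continuous) ((j.appIso O).inv f) t 
    (res_eq_zero_of_le (M := M) hb.ge (j.image_mono (X.basicOpen_le f)) ht)
  refine ⟨n, .trans ?_ hn⟩
  change (show Γ(M, j ''ᵁ O) from ((j.appIso O).inv (f ^ n)) • (show Γ(M, j ''ᵁ O) from t)) = _
  rw [map_pow]

/-! ### Kernels, images and fibre products over torsion bounded sheaves -/

/-- If `s` is a section of the kernel over `D(f)`, then `f ^ n • s` extends to a global section `t`
of the middle term. The image of `t` vanishes over `D(f)`, so some `f ^ m` annihilates it and `f ^ m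
• t` lies in the kernel. The third term thus only has to be torsion bounded, which makes direct
images admissible as targets. -/
lemma isLocalizing_kernel {R : CommRingCat.{u}} {S : ShortComplex (Spec R).Modules} (hS : S.Exact)
    [Mono S.f] (h₂ : IsLocalizing (modulesSpecToSheaf.obj S.X₂)) (h₃ : IsTorsionBounded S.X₃) :
    IsLocalizing (modulesSpecToSheaf.obj S.X₁) := by
  have H₂ := (isLocalizing_iff_sections _).1 h₂
  refine (isLocalizing_iff_sections _).2 ⟨fun f s => ?_, fun f t ht => ?_⟩
  · obtain ⟨n, t, ht⟩ := H₂.1 f (S.f.app _ s)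
    have h0 : S.g.app _ (S.f.app _ s) = 0 := congr(($(S.zero)).app _ s)
    have hb : (Spec R).basicOpen ((Scheme.ΓSpecIso R).inv f) = specBasicOpen f :=
      basicOpen_eq_of_affine f
    obtain ⟨m, hm⟩ := h₃ ⊤ isCompact_univ ((Scheme.ΓSpecIso R).inv f) (S.g.app _ t) (by
      have : res S.X₃ le_top (S.g.app _ t) = (0 : Γ(S.X₃, specBasicOpen f)) := by
        rw [← app_res]
        exact (congrArg _ ht).trans (by rw [app_smul_Spec, h0, smul_zero])
      rw [← res_res hb.le le_top, this, map_zero])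
    have hm' : f ^ m • S.g.app _ t = 0 := by
      rw [smul_Spec_def, map_pow, map_pow]
      convert hm
      exact congr($((Spec R).presheaf.map_id _) _)
    obtain ⟨k, hk⟩ := exists_app_eq_of_exact hS ⊤ (f ^ m • t) (by rw [app_smul_Spec, hm'])
    refine ⟨m + n, k, app_injective_of_mono S.f _ ?_⟩
    rw [app_map, hk, map_smul_Spec, ht, app_smul_Spec, pow_add, mul_smul]
  · obtain ⟨n, hn⟩ := H₂.2 f (S.f.app _ t) (by rw [← app_map, ht, map_zero])
    exact ⟨n, app_injective_of_mono S.f _ (by rw [app_smul_Spec, hn, map_zero])⟩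

lemma IsTildeFinite.kernel_of_isTorsionBounded {R : CommRingCat.{u}} [IsNoetherianRing R]
    {S : ShortComplex (Spec R).Modules} (hS : S.Exact) [Mono S.f] (h₂ : IsTildeFinite S.X₂)
    (h₃ : IsTorsionBounded S.X₃) : IsTildeFinite S.X₁ := by
  have h₁' := (isIso_fromTildeΓ_iff_isLocalizing _).2 (isLocalizing_kernel hS h₂.isLocalizing h₃)
  refine ⟨moduleSpecΓFunctor.obj S.X₁, ?_, ⟨(asIso S.X₁.fromTildeΓ).symm⟩⟩
  obtain ⟨N, hN, ⟨e⟩⟩ := h₂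
  let e' : N ≅ moduleSpecΓFunctor.obj S.X₂ :=
    tilde.toTildeΓNatIso.app N ≪≫ moduleSpecΓFunctor.mapIso e.symm
  have : Module.Finite R (moduleSpecΓFunctor.obj S.X₂) := Module.Finite.equiv e'.toLinearEquiv
  exact Module.Finite.of_injective (moduleSpecΓFunctor.map S.f).hom (app_injective_of_mono S.f ⊤)

lemma isCoherent_kernel_of_isTorsionBounded [IsLocallyNoetherian X] {S : ShortComplex X.Modules}
    (hS : S.Exact) [Mono S.f] (h₂ : isCoherent X S.X₂) (h₃ : IsTorsionBounded S.X₃) :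
    isCoherent X S.X₁ := by
  intro x
  obtain ⟨R, i, hi, hx, H₂⟩ := h₂ x
  have : Mono (S.map (restrictFunctor i)).f := inferInstanceAs (Mono ((restrictFunctor i).map S.f))
  have : IsNoetherianRing R := isLocallyNoetherian_Spec.1 (isLocallyNoetherian_of_isOpenImmersion i)
  exact ⟨R, i, hi, hx, IsTildeFinite.kernel_of_isTorsionBounded
    (S := S.map (restrictFunctor i)) (hS.map _) H₂ (h₃.restrict i)⟩

/-- The kernel is coherent because the target is torsion bounded, and the image is the cokernel of
`kernel φ ⟶ M`. -/
lemma isCoherent_image [IsLocallyNoetherian X] {M N : X.Modules} (φ : M ⟶ N) (hM : isCoherent X M)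
    (hN : IsTorsionBounded N) : isCoherent X (image φ) := by
  have hk : isCoherent X (kernel φ) :=
    isCoherent_kernel_of_isTorsionBounded (S := ShortComplex.mk (kernel.ι φ) φ (kernel.condition φ))
      (ShortComplex.exact_kernel φ) hM hN
  let S := ShortComplex.mk (kernel.ι φ) (factorThruImage φ) (by
    rw [← cancel_mono (image.ι φ)]; simp)
  have hS : S.Exact := by
    have := ShortComplex.exact_kernel φ
    let ψ : S ⟶ ShortComplex.mk (kernel.ι φ) φ (kernel.condition φ) :=
      { τ₁ := 𝟙 _, τ₂ := 𝟙 _, τ₃ := image.ι φ }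
    have : Epi ψ.τ₁ := inferInstanceAs (Epi (𝟙 _))
    have : IsIso ψ.τ₂ := inferInstanceAs (IsIso (𝟙 _))
    have : Mono ψ.τ₃ := inferInstanceAs (Mono (image.ι φ))
    rwa [ShortComplex.exact_iff_of_epi_of_isIso_of_mono ψ]
  have : Epi S.g := inferInstanceAs (Epi (factorThruImage φ))
  exact isCoherent_of_cokernel hS hk hM

/-- The fibre product is the kernel of a morphism `M ⊞ N ⟶ P`. -/
lemma isCoherent_pullback_of_isTorsionBounded [IsLocallyNoetherian X] {M N P Q : X.Modules}
    {a : Q ⟶ M} {b : Q ⟶ N} {f : M ⟶ P} {g : N ⟶ P} (h : IsPullback a b f g)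
    (hM : isCoherent X M) (hN : isCoherent X N) (hP : IsTorsionBounded P) : isCoherent X Q := by
  have := h.mono_shortComplex'_f
  exact isCoherent_kernel_of_isTorsionBounded h.exact_shortComplex' (isCoherent_biprod hM hN) hP

end AlgebraicGeometry.Scheme.Modules

/-! ### Extension of coherent sheaves from an open subscheme -/

/-- Numerators of finitely many generators of `A'` serve as `T`. Writing `l y` in these generators
and clearing denominators costs one power of `g`; passing from an equality in the localization to
one in `A` costs another. -/
lemma exists_finset_pow_smul_mem_span {R R' A A' : Type*} [CommRing R] [CommRing R'] [Algebra R R']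
    (g : R) [IsLocalization.Away g R'] [AddCommGroup A] [Module R A] [AddCommGroup A'] [Module R A']
    [Module R' A'] [IsScalarTower R R' A'] [Module.Finite R' A'] (l : A →ₗ[R] A')
    [IsLocalizedModule.Away g l] :
    ∃ T : Finset A, ∀ y : A, ∃ n : ℕ, g ^ n • y ∈ Submodule.span R (T : Set A) := by
  classical
  obtain ⟨G, hG⟩ := Module.Finite.fg_top (R := R') (M := A')
  have hs (s : A') : ∃ (n : ℕ) (a : A), l a = g ^ n • s := by
    obtain ⟨⟨a, ⟨_, n, rfl⟩⟩, h⟩ := IsLocalizedModule.surj (.powers g) l s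
    exact ⟨n, a, h.symm⟩
  choose n a ha using hs
  refine ⟨G.image a, fun y => ?_⟩
  -- Induction over the span, because the coefficients in `R'` have denominators of their own that
  -- must be cleared along the way.
  have key (t : A') (ht : t ∈ Submodule.span R' (G : Set A')) :
      ∃ (k : ℕ), ∃ p ∈ Submodule.span R ((G.image a : Finset A) : Set A), l p = g ^ k • t := by
    induction ht using Submodule.span_induction with
    | mem x hx =>
      exact ⟨n x, a x, Submodule.subset_span (Finset.mem_image_of_mem a hx), ha x⟩
    | zero => exact ⟨0, 0, zero_mem _, by simp⟩
    | add x y _ _ hx hy =>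
      obtain ⟨k, p, hp, hk⟩ := hx
      obtain ⟨k', p', hp', hk'⟩ := hy
      refine ⟨k + k', g ^ k' • p + g ^ k • p', add_mem (Submodule.smul_mem _ _ hp)
        (Submodule.smul_mem _ _ hp'), ?_⟩
      rw [map_add, _root_.map_smul, _root_.map_smul, hk, hk', smul_add, smul_smul, smul_smul, pow_add, mul_comm]
    | smul r x _ hx =>
      obtain ⟨k, p, hp, hk⟩ := hx
      obtain ⟨m, ρ, h⟩ := IsLocalization.Away.surj g r
      refine ⟨k + m, ρ • p, Submodule.smul_mem _ _ hp, ?_⟩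
      rw [_root_.map_smul, hk, ← algebraMap_smul R' ρ, ← h, ← algebraMap_smul R' (g ^ k),
        ← algebraMap_smul R' (g ^ (k + m)), smul_smul, smul_smul, pow_add, map_mul, map_pow,
        map_pow]
      congr 1
      ring
  obtain ⟨k, p, hp, hk⟩ := key (l y) (hG ▸ Submodule.mem_top)
  rw [← _root_.map_smul] at hk
  obtain ⟨⟨_, m, rfl⟩, hm⟩ := (IsLocalizedModule.eq_iff_exists (.powers g) l).1 hk
  refine ⟨m + k, ?_⟩
  rw [pow_add, mul_smul]
  exact hm ▸ Submodule.smul_mem _ _ hp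

namespace AlgebraicGeometry.Scheme.Modules
variable {X Y : Scheme.{u}}

lemma IsTildeFinite.finite_sections {M : X.Modules} {R : CommRingCat.{u}} {i : Spec R ⟶ X}
    [IsOpenImmersion i] (h : IsTildeFinite (M.restrict i)) {B : X.Opens} (hB : i ''ᵁ ⊤ = B) :
    Module.Finite Γ(X, B) Γ(M, B) := by
  subst hB
  obtain ⟨N, hN, ⟨e⟩⟩ := h
  let e' : N ≅ moduleSpecΓFunctor.obj (M.restrict i) :=
    tilde.toTildeΓNatIso.app N ≪≫ moduleSpecΓFunctor.mapIso e.symm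
  have : Module.Finite R (moduleSpecΓFunctor.obj (M.restrict i)) :=
    Module.Finite.equiv e'.toLinearEquiv
  obtain ⟨G, hG⟩ := Module.Finite.fg_top (R := R) (M := moduleSpecΓFunctor.obj (M.restrict i))
  refine ⟨⟨(show Finset Γ(M, i ''ᵁ ⊤) from G), ?_⟩⟩
  rw [eq_top_iff]
  suffices H : ∀ t : moduleSpecΓFunctor.obj (M.restrict i),
      t ∈ Submodule.span R (G : Set (moduleSpecΓFunctor.obj (M.restrict i))) →
        (show Γ(M, i ''ᵁ ⊤) from t) ∈ Submodule.span Γ(X, i ''ᵁ ⊤)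
          ((show Finset Γ(M, i ''ᵁ ⊤) from G) : Set Γ(M, i ''ᵁ ⊤)) from
    fun t _ => H t (hG ▸ Submodule.mem_top)
  intro t ht
  induction ht using Submodule.span_induction with
  | mem x hx => exact Submodule.subset_span hx
  | zero => exact zero_mem _
  | add x y _ _ hx hy => exact add_mem hx hy
  | smul r x _ hx => exact Submodule.smul_mem _ ((i.appIso ⊤).inv
      ((Spec R).presheaf.map (⊤ : (Spec R).Opens).leTop.op ((Scheme.ΓSpecIso R).inv r))) hx

/-- A coherence chart at `x` is shrunk to a basic open subset `D(g)` of the whole spectrum. The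
sections over it form the localization `A_g`, which is finitely generated there. -/
lemma exists_finset_of_isCoherent {R : CommRingCat.{u}} (A : ModuleCat.{u} R)
    {V : (Spec R).Opens} (h : isCoherent V ((tilde A).restrict V.ι)) (x : Spec R) (hx : x ∈ V) :
    ∃ (g : R) (T : Finset A), x ∈ specBasicOpen g ∧
      ∀ y : A, ∃ n : ℕ, g ^ n • y ∈ Submodule.span R (T : Set A) := by
  obtain ⟨S, i, hi, hxi, hfin⟩ := h ⟨x, hx⟩
  have hx' : x ∈ (i ≫ V.ι).opensRange := by
    obtain ⟨y, hy⟩ := hxi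
    refine ⟨y, ?_⟩
    rw [Scheme.Hom.comp_apply, hy]
    rfl
  obtain ⟨_, ⟨_, ⟨g, rfl⟩, rfl⟩, hxg, hgU⟩ :=
    PrimeSpectrum.isBasis_basic_opens.exists_subset_of_mem_open hx' (i ≫ V.ι).opensRange.isOpen
  have hD : IsAffineOpen (specBasicOpen g) := IsAffineOpen.Spec_basicOpen g
  have h1 : IsTildeFinite ((tilde A).restrict (i ≫ V.ι)) :=
    hfin.of_iso ((restrictFunctorComp i V.ι).symm.app (tilde A))
  have h2 : IsTildeFinite ((tilde A).restrict hD.fromSpec) :=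
    h1.of_range_le (i ≫ V.ι) hD.fromSpec (by rw [hD.range_fromSpec]; exact hgU)
  have h3 := h2.finite_sections (B := specBasicOpen g) (by
    rw [Scheme.Hom.image_top_eq_opensRange, IsAffineOpen.opensRange_fromSpec])
  have : IsLocalization.Away g Γ(Spec R, specBasicOpen g) :=
    StructureSheaf.IsLocalization.to_basicOpen R g
  have : IsLocalizedModule.Away g (show A →ₗ[R] Γ(tilde A, specBasicOpen g) from
      (tilde.toOpen A (PrimeSpectrum.basicOpen g)).hom) :=
    inferInstanceAs (IsLocalizedModule.Away g (tilde.toOpen A (PrimeSpectrum.basicOpen g)).hom)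
  obtain ⟨T, hT⟩ := exists_finset_pow_smul_mem_span (R' := Γ(Spec R, specBasicOpen g)) g
    (show A →ₗ[R] Γ(tilde A, specBasicOpen g) from (tilde.toOpen A (PrimeSpectrum.basicOpen g)).hom)
  exact ⟨g, T, hxg, hT⟩

/-- Near `x`, over some `D(f)` contained in `D(g)`, a power of `f` times the section comes from an
element of `A`, which a power of `g` annihilates. Both `f` and `g` act injectively over `D(f)`, so
the section is zero there. -/
lemma subsingleton_tilde {R : CommRingCat.{u}} (A : ModuleCat.{u} R) {V : (Spec R).Opens}
    (h : ∀ x ∈ V, ∃ g : R, x ∈ specBasicOpen g ∧ ∀ a : A, ∃ n : ℕ, g ^ n • a = 0)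
    {O : (Spec R).Opens} (hO : O ≤ V) : Subsingleton Γ(tilde A, O) := by
  have H := (isLocalizing_iff_sections (tilde A)).1 (isLocalizing_tilde A)
  suffices ∀ s : Γ(tilde A, O), s = 0 from ⟨fun a b => (this a).trans (this b).symm⟩
  refine fun s => eq_of_forall_mem fun x hx => ?_
  obtain ⟨g, hg, hn⟩ := h x (hO hx)
  obtain ⟨_, ⟨_, ⟨f, rfl⟩, rfl⟩, hxf, hfU⟩ :=
    PrimeSpectrum.isBasis_basic_opens.exists_subset_of_mem_open
      (show x ∈ O ⊓ specBasicOpen g from ⟨hx, hg⟩) (O ⊓ specBasicOpen g).isOpen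
  have hfO : specBasicOpen f ≤ O := fun y hy => (hfU hy).1
  have hfg : specBasicOpen f ≤ specBasicOpen g := fun y hy => (hfU hy).2
  refine ⟨specBasicOpen f, hfO, hxf, ?_⟩
  rw [map_zero]
  obtain ⟨n, t, ht⟩ := H.1 f (res _ hfO s)
  obtain ⟨a, rfl⟩ : ∃ a, (tilde.isoTop A).hom a = t :=
    ⟨(tilde.isoTop A).inv t, congr($((tilde.isoTop A).inv_hom_id) t)⟩
  obtain ⟨m, hm⟩ := hn a
  have hreg (r : R) (hr : specBasicOpen f ≤ specBasicOpen r) (k : ℕ) :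
      IsSMulRegular Γ(tilde A, specBasicOpen f) (r ^ k) :=
    (isSMulRegular_of_le_basicOpen (M := tilde A) hr).pow k
  refine hreg f le_rfl n (hreg g hfg m ?_)
  have h1 : g ^ m • (show Γ(tilde A, ⊤) from (tilde.isoTop A).hom a) = 0 :=
    ((tilde.isoTop A).hom.hom.map_smul (g ^ m) a).symm.trans ((congrArg _ hm).trans (map_zero _))
  have h2 : g ^ m • f ^ n • res (tilde A) hfO s = 0 :=
    (congrArg (fun y => g ^ m • y) ht.symm).trans
      ((map_smul_Spec _ _ _).symm.trans ((congrArg _ h1).trans (map_zero _)))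
  exact h2.trans ((congrArg (fun y => g ^ m • y) (smul_zero _)).trans (smul_zero _)).symm

/-- A quasi-coherent sheaf on a Noetherian affine scheme that is coherent over `V` has a
quasi-coherent quotient that vanishes over `V` and whose kernel is coherent. -/
lemma exists_tildeFinite_kernel {R : CommRingCat.{u}} [IsNoetherianRing R] {Q : (Spec R).Modules}
    (hQ : IsLocalizing (modulesSpecToSheaf.obj Q)) {V : (Spec R).Opens}
    (hV : isCoherent V (Q.restrict V.ι)) :
    ∃ (C : (Spec R).Modules) (p : Q ⟶ C), IsTorsionBounded C ∧
      (∀ O ≤ V, Subsingleton Γ(C, O)) ∧ IsTildeFinite (kernel p) := by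
  obtain ⟨A, ⟨e⟩⟩ : ∃ A : ModuleCat.{u} R, Nonempty (Q ≅ tilde A) := by
    have := (isIso_fromTildeΓ_iff_isLocalizing _).2 hQ
    exact ⟨moduleSpecΓFunctor.obj Q, ⟨(asIso Q.fromTildeΓ).symm⟩⟩
  replace hV : isCoherent V ((tilde A).restrict V.ι) :=
    (isCoherent V).prop_of_iso ((restrictFunctor V.ι).mapIso e) hV
  choose g T hg hT using fun x : V => exists_finset_of_isCoherent A hV x.1 x.2
  have : NoetherianSpace (Spec R) := inferInstanceAs (NoetherianSpace (PrimeSpectrum R))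
  obtain ⟨J, hJ⟩ := (NoetherianSpace.isCompact (V : Set (Spec R))).elim_finite_subcover
    (fun x : V => (specBasicOpen (g x) : Set (Spec R))) (fun x => (specBasicOpen (g x)).isOpen)
    fun x hx => Set.mem_iUnion.2 ⟨⟨x, hx⟩, hg _⟩
  -- `P` is finitely generated and contains a multiple by a power of `g x` of every element of `A`,
  -- for each `x` in the finite cover. Hence the sheaf of `A ⧸ P` vanishes over `V`.
  let P : Submodule R A := ⨆ x ∈ J, Submodule.span R (T x : Set A)
  have hP : P.FG := Submodule.fg_biSup _ _ fun x _ => ⟨T x, rfl⟩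
  have hP' : Module.Finite R P := Module.Finite.iff_fg.2 hP
  let q : A ⟶ ModuleCat.of R (A ⧸ P) := ModuleCat.ofHom P.mkQ
  have hC := isTorsionBounded_of_isLocalizing (isLocalizing_tilde (ModuleCat.of R (A ⧸ P)))
  refine ⟨tilde (ModuleCat.of R (A ⧸ P)), e.hom ≫ tilde.map q, hC, fun O hO => ?_, ?_⟩
  · refine subsingleton_tilde _ (V := V) (fun x hx => ?_) hO
    obtain ⟨y, hy, hxy⟩ := Set.mem_iUnion₂.1 (hJ hx)
    refine ⟨g y, hxy, fun a => ?_⟩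
    obtain ⟨a, rfl⟩ := P.mkQ_surjective a
    obtain ⟨n, hn⟩ := hT y a
    refine ⟨n, ?_⟩
    rw [← _root_.map_smul]
    exact (Submodule.Quotient.mk_eq_zero P).2 (Submodule.mem_iSup_of_mem y
      (Submodule.mem_iSup_of_mem hy hn))
  · refine IsTildeFinite.of_iso (kernelIsIsoComp e.hom (tilde.map q)).symm ?_
    let S := ShortComplex.mk (kernel.ι (tilde.map q)) (tilde.map q) (kernel.condition _)
    have : Mono S.f := inferInstanceAs (Mono (kernel.ι _))
    have h₁ := (isIso_fromTildeΓ_iff_isLocalizing _).2 (isLocalizing_kernel (S := S)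
      (ShortComplex.exact_kernel _) (isLocalizing_tilde A) hC)
    refine ⟨moduleSpecΓFunctor.obj S.X₁, ?_, ⟨(asIso S.X₁.fromTildeΓ).symm⟩⟩
    -- The kernel need not be identified with the sheaf of `P`: its global sections embed into `P`,
    -- and this gives finiteness because `R` is Noetherian.
    let l : moduleSpecΓFunctor.obj S.X₁ ⟶ A :=
      moduleSpecΓFunctor.map S.f ≫ (tilde.toTildeΓNatIso.app A).inv
    have hl0 : l ≫ q = 0 := by
      have h1 : (tilde.toTildeΓNatIso.app A).inv ≫ q =
        moduleSpecΓFunctor.map (tilde.map q) ≫ (tilde.toTildeΓNatIso.app _).inv :=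
          (tilde.toTildeΓNatIso.inv.naturality q).symm
      have h2 : moduleSpecΓFunctor.map S.f ≫ moduleSpecΓFunctor.map (tilde.map q) = 0 :=
        (moduleSpecΓFunctor.map_comp _ _).symm.trans
          ((congrArg _ S.zero).trans (by ext; rfl))
      exact (Category.assoc _ _ _).trans ((congrArg (moduleSpecΓFunctor.map S.f ≫ ·) h1).trans
        ((Category.assoc _ _ _).symm.trans ((congrArg (· ≫ _) h2).trans zero_comp)))
    have hl : Function.Injective l := by
      have h1 : Function.Injective (moduleSpecΓFunctor.map S.f) := app_injective_of_mono S.f ⊤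
      exact ((ModuleCat.mono_iff_injective (tilde.toTildeΓNatIso.app A).inv).1 inferInstance).comp h1
    have hl' (y) : l y ∈ P := (Submodule.Quotient.mk_eq_zero P).1 (show q (l y) = 0 from congr($hl0 y))
    exact Module.Finite.of_injective (l.hom.codRestrict P hl')
      fun a b h => hl congr(($h).1)


/-- A power of a function `f` on `O` times a given section over the open subset `O_f` extends
to `O`. -/
def IsExtensionBounded (M : X.Modules) : Prop :=
  ∀ (O : X.Opens) (f : Γ(X, O)) (s : Γ(M, X.basicOpen f)),
    ∃ (n : ℕ) (t : Γ(M, O)), res M (X.basicOpen_le f) t = resO (X.basicOpen_le f) f ^ n • s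

lemma isExtensionBounded_of_isCoherent [NoetherianSpace X] {M : X.Modules} (hM : isCoherent X M) :
    IsExtensionBounded M := fun _ f s => exists_res_eq_pow_smul hM f s

lemma resO_app (j : X ⟶ Y) {U V : Y.Opens} (h : U ≤ V) (f : Γ(Y, V)) :
    j.app U (resO h f) = resO (j.preimage_mono h) (j.app V f) :=
  congr($(j.naturality (homOfLE h).op) f)

lemma IsExtensionBounded.pushforward {M : X.Modules} (hM : IsExtensionBounded M) (j : X ⟶ Y) :
    IsExtensionBounded ((pushforward j).obj M) := by
  intro O f s
  have hb : X.basicOpen (j.app O f) = j ⁻¹ᵁ Y.basicOpen f := (Scheme.preimage_basicOpen j f).symm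
  obtain ⟨n, t, ht⟩ := hM (j ⁻¹ᵁ O) (j.app O f) (res M hb.le s)
  refine ⟨n, t, ?_⟩
  have h1 := congrArg (res M hb.ge) ht
  have h2 : res M hb.ge (res M hb.le s) = s := (res_res _ _ _).trans (res_self _)
  refine Eq.trans ?_ (h1.trans ((res_resO_pow_smul _ _ _ _ _).trans ?_))
  · exact (res_res (M := M) _ _ _).symm
  · refine (congrArg _ h2).trans ?_
    change _ = (show Γ(M, j ⁻¹ᵁ Y.basicOpen f) from
      (j.app _ (resO (Y.basicOpen_le f) f ^ n)) • (show Γ(M, j ⁻¹ᵁ Y.basicOpen f) from s))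
    rw [map_pow, resO_app]

lemma exists_chartSection_eq {R : CommRingCat.{u}} (i : Spec R ⟶ X) [IsOpenImmersion i]
    (h : ⊤ ≤ i ⁻¹ᵁ i ''ᵁ ⊤) (f : R) : ∃ f' : Γ(X, i ''ᵁ ⊤), chartSection i h f' = f := by
  refine ⟨(i.appIso ⊤).inv ((Scheme.ΓSpecIso R).inv f), ?_⟩
  have h1 : i.appLE (i ''ᵁ ⊤) ⊤ h = (i.appIso ⊤).hom := (i.appIso_hom' ⊤).symm
  have h2 : (i.appIso ⊤).hom ((i.appIso ⊤).inv ((Scheme.ΓSpecIso R).inv f)) =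
      (Scheme.ΓSpecIso R).inv f := congr($((i.appIso ⊤).inv_hom_id) _)
  rw [chartSection, h1]
  exact (congrArg _ h2).trans congr($((Scheme.ΓSpecIso R).inv_hom_id) f)

/-- Every element of `R` is a function on the image of the chart, and for that open subset the two
hypotheses are the two halves of the localization property. -/
lemma isLocalizing_restrict {N : X.Modules} (h₁ : IsTorsionBounded N) (h₂ : IsExtensionBounded N)
    {R : CommRingCat.{u}} (i : Spec R ⟶ X) [IsOpenImmersion i] :
    IsLocalizing (modulesSpecToSheaf.obj (N.restrict i)) := by
  have hO : ⊤ ≤ i ⁻¹ᵁ i ''ᵁ ⊤ := (i.preimage_image_eq ⊤).ge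
  have hc : IsCompact ((i ''ᵁ ⊤ : X.Opens) : Set X) := isCompact_univ.image i.continuous
  rw [isLocalizing_iff_sections]
  refine ⟨fun f s => ?_, fun f t ht => ?_⟩
  · obtain ⟨f, rfl⟩ := exists_chartSection_eq i hO f
    have hb : X.basicOpen f = i ''ᵁ specBasicOpen (chartSection i hO f) := by
      rw [image_specBasicOpen_chartSection, ← Scheme.Hom.image_top_eq_opensRange,
        inf_eq_left.2 (X.basicOpen_le f)]
    obtain ⟨n, t, ht⟩ := h₂ _ f (res N hb.le s)
    refine ⟨n, t, Eq.trans ?_ (pow_smul_restrict_chart i N hO f _ (i.image_mono le_top) n s).symm⟩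
    have h1 := congrArg (res N hb.ge) ht
    have h2 : res N hb.ge (res N hb.le s) = s := (res_res _ _ _).trans (res_self _)
    exact ((res_res (M := N) _ _ _).symm.trans h1).trans
      ((res_resO_pow_smul _ _ _ _ _).trans (congrArg _ h2))
  · obtain ⟨f, rfl⟩ := exists_chartSection_eq i hO f
    have hb : X.basicOpen f = i ''ᵁ specBasicOpen (chartSection i hO f) := by
      rw [image_specBasicOpen_chartSection, ← Scheme.Hom.image_top_eq_opensRange,
        inf_eq_left.2 (X.basicOpen_le f)]
    obtain ⟨n, hn⟩ := h₁ _ hc f t (res_eq_zero_of_le (M := N) hb.le (i.image_mono le_top) ht)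
    refine ⟨n, (pow_smul_restrict_chart i N hO f ⊤ le_rfl n t).trans ?_⟩
    rw [resO_self]
    exact hn

lemma eq_zero_of_app_fst_snd {M N : X.Modules} {U : X.Opens} (t : Γ(M ⊞ N, U))
    (h₁ : (biprod.fst : M ⊞ N ⟶ M).app U t = 0) (h₂ : (biprod.snd : M ⊞ N ⟶ N).app U t = 0) :
    t = 0 := by
  have h : t = (biprod.inl : M ⟶ M ⊞ N).app U ((biprod.fst : M ⊞ N ⟶ M).app U t) +
      (biprod.inr : N ⟶ M ⊞ N).app U ((biprod.snd : M ⊞ N ⟶ N).app U t) :=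
    congr(($(biprod.total (X := M) (Y := N))).app U t).symm
  rw [h, h₁, h₂, map_zero, map_zero, add_zero]

lemma IsTorsionBounded.biprod {M N : X.Modules} (hM : IsTorsionBounded M)
    (hN : IsTorsionBounded N) : IsTorsionBounded (M ⊞ N) := by
  intro O hO f t ht
  obtain ⟨n, hn⟩ := hM O hO f ((biprod.fst : M ⊞ N ⟶ M).app O t) (by rw [← app_res, ht, map_zero])
  obtain ⟨m, hm⟩ := hN O hO f ((biprod.snd : M ⊞ N ⟶ N).app O t) (by rw [← app_res, ht, map_zero])
  refine ⟨m + n, eq_zero_of_app_fst_snd _ ?_ ?_⟩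
  · rw [Hom.app_smul, pow_add, mul_smul, hn, smul_zero]
  · rw [Hom.app_smul, pow_add, mul_comm, mul_smul, hm, smul_zero]

lemma isTorsionBounded_of_isZero {M : X.Modules} (h : IsZero M) : IsTorsionBounded M := by
  intro O _ f t _
  have := (isZero_iff_subsingleton M).1 h O
  exact ⟨0, Subsingleton.elim _ _⟩

/-- `T'` is the direct sum of the `T i` over `s`. Since each `p i` with `i ∈ s` factors through
`p'`, the kernel of `p'` lies in all the kernels of these `p i`. -/
lemma exists_common_quotient {Q : X.Modules} (V : X.Opens) {ι : Type*} (s : Finset ι)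
    (T : ι → X.Modules) (p : ∀ i, Q ⟶ T i) (hT : ∀ i, IsTorsionBounded (T i))
    (hV : ∀ i, ∀ O ≤ V, Subsingleton Γ(T i, O)) :
    ∃ (T' : X.Modules) (p' : Q ⟶ T'), IsTorsionBounded T' ∧ (∀ O ≤ V, Subsingleton Γ(T', O)) ∧
      ∀ i ∈ s, ∃ r, p' ≫ r = p i := by
  classical
  induction s using Finset.induction_on with
  | empty =>
    obtain ⟨Z, hZ⟩ := HasZeroObject.zero (C := X.Modules)
    exact ⟨Z, 0, isTorsionBounded_of_isZero hZ,
      fun O _ => (isZero_iff_subsingleton _).1 hZ O, by simp⟩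
  | insert i s _ ih =>
    obtain ⟨T', p', h₁, h₂, h₃⟩ := ih
    refine ⟨T i ⊞ T', biprod.lift (p i) p', (hT i).biprod h₁, fun O hO => ?_, fun k hk => ?_⟩
    · have := hV i O hO
      have := h₂ O hO
      suffices ∀ t : Γ(T i ⊞ T', O), t = 0 from ⟨fun a b => (this a).trans (this b).symm⟩
      exact fun t => eq_zero_of_app_fst_snd t (Subsingleton.elim _ _) (Subsingleton.elim _ _)
    · obtain rfl | hk := Finset.mem_insert.1 hk
      · exact ⟨biprod.fst, by simp⟩
      · obtain ⟨r, hr⟩ := h₃ k hk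
        exact ⟨biprod.snd ≫ r, by simp [hr]⟩

/-- By adjunction `c` factors through the restriction of `p`, so over the chart the kernel of `p`
lies in that of `c`. It is the kernel of `kernel c ⟶ T.restrict i`, which has coherent source and
torsion bounded target. -/
lemma isTildeFinite_kernel_restrict {Q T : X.Modules} (p : Q ⟶ T) (hT : IsTorsionBounded T)
    {R : CommRingCat.{u}} [IsNoetherianRing R] (i : Spec R ⟶ X) [IsOpenImmersion i]
    {C : (Spec R).Modules} (c : Q.restrict i ⟶ C) (hc : IsTildeFinite (kernel c))
    (r : T ⟶ (pushforward i).obj C)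
    (hr : p ≫ r = (restrictAdjunction i).homEquiv _ _ c) :
    IsTildeFinite ((kernel p).restrict i) := by
  let F := restrictFunctor i
  have hc' : c = F.map p ≫ ((restrictAdjunction i).homEquiv _ _).symm r := by
    rw [← (restrictAdjunction i).homEquiv_naturality_left_symm, hr, Equiv.symm_apply_apply]
  let k := kernel.ι c ≫ F.map p
  let S := ShortComplex.mk (kernel.ι k) k (kernel.condition k)
  have : Mono S.f := inferInstanceAs (Mono (kernel.ι _))
  have h := IsTildeFinite.kernel_of_isTorsionBounded (S := S) (ShortComplex.exact_kernel _) hc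
    (hT.restrict i)
  refine h.of_iso ?_
  have hk : IsLimit (KernelFork.ofι (f := F.map p) (kernel.ι k ≫ kernel.ι c) (by
      rw [Category.assoc]; exact kernel.condition k)) :=
    KernelFork.IsLimit.ofι' _ _ fun {A} a ha => by
      have ha' : a ≫ c = 0 := by
        rw [hc', reassoc_of% ha, zero_comp]
      exact ⟨kernel.lift k (kernel.lift c a ha') (by simp [k, ha]), by simp⟩
  exact (hk.conePointUniqueUpToIso (kernelIsKernel _)) ≪≫ (PreservesKernel.iso F p).symm

/-- A coherent sheaf on an open subscheme of a Noetherian scheme extends to a coherent subsheaf of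
its direct image. -/
theorem exists_coherent_extension [IsLocallyNoetherian Y] [NoetherianSpace Y] [NoetherianSpace X]
    (j : X ⟶ Y) [IsOpenImmersion j] {M : X.Modules} (hM : isCoherent X M) :
    ∃ (N : Y.Modules) (ι : N ⟶ (pushforward j).obj M), isCoherent Y N ∧ Mono ι ∧
      ∀ O ≤ j.opensRange, Function.Bijective (ι.app O) := by
  let Q := (pushforward j).obj M
  have hQ₁ : IsTorsionBounded Q := (isTorsionBounded_of_isCoherent hM).pushforward j
  have hQ₂ : IsExtensionBounded Q := (isExtensionBounded_of_isCoherent hM).pushforward j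
  -- On an affine chart the direct image is quasi-coherent, and over the trace of `X` it is
  -- coherent, being a restriction of `M`.
  have hch (x : Y) : ∃ (R : CommRingCat.{u}) (i : Spec R ⟶ Y) (_ : IsOpenImmersion i),
      x ∈ i.opensRange ∧ ∃ (C : (Spec R).Modules) (c : Q.restrict i ⟶ C), IsTorsionBounded C ∧
        (∀ O ≤ i ⁻¹ᵁ j.opensRange, Subsingleton Γ(C, O)) ∧ IsTildeFinite (kernel c) := by
    obtain ⟨_, ⟨W, hW, rfl⟩, hxW, -⟩ := Y.isBasis_affineOpens.exists_subset_of_mem_open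
      (show x ∈ ((⊤ : Y.Opens) : Set Y) from trivial) (⊤ : Y.Opens).isOpen
    have hW' : IsAffineOpen W := hW
    have : IsNoetherianRing Γ(Y, W) := isLocallyNoetherian_Spec.1
      (isLocallyNoetherian_of_isOpenImmersion hW'.fromSpec)
    let i := hW'.fromSpec
    refine ⟨_, i, inferInstance, ?_, exists_tildeFinite_kernel (V := i ⁻¹ᵁ j.opensRange)
      (isLocalizing_restrict hQ₁ hQ₂ i) ?_⟩
    · rw [IsAffineOpen.opensRange_fromSpec]; exact hxW
    · let V := i ⁻¹ᵁ j.opensRange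
      have hV : Set.range (V.ι ≫ i) ⊆ Set.range j := by
        rintro _ ⟨y, rfl⟩
        exact y.2
      let g := IsOpenImmersion.lift j (V.ι ≫ i) hV
      have hg : g ≫ j = V.ι ≫ i := IsOpenImmersion.lift_fac _ _ _
      have : IsOpenImmersion g := by
        have : IsOpenImmersion (g ≫ j) := by rw [hg]; infer_instance
        exact IsOpenImmersion.of_comp g j
      refine (isCoherent V).prop_of_iso ?_ (isCoherent_restrict hM g)
      exact (restrictFunctor g).mapIso ((asIso (restrictAdjunction j).counit).app M).symm ≪≫
        (restrictFunctorComp g j).symm.app Q ≪≫ (restrictFunctorCongr hg).app Q ≪≫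
        (restrictFunctorComp V.ι i).app Q
  choose R i hi hx C c hC hCV hc using hch
  obtain ⟨J, hJ⟩ := isCompact_univ.elim_finite_subcover
    (fun x : Y => ((i x).opensRange : Set Y)) (fun x => (i x).opensRange.isOpen)
    fun x _ => Set.mem_iUnion.2 ⟨x, hx x⟩
  -- The local quotients are spread out to `Y` as direct images of the `C x` and combined. The
  -- kernel of the resulting `p` is globally defined, coherent on every chart of the cover, and
  -- equal to `Q` over the image of `j`, where `T` vanishes.
  obtain ⟨T, p, hT, hTV, hr⟩ := exists_common_quotient (Q := Q) j.opensRange J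
    (fun x => (pushforward (i x)).obj (C x))
    (fun x => (restrictAdjunction (i x)).homEquiv _ _ (c x))
    (fun x => by
      have : IsLocallyNoetherian (Spec (R x)) := isLocallyNoetherian_of_isOpenImmersion (i x)
      have : IsNoetherianRing (R x) := isLocallyNoetherian_Spec.1 this
      have : NoetherianSpace (Spec (R x)) := inferInstanceAs (NoetherianSpace (PrimeSpectrum (R x)))
      exact (hC x).pushforward (i x))
    (fun x O hO => hCV x _ ((i x).preimage_mono hO))
  refine ⟨kernel p, kernel.ι p, fun x => ?_, inferInstance, fun O hO =>
    ⟨app_injective_of_mono _ _, fun m => ?_⟩⟩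
  · obtain ⟨y, hy, hxy⟩ := Set.mem_iUnion₂.1 (hJ (Set.mem_univ x))
    have : IsNoetherianRing (R y) :=
      isLocallyNoetherian_Spec.1 (isLocallyNoetherian_of_isOpenImmersion (i y))
    obtain ⟨r, hr⟩ := hr y hy
    exact ⟨R y, i y, hi y, hxy, isTildeFinite_kernel_restrict p hT (i y) (c y) (hc y) r hr⟩
  · have := hTV O hO
    exact exists_app_eq_of_exact (S := ShortComplex.mk (kernel.ι p) p (kernel.condition p))
      (ShortComplex.exact_kernel p) O m (Subsingleton.elim _ _)

end AlgebraicGeometry.Scheme.Modules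

/-! ### Extension of complexes and morphisms from an open subscheme -/

/-- The preimage of the subobject `N` under `f` is a subobject of `K` through which `a` factors, so
it contains the image of `a`. -/
lemma CategoryTheory.Limits.exists_image_lift {C : Type*} [Category* C] [HasPullbacks C]
    {P K K' N : C} (a : P ⟶ K) [HasImage a] (n : N ⟶ K') [Mono n] (f : K ⟶ K') (b : P ⟶ N)
    (h : b ≫ n = a ≫ f) : ∃ d : image a ⟶ N, d ≫ n = image.ι a ≫ f := by
  let F : MonoFactorisation a :=
    { I := pullback f n, m := pullback.fst f n, e := pullback.lift a b h.symm, fac := pullback.lift_fst _ _ _ }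
  refine ⟨image.lift F ≫ pullback.snd f n, ?_⟩
  rw [Category.assoc, ← pullback.condition, ← Category.assoc]
  exact congrArg (· ≫ f) (image.lift_fac F)

namespace AlgebraicGeometry.Scheme.Modules
variable {X Y : Scheme.{u}}

lemma isIso_restrict_map {M N : Y.Modules} (j : X ⟶ Y) [IsOpenImmersion j] (f : M ⟶ N)
    (hf : ∀ O ≤ j.opensRange, Function.Bijective (f.app O)) : IsIso ((restrictFunctor j).map f) := by
  rw [Hom.isIso_iff_isIso_app]
  exact fun U => (ConcreteCategory.isIso_iff_bijective _).2 (hf _ (j.image_le_opensRange U))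

/-- A family of coherent subsheaves of a complex of sheaves that is stable under the differential,
as a complex of coherent sheaves. -/
noncomputable def cohSubcomplex {K : CochainComplex X.Modules ℤ} (N : ℤ → X.Modules)
    (hN : ∀ i, isCoherent X (N i)) (m : ∀ i, N i ⟶ K.X i) [∀ i, Mono (m i)]
    (d : ∀ i k, N i ⟶ N k) (hd : ∀ i k, d i k ≫ m k = m i ≫ K.d i k) :
    CochainComplex (Coh X) ℤ where
  X i := ⟨N i, hN i⟩
  d i k := ObjectProperty.homMk (d i k)
  shape i k h := by
    apply (isCoherent X).ι.map_injective
    change d i k = 0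
    rw [← cancel_mono (m k), hd, K.shape i k h, comp_zero, zero_comp]
  d_comp_d' i k l _ _ := by
    apply (isCoherent X).ι.map_injective
    change d i k ≫ d k l = 0
    rw [← cancel_mono (m l), Category.assoc, hd, reassoc_of% (hd i k), K.d_comp_d, comp_zero,
      zero_comp]

/-- In degree `i` one takes the sum of the image of `P i` and the differential of the image of `P (i
- 1)`. Since the differential squares to zero this is a subcomplex, and it is coherent as an image
in a torsion bounded sheaf. -/
lemma exists_cohSubcomplex [IsLocallyNoetherian X] (K : CochainComplex X.Modules ℤ)
    (hK : ∀ i, IsTorsionBounded (K.X i)) (P : ℤ → X.Modules) (m : ∀ i, P i ⟶ K.X i)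
    (hP : ∀ i, isCoherent X (P i)) :
    ∃ (N : CochainComplex (Coh X) ℤ) (n : ∀ i, (N.X i).obj ⟶ K.X i), (∀ i, Mono (n i)) ∧
      (∀ i, ∃ r, r ≫ n i = m i) ∧ ∀ i k, (N.d i k).hom ≫ n k = n i ≫ K.d i k := by
  let a (i : ℤ) : P i ⊞ P (i - 1) ⟶ K.X i := biprod.desc (m i) (m (i - 1) ≫ K.d (i - 1) i)
  have hN (i : ℤ) : isCoherent X (image (a i)) :=
    isCoherent_image (a i) (isCoherent_biprod (hP _) (hP _)) (hK i)
  have hd (i k : ℤ) : ∃ d : image (a i) ⟶ image (a k), d ≫ image.ι (a k) = image.ι (a i) ≫ K.d i k := by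
    by_cases hik : (ComplexShape.up ℤ).Rel i k
    · obtain rfl : i = k - 1 := by
        have : i + 1 = k := hik
        omega
      -- The differential takes the first summand to the second summand in degree `k` and
      -- annihilates the other one.
      let b : P (k - 1) ⊞ P (k - 1 - 1) ⟶ image (a k) :=
        biprod.desc (biprod.inr ≫ factorThruImage (a k)) 0
      refine exists_image_lift (a (k - 1)) (image.ι (a k)) (K.d (k - 1) k) b ?_
      apply biprod.hom_ext'
      · simp only [b, biprod.inl_desc_assoc, Category.assoc, image.fac]
        simp [a]
      · simp [a, b]
    · exact ⟨0, by rw [K.shape i k hik, comp_zero, zero_comp]⟩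
  choose d hd using hd
  exact ⟨cohSubcomplex _ hN (fun i => image.ι (a i)) d hd, fun i => image.ι (a i),
    fun i => inferInstanceAs (Mono (image.ι (a i))), fun i => ⟨biprod.inl ≫ factorThruImage (a i),
      (Category.assoc _ _ _).trans ((congrArg _ (image.fac (a i))).trans (biprod.inl_desc _ _))⟩, hd⟩

/-- A complex of coherent sheaves on an open subscheme of a Noetherian scheme extends to a complex
of coherent sheaves. -/
theorem exists_complex_extension [IsLocallyNoetherian Y] [NoetherianSpace Y] [NoetherianSpace X]
    (j : X ⟶ Y) [IsOpenImmersion j] (M : CochainComplex (Coh X) ℤ) :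
    ∃ N : CochainComplex (Coh Y) ℤ,
      Nonempty (((cohRestrict j).mapHomologicalComplex _).obj N ≅ M) ∧
      ∀ i, IsZero (M.X i) → IsZero (N.X i) := by
  let K : CochainComplex Y.Modules ℤ :=
    (((isCoherent X).ι ⋙ pushforward j).mapHomologicalComplex _).obj M
  choose P m hP hm hb using fun i => exists_coherent_extension j (M.X i).property
  obtain ⟨N, n, hn, hr, hd⟩ := exists_cohSubcomplex K
    (fun i => (isTorsionBounded_of_isCoherent (M.X i).property).pushforward j) P m hP
  let n' (i : ℤ) : (N.X i).obj ⟶ (pushforward j).obj (M.X i).obj := n i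
  have hd' (i k : ℤ) : (N.d i k).hom ≫ n' k = n' i ≫ (pushforward j).map (M.d i k).hom := hd i k
  -- The subsheaf contains the extension `P i`, which already is the whole direct image over the
  -- range of `j`.
  have hι (i : ℤ) : ∀ O ≤ j.opensRange, Function.Bijective ((n' i).app O) := by
    refine fun O hO => ⟨app_injective_of_mono (n i) _, fun t => ?_⟩
    obtain ⟨s, rfl⟩ := (hb i O hO).2 t
    obtain ⟨r, hr⟩ := hr i
    exact ⟨r.app O s, congr(($hr).app O s)⟩
  let e (i : ℤ) : (restrictFunctor j).obj (N.X i).obj ⟶ (M.X i).obj :=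
    ((restrictAdjunction j).homEquiv _ _).symm (n' i)
  have he (i : ℤ) : IsIso (e i) := by
    have := isIso_restrict_map j (n' i) (hι i)
    have h : e i = (restrictFunctor j).map (n' i) ≫ (restrictAdjunction j).counit.app (M.X i).obj :=
      (restrictAdjunction j).homEquiv_counit _ _ _
    rw [h]
    exact IsIso.comp_isIso
  let e' (i : ℤ) : (((cohRestrict j).mapHomologicalComplex _).obj N).X i ≅ M.X i :=
    (isCoherent X).isoMk (@asIso _ _ _ _ (e i) (he i))
  refine ⟨N, ⟨HomologicalComplex.Hom.isoOfComponents e' fun i k _ => ?_⟩, fun i hi => ?_⟩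
  · apply (isCoherent X).ι.map_injective
    refine ((restrictAdjunction j).homEquiv_naturality_right_symm (n' i) (M.d i k).hom).symm.trans ?_
    refine Eq.trans ?_ ((restrictAdjunction j).homEquiv_naturality_left_symm (N.d i k).hom (n' k))
    rw [hd']
  · have h : IsZero (K.X i) :=
      ((isCoherent X).ι ⋙ pushforward j).map_isZero hi
    rw [IsZero.iff_id_eq_zero]
    apply (isCoherent Y).ι.map_injective
    change 𝟙 (N.X i).obj = 0
    rw [← cancel_mono (n i)]
    exact h.eq_of_tgt _ _

lemma isIso_restrict_map_unit (j : X ⟶ Y) [IsOpenImmersion j] (M : Y.Modules) :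
    IsIso ((restrictFunctor j).map ((restrictAdjunction j).unit.app M)) := by
  have h := (restrictAdjunction j).left_triangle_components M
  have : IsIso ((restrictAdjunction j).counit.app ((restrictFunctor j).obj M)) := inferInstance
  exact IsIso.of_isIso_fac_right h

/-- A morphism between the restrictions to an open subscheme of two complexes of coherent sheaves
extends after replacing the source by a complex with the same restriction. -/
theorem exists_hom_extension [IsLocallyNoetherian Y] [NoetherianSpace X]
    (j : X ⟶ Y) [IsOpenImmersion j] [IsLocallyNoetherian X] {N K : CochainComplex (Coh Y) ℤ}
    (φ : ((cohRestrict j).mapHomologicalComplex _).obj N ⟶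
      ((cohRestrict j).mapHomologicalComplex _).obj K) :
    ∃ (N' : CochainComplex (Coh Y) ℤ) (α : N' ⟶ N) (β : N' ⟶ K),
      IsIso (((cohRestrict j).mapHomologicalComplex _).map α) ∧
      ((cohRestrict j).mapHomologicalComplex _).map β =
        ((cohRestrict j).mapHomologicalComplex _).map α ≫ φ ∧
      ∀ i, IsZero (N.X i) → IsZero (K.X i) → IsZero (N'.X i) := by
  let adj := restrictAdjunction j
  let f (i : ℤ) : (N.X i).obj ⟶ (pushforward j).obj ((restrictFunctor j).obj (K.X i).obj) :=
    adj.homEquiv _ _ (φ.f i).hom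
  let g (i : ℤ) : (K.X i).obj ⟶ (pushforward j).obj ((restrictFunctor j).obj (K.X i).obj) :=
    adj.unit.app _
  -- `N'` is the degreewise fibre product of `N` and `K` over `j_* j^* K`. Over the open subscheme
  -- the unit `g i` is an isomorphism, hence so is the projection to `N`.
  have hc (i : ℤ) : isCoherent Y (Limits.pullback (f i) (g i)) :=
    isCoherent_pullback_of_isTorsionBounded (IsPullback.of_hasPullback (f i) (g i))
      (N.X i).property (K.X i).property
      ((isTorsionBounded_of_isCoherent (isCoherent_restrict (K.X i).property j)).pushforward j)
  have hf (i k : ℤ) : (N.d i k).hom ≫ f k =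
      f i ≫ (pushforward j).map ((restrictFunctor j).map (K.d i k).hom) := by
    have hφ : (φ.f i).hom ≫ (restrictFunctor j).map (K.d i k).hom =
        (restrictFunctor j).map (N.d i k).hom ≫ (φ.f k).hom :=
      congrArg InducedCategory.Hom.hom (φ.comm i k)
    refine (adj.homEquiv_naturality_left _ _).symm.trans ((congrArg _ hφ.symm).trans ?_)
    exact adj.homEquiv_naturality_right _ _
  have hg (i k : ℤ) : (K.d i k).hom ≫ g k =
      g i ≫ (pushforward j).map ((restrictFunctor j).map (K.d i k).hom) :=
    adj.unit.naturality (K.d i k).hom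
  obtain ⟨d, hd, hd'⟩ : ∃ d : ∀ i k : ℤ, Limits.pullback (f i) (g i) ⟶ Limits.pullback (f k) (g k),
      (∀ i k, d i k ≫ pullback.fst _ _ = pullback.fst _ _ ≫ (N.d i k).hom) ∧
      ∀ i k, d i k ≫ pullback.snd _ _ = pullback.snd _ _ ≫ (K.d i k).hom :=
    ⟨fun i k => pullback.map _ _ _ _ (N.d i k).hom (K.d i k).hom
      ((pushforward j).map ((restrictFunctor j).map (K.d i k).hom)) (hf i k).symm (hg i k).symm,
      fun i k => pullback.lift_fst _ _ _, fun i k => pullback.lift_snd _ _ _⟩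
  have hdd (i k l : ℤ) : (N.d i k).hom ≫ (N.d k l).hom = 0 :=
    congrArg InducedCategory.Hom.hom (N.d_comp_d i k l)
  have hdd' (i k l : ℤ) : (K.d i k).hom ≫ (K.d k l).hom = 0 :=
    congrArg InducedCategory.Hom.hom (K.d_comp_d i k l)
  let N' : CochainComplex (Coh Y) ℤ :=
    { X i := ⟨Limits.pullback (f i) (g i), hc i⟩
      d i k := ObjectProperty.homMk (d i k)
      shape i k h := by
        apply (isCoherent Y).ι.map_injective
        change d i k = 0
        have h1 : (N.d i k).hom = 0 := congrArg InducedCategory.Hom.hom (N.shape i k h)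
        have h2 : (K.d i k).hom = 0 := congrArg InducedCategory.Hom.hom (K.shape i k h)
        apply pullback.hom_ext
        · rw [hd, h1, comp_zero, zero_comp]
        · rw [hd', h2, comp_zero, zero_comp]
      d_comp_d' i k l _ _ := by
        apply (isCoherent Y).ι.map_injective
        change d i k ≫ d k l = 0
        apply pullback.hom_ext
        · rw [Category.assoc, hd, reassoc_of% (hd i k), hdd, comp_zero, zero_comp]
        · rw [Category.assoc, hd', reassoc_of% (hd' i k), hdd', comp_zero, zero_comp] }
  let α : N' ⟶ N :=
    { f i := ObjectProperty.homMk (pullback.fst (f i) (g i))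
      comm' i k _ := by
        apply (isCoherent Y).ι.map_injective
        exact (hd i k).symm }
  let β : N' ⟶ K :=
    { f i := ObjectProperty.homMk (pullback.snd (f i) (g i))
      comm' i k _ := by
        apply (isCoherent Y).ι.map_injective
        exact (hd' i k).symm }
  refine ⟨N', α, β, ?_, ?_, fun i h h' => ?_⟩
  · have h (i : ℤ) : IsIso ((((cohRestrict j).mapHomologicalComplex (ComplexShape.up ℤ)).map α).f i) := by
      have h1 := (IsPullback.of_hasPullback (f i) (g i)).map (restrictFunctor j)
      have h2 : IsIso ((restrictFunctor j).map (g i)) := isIso_restrict_map_unit j _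
      have h3 : IsIso ((restrictFunctor j).map (pullback.fst (f i) (g i))) :=
        h1.isIso_fst_of_isIso
      have : IsIso ((isCoherent X).ι.map
          ((((cohRestrict j).mapHomologicalComplex (ComplexShape.up ℤ)).map α).f i)) := h3
      exact isIso_of_reflects_iso _ (isCoherent X).ι
    exact HomologicalComplex.Hom.isIso_of_components _
  · apply HomologicalComplex.hom_ext
    intro i
    apply (isCoherent X).ι.map_injective
    change (restrictFunctor j).map (pullback.snd (f i) (g i)) =
      (restrictFunctor j).map (pullback.fst (f i) (g i)) ≫ (φ.f i).hom
    apply (adj.homEquiv _ _).injective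
    refine Eq.trans ?_ ((pullback.condition (f := f i) (g := g i)).symm.trans
      (adj.homEquiv_naturality_left _ _).symm)
    rw [adj.homEquiv_unit]
    exact (adj.unit.naturality (pullback.snd (f i) (g i))).symm
  · rw [IsZero.iff_id_eq_zero]
    apply (isCoherent Y).ι.map_injective
    change 𝟙 (Limits.pullback (f i) (g i)) = 0
    apply pullback.hom_ext
    · exact ((isCoherent Y).ι.map_isZero h).eq_of_tgt _ _
    · exact ((isCoherent Y).ι.map_isZero h').eq_of_tgt _ _

open DerivedCategory in
/-- A morphism between the restrictions to an open subscheme of two bounded complexes of coherent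
sheaves extends after replacing the source by a complex with the same restriction. -/
theorem exists_roof_extension [IsLocallyNoetherian Y] [NoetherianSpace Y] [NoetherianSpace X]
    [IsLocallyNoetherian X] (j : X ⟶ Y) [IsOpenImmersion j] {F G : DerivedCategory (Coh Y)}
    (hF : TStructure.t.bounded F) (hG : TStructure.t.bounded G)
    (φ : (cohRestrict j).mapDerivedCategory.obj F ⟶ (cohRestrict j).mapDerivedCategory.obj G) :
    ∃ (N : DerivedCategory (Coh Y)) (a : N ⟶ F) (b : N ⟶ G), TStructure.t.bounded N ∧
      IsIso ((cohRestrict j).mapDerivedCategory.map a) ∧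
      (cohRestrict j).mapDerivedCategory.map b = (cohRestrict j).mapDerivedCategory.map a ≫ φ := by
  obtain ⟨⟨a₁, _⟩, ⟨b₁, _⟩⟩ := hF
  obtain ⟨⟨a₂, _⟩, ⟨b₂, _⟩⟩ := hG
  obtain ⟨A, _, _, ⟨e₁⟩⟩ := exists_iso_Q_obj_of_isGE_of_isLE F a₁ b₁
  obtain ⟨B, _, _, ⟨e₂⟩⟩ := exists_iso_Q_obj_of_isGE_of_isLE G a₂ b₂
  let Φ := (cohRestrict j).mapDerivedCategory
  let Ψ := (cohRestrict j).mapHomologicalComplex (ComplexShape.up ℤ)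
  let τ : Q ⋙ Φ ≅ Ψ ⋙ Q := (cohRestrict j).mapDerivedCategoryFactors
  -- All complexes, on `X` and on `Y`, are kept strictly within the common range `[a, b]`, so that
  -- the apex of the roof is bounded.
  let a := min a₁ a₂
  let b := max b₁ b₂
  have : A.IsStrictlyGE a := A.isStrictlyGE_of_ge a a₁ (min_le_left _ _)
  have : B.IsStrictlyGE a := B.isStrictlyGE_of_ge a a₂ (min_le_right _ _)
  have : A.IsStrictlyLE b := A.isStrictlyLE_of_le b₁ b (le_max_left _ _)
  have : B.IsStrictlyLE b := B.isStrictlyLE_of_le b₂ b (le_max_right _ _)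
  let E₁ : Φ.obj F ≅ Q.obj (Ψ.obj A) := Φ.mapIso e₁ ≪≫ τ.app A
  let E₂ : Φ.obj G ≅ Q.obj (Ψ.obj B) := Φ.mapIso e₂ ≪≫ τ.app B
  let φ' : Q.obj (Ψ.obj A) ⟶ Q.obj (Ψ.obj B) := E₁.inv ≫ φ ≫ E₂.hom
  have hZ (K : CochainComplex (Coh Y) ℤ) (i : ℤ) (h : IsZero (K.X i)) : IsZero ((Ψ.obj K).X i) :=
    (cohRestrict j).map_isZero h
  have : CochainComplex.IsStrictlyGE (Ψ.obj A) a := (CochainComplex.isStrictlyGE_iff _ _).2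
    fun i hi => hZ _ _ (A.isZero_of_isStrictlyGE a i hi)
  have : CochainComplex.IsStrictlyGE (Ψ.obj B) a := (CochainComplex.isStrictlyGE_iff _ _).2
    fun i hi => hZ _ _ (B.isZero_of_isStrictlyGE a i hi)
  have : CochainComplex.IsStrictlyLE (Ψ.obj A) b := (CochainComplex.isStrictlyLE_iff _ _).2
    fun i hi => hZ _ _ (A.isZero_of_isStrictlyLE b i hi)
  obtain ⟨M, _, _, s, hs, g, hg⟩ := right_fac_of_isStrictlyLE_of_isStrictlyGE a b φ'
  -- The morphism is represented on `X` by a roof with apex `M`. The apex is extended first, then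
  -- its two legs in turn, each at the price of a new apex with the same restriction.
  obtain ⟨N₁, ⟨e⟩, h₁⟩ := exists_complex_extension j M
  obtain ⟨N₂, α₂, β₂, hα₂, hβ₂, h₂⟩ := exists_hom_extension j (N := N₁) (K := A) (e.hom ≫ s)
  obtain ⟨N₃, α₃, β₃, hα₃, hβ₃, h₃⟩ := exists_hom_extension j (N := N₂) (K := B)
    (Ψ.map α₂ ≫ e.hom ≫ g)
  have hN₃ (i : ℤ) (h1 : IsZero (M.X i)) (h2 : IsZero (A.X i)) (h3 : IsZero (B.X i)) :
      IsZero (N₃.X i) := h₃ i (h₂ i (h₁ i h1) h2) h3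
  have hGE : N₃.IsStrictlyGE a := (CochainComplex.isStrictlyGE_iff _ _).2 fun i hi =>
    hN₃ i (M.isZero_of_isStrictlyGE a i hi) (A.isZero_of_isStrictlyGE a i hi)
      (B.isZero_of_isStrictlyGE a i hi)
  have hLE : N₃.IsStrictlyLE b := (CochainComplex.isStrictlyLE_iff _ _).2 fun i hi =>
    hN₃ i (M.isZero_of_isStrictlyLE b i hi) (A.isZero_of_isStrictlyLE b i hi)
      (B.isZero_of_isStrictlyLE b i hi)
  have key (P P' : CochainComplex (Coh Y) ℤ) (f : P ⟶ P') {H : DerivedCategory (Coh Y)}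
      (ε : H ≅ Q.obj P') : Φ.map (Q.map f ≫ ε.inv) =
        τ.hom.app P ≫ Q.map (Ψ.map f) ≫ (Φ.mapIso ε ≪≫ τ.app P').inv := by
    have h : Φ.map (Q.map f) ≫ τ.hom.app P' = τ.hom.app P ≫ Q.map (Ψ.map f) := τ.hom.naturality f
    rw [← Category.assoc, Iso.eq_comp_inv, ← h, Functor.map_comp]
    simp [← Functor.map_comp_assoc]
  have hsα : Ψ.map (α₃ ≫ β₂) = Ψ.map α₃ ≫ Ψ.map α₂ ≫ e.hom ≫ s := by
    rw [Functor.map_comp, hβ₂]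
  have hβ : Q.map (Ψ.map β₃) = Q.map (Ψ.map (α₃ ≫ β₂)) ≫ φ' := by
    have h : Ψ.map β₃ = Ψ.map α₃ ≫ Ψ.map α₂ ≫ e.hom ≫ g := hβ₃
    rw [hsα, h, hg]
    simp only [Functor.map_comp, Category.assoc, IsIso.hom_inv_id_assoc]
  refine ⟨Q.obj N₃, Q.map (α₃ ≫ β₂) ≫ e₁.inv, Q.map β₃ ≫ e₂.inv, ⟨⟨a, ?_⟩, ⟨b, ?_⟩⟩, ?_, ?_⟩
  · exact (isGE_Q_obj_iff _ _).2 inferInstance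
  · exact (isLE_Q_obj_iff _ _).2 inferInstance
  · have : IsIso (Ψ.map α₃) := hα₃
    have : IsIso (Ψ.map α₂) := hα₂
    have : IsIso (Q.map (Ψ.map (α₃ ≫ β₂))) := by
      rw [hsα, Functor.map_comp, Functor.map_comp, Functor.map_comp]
      infer_instance
    change IsIso (Φ.map _)
    rw [key]
    infer_instance
  · change Φ.map _ = Φ.map _ ≫ φ
    rw [key, key, hβ]
    change _ ≫ _ ≫ E₂.inv = (_ ≫ _ ≫ E₁.inv) ≫ φ
    simp [φ']

end AlgebraicGeometry.Scheme.Modules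

/-! ### Killing morphisms in a triangulated category; dévissage in derived categories -/

open Pretriangulated

lemma CategoryTheory.NatTrans.app_eq_zero_of_iso {C : Type*} [Category* C] [HasZeroMorphisms C]
    {T : C ⥤ C} (σ : 𝟭 C ⟶ T) {X Y : C} (e : X ≅ Y) (h : σ.app Y = 0) : σ.app X = 0 := by
  have h1 := σ.naturality e.hom
  rw [h, comp_zero] at h1
  rw [← cancel_mono (T.map e.hom), zero_comp, ← h1]

section
variable {C : Type*} [Category* C] [Preadditive C] [HasZeroObject C] [HasShift C ℤ]
  [∀ n : ℤ, (shiftFunctor C n).Additive] [Pretriangulated C]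

/-- Let `c ≫ s₁ = 0` with `c : X ⟶ G` and `s₁ : G ⟶ G₁`, and let `σ : 𝟭 C ⟶ T` be a natural
transformation that vanishes on `X`. Replacing the fibre `Q` of `s₁` by `T Q` gives `s : G ⟶ G₂`
with `c ≫ s = 0`. -/
lemma CategoryTheory.Pretriangulated.exists_killing_extension {T : C ⥤ C} (σ : 𝟭 C ⟶ T) {X G G₁ : C}
    (hX : σ.app X = 0) (c : X ⟶ G) (s₁ : G ⟶ G₁) (hc : c ≫ s₁ = 0) (P : ObjectProperty C)
    [P.IsClosedUnderIsomorphisms] [P.IsTriangulatedClosed₂] (hPs : ∀ X, P X → P (X⟦(-1 : ℤ)⟧))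
    (hPT : ∀ X, P X → P (T.obj X)) (hG : P G) (hG₁ : P G₁) :
    ∃ (Q : C) (f : Q ⟶ G) (δ : G₁ ⟶ Q⟦(1 : ℤ)⟧) (_ : Triangle.mk f s₁ δ ∈ distTriang C)
      (G₂ : C) (i : T.obj Q ⟶ G₂) (p : G₂ ⟶ G₁) (δ' : G₁ ⟶ (T.obj Q)⟦(1 : ℤ)⟧)
      (_ : Triangle.mk i p δ' ∈ distTriang C)
      (φ : Triangle.mk f s₁ δ ⟶ Triangle.mk i p δ'),
      φ.hom₁ = σ.app Q ∧ φ.hom₃ = 𝟙 G₁ ∧ P G₂ ∧ c ≫ φ.hom₂ = 0 := by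
  obtain ⟨Q, f, δ, hT⟩ := distinguished_cocone_triangle₁ s₁
  -- `G₂` is the extension of `G₁` by `T.obj Q` whose class is the image under `σ` of the class of
  -- `G`.
  obtain ⟨G₂, i, p, hT'⟩ := distinguished_cocone_triangle₂ (δ ≫ (σ.app Q)⟦(1 : ℤ)⟧')
  have hQ : P Q := P.ext_of_isTriangulatedClosed₂ _ (inv_rot_of_distTriang _ hT) (hPs _ hG₁) hG
  obtain ⟨s, h₁, h₂⟩ := complete_distinguished_triangle_morphism₂ _ _ hT hT' (σ.app Q) (𝟙 G₁)
    (Category.id_comp _).symm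
  -- `c` factors through the fibre `Q` as `c' ≫ f`, and `c' ≫ σ.app Q` vanishes by naturality
  -- because `σ.app X = 0`.
  obtain ⟨c', hc'⟩ := Triangle.coyoneda_exact₂ _ hT c hc
  refine ⟨Q, f, δ, hT, G₂, i, p, _, hT', Triangle.homMk _ _ (σ.app Q) s (𝟙 _) h₁ h₂
    (Category.id_comp _).symm,
    rfl, rfl, P.ext_of_isTriangulatedClosed₂ _ hT' (hPT _ hQ) hG₁, ?_⟩
  have h₁' : f ≫ s = σ.app Q ≫ i := h₁
  have h₃ : c' ≫ σ.app Q = 0 := by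
    have := σ.naturality c'
    rw [hX, zero_comp] at this
    exact this
  have hc'' : c = c' ≫ f := hc'
  have h₄ : (c' ≫ σ.app Q) ≫ i = 0 := by
    rw [h₃]
    exact zero_comp
  have h₅ : c ≫ s = (c' ≫ f) ≫ s := congrArg (· ≫ s) hc''
  exact h₅.trans ((Category.assoc _ _ _).trans ((congrArg (c' ≫ ·) h₁').trans
    ((Category.assoc _ _ _).symm.trans h₄)))

end

section
variable {A B : Type*} [Category* A] [Category* B] [Abelian A] [Abelian B]
  [HasDerivedCategory A] [HasDerivedCategory B]

namespace DerivedCategory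
open TStructure

lemma isZero_mapDerivedCategory_iff (F : A ⥤ B) [F.Additive] [PreservesFiniteLimits F]
    [PreservesFiniteColimits F] (X : DerivedCategory A) :
    IsZero (F.mapDerivedCategory.obj X) ↔ ∀ n : ℤ, IsZero (F.obj ((homologyFunctor A n).obj X)) := by
  constructor
  · intro h n
    obtain ⟨e⟩ := nonempty_homology_mapDerivedCategory_iso F X n
    exact ((homologyFunctor B n).map_isZero h).of_iso e.symm
  · intro h
    refine isZero_of_forall_homology fun n => ?_
    obtain ⟨e⟩ := nonempty_homology_mapDerivedCategory_iso F X n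
    exact (h n).of_iso e

lemma isLE_mapDerivedCategory (F : A ⥤ B) [F.Additive] [PreservesFiniteLimits F]
    [PreservesFiniteColimits F] (X : DerivedCategory A) (n : ℤ) [X.IsLE n] :
    (F.mapDerivedCategory.obj X).IsLE n := (isLE_iff _ _).2 fun i hi => by
  obtain ⟨e⟩ := nonempty_homology_mapDerivedCategory_iso F X i
  exact (F.map_isZero ((isLE_iff _ _).1 ‹_› i hi)).of_iso e

lemma isGE_mapDerivedCategory (F : A ⥤ B) [F.Additive] [PreservesFiniteLimits F]
    [PreservesFiniteColimits F] (X : DerivedCategory A) (n : ℤ) [X.IsGE n] :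
    (F.mapDerivedCategory.obj X).IsGE n := (isGE_iff _ _).2 fun i hi => by
  obtain ⟨e⟩ := nonempty_homology_mapDerivedCategory_iso F X i
  exact (F.map_isZero ((isGE_iff _ _).1 ‹_› i hi)).of_iso e

/-- A property of bounded complexes that are annihilated by an exact functor `F` may be checked
on the objects of the abelian category that are annihilated by `F`, if it is stable by
extensions. -/
theorem of_bounded_of_isZero (F : A ⥤ B) [F.Additive] [PreservesFiniteLimits F]
    [PreservesFiniteColimits F] (P : ObjectProperty (DerivedCategory A))
    [P.IsClosedUnderIsomorphisms] [P.IsTriangulatedClosed₂]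
    (h₀ : ∀ X, IsZero X → P X)
    (h : ∀ (n : ℤ) (H : A), IsZero (F.obj H) → P ((singleFunctor A n).obj H))
    (X : DerivedCategory A) (hX : t.bounded X) (hF : IsZero (F.mapDerivedCategory.obj X)) :
    P X := by
  -- Induction on the number `n` of degrees `a, …, a + n - 1` in which there may be cohomology; the
  -- top cohomology object is split off by truncation.
  have key (a : ℤ) (n : ℕ) : ∀ X : DerivedCategory A, X.IsGE a → X.IsLE (a + n - 1) →
      IsZero (F.mapDerivedCategory.obj X) → P X := by
    induction n with
    | zero =>
      intro X _ _ _
      exact h₀ X (t.isZero X (a + (0 : ℕ) - 1) a (by simp))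
    | succ n ih =>
      intro X _ _ hF
      obtain ⟨X', X'', h', h'', f, g, δ, hT⟩ := t.exists_triangle X (a + n - 1) (a + n) (by lia)
      have i' : X'.IsLE (a + n - 1) := ⟨h'⟩
      have i'' : X''.IsGE (a + n) := ⟨h''⟩
      have j' : X'.IsGE a := by
        have : t.IsGE (X''⟦(-1 : ℤ)⟧) a := by
          have := t.isGE_shift X'' (a + n) (-1) (a + n + 1) (by lia)
          exact t.isGE_of_ge _ a (a + n + 1) (by lia)
        exact t.isGE₂ _ (inv_rot_of_distTriang _ hT) a this ‹_›
      have j'' : X''.IsLE (a + n) := by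
        have h1 : t.IsLE X (a + n) := t.isLE_of_le X (a + (n + 1 : ℕ) - 1) (a + n) (by simp; lia)
        have : t.IsLE (X'⟦(1 : ℤ)⟧) (a + n) := by
          have := t.isLE_shift X' (a + n - 1) 1 (a + n - 1 - 1) (by lia)
          exact t.isLE_of_le _ (a + n - 1 - 1) (a + n) (by lia)
        exact t.isLE₂ _ (rot_of_distTriang _ hT) (a + n) h1 this
      have hT' := F.mapDerivedCategory.map_distinguished _ hT
      have k' := isLE_mapDerivedCategory F X' (a + n - 1)
      have k'' := isGE_mapDerivedCategory F X'' (a + n)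
      let T' := F.mapDerivedCategory.mapTriangle.obj (Triangle.mk f g δ)
      have hz₂ : IsZero T'.obj₂ := hF
      -- As the image of `X` is zero, the image of `X''` is the shift of that of `X'`. Exactness of
      -- `F` puts it both in degrees at most `a + n - 1` and in degrees at least `a + n`.
      have hz₃ : IsZero (F.mapDerivedCategory.obj X'') := by
        have hiso : IsIso T'.mor₃ := (Triangle.isZero₂_iff_isIso₃ _ hT').1 hz₂
        have : t.IsLE (T'.obj₁⟦(1 : ℤ)⟧) (a + n - 1) := by
          have : t.IsLE (T'.obj₁⟦(1 : ℤ)⟧) (a + n - 1 - 1) := t.isLE_shift (F.mapDerivedCategory.obj X') (a + n - 1) 1 (a + n - 1 - 1) (by lia)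
          exact t.isLE_of_le _ (a + n - 1 - 1) (a + n - 1) (by lia)
        have : t.IsLE (F.mapDerivedCategory.obj X'') (a + n - 1) :=
          t.isLE_of_iso (asIso T'.mor₃).symm (a + n - 1)
        exact t.isZero _ (a + n - 1) (a + n)
      have hz₁ : IsZero (F.mapDerivedCategory.obj X') := by
        have hiso : IsIso T'.mor₁ := (Triangle.isZero₃_iff_isIso₁ _ hT').1 hz₃
        exact hz₂.of_iso (@asIso _ _ _ _ T'.mor₁ hiso)
      refine P.ext_of_isTriangulatedClosed₂ _ hT (ih X' j' i' hz₁) ?_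
      obtain ⟨H, ⟨e⟩⟩ := exists_iso_singleFunctor_obj_of_isGE_of_isLE X'' (a + n)
      refine P.prop_of_iso e.symm (h _ H ?_)
      have hs : IsZero ((singleFunctor B (a + n)).obj (F.obj H)) :=
        hz₃.of_iso ((F.mapDerivedCategorySingleFunctor (a + n)).symm.app H ≪≫
          F.mapDerivedCategory.mapIso e.symm)
      rw [IsZero.iff_id_eq_zero]
      exact (singleFunctor B (a + n)).map_injective (hs.eq_of_src _ _)
  obtain ⟨⟨a, _⟩, ⟨b, _⟩⟩ := hX
  -- When `b < a` the length is `0` and the range is empty, so the base case covers it.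
  refine key a (b - a + 1).toNat X ‹_› ?_ hF
  exact t.isLE_of_le X b _ (by lia)

section
variable {T : A ⥤ A} [T.Additive] [PreservesFiniteLimits T] [PreservesFiniteColimits T]
  (σ : 𝟭 A ⟶ T)

/-- The morphism of complexes induced degreewise by a natural transformation `𝟭 A ⟶ T`. -/
def homOfIdTrans (K : CochainComplex A ℤ) : K ⟶ (T.mapHomologicalComplex _).obj K where
  f i := σ.app (K.X i)
  comm' i k _ := (σ.naturality (K.d i k)).symm

/-- The natural transformation on the derived category induced by a natural transformation from the
identity functor to an exact functor. -/
noncomputable def idTrans : 𝟭 (DerivedCategory A) ⟶ T.mapDerivedCategory :=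
  Localization.liftNatTrans Q (HomologicalComplex.quasiIso A (ComplexShape.up ℤ)) Q
    (T.mapHomologicalComplex _ ⋙ Q) _ _
    { app K := Q.map (homOfIdTrans σ K)
      naturality K L f := by
        refine (Q.map_comp _ _).symm.trans (Eq.trans ?_ (Q.map_comp _ _))
        congr 1
        ext i
        exact σ.naturality (f.f i) }

lemma idTrans_app_Q (K : CochainComplex A ℤ) :
    (idTrans σ).app (Q.obj K) =
      Q.map (homOfIdTrans σ K) ≫ T.mapDerivedCategoryFactors.inv.app K := by
  refine (Localization.liftNatTrans_app _ _ _ _ _ _ _ _).trans ?_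
  exact Category.id_comp _

lemma idTrans_app_single_eq_zero {H : A} (hH : σ.app H = 0) (n : ℤ) :
    (idTrans σ).app ((singleFunctor A n).obj H) = 0 := by
  have e := (singleFunctorIsoCompQ A n).app H
  have h : (idTrans σ).app (Q.obj ((HomologicalComplex.single A (ComplexShape.up ℤ) n).obj H)) = 0 := by
    rw [idTrans_app_Q]
    have : homOfIdTrans σ ((HomologicalComplex.single A (ComplexShape.up ℤ) n).obj H) = 0 := by
      apply HomologicalComplex.from_single_hom_ext
      exact σ.app_eq_zero_of_iso (HomologicalComplex.singleObjXSelf _ n H) hH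
    rw [this, Functor.map_zero, zero_comp]
  exact (idTrans σ).app_eq_zero_of_iso e h

/-- On a representing complex the transformation acts degreewise, so invertibility is inherited from
the abelian category. -/
lemma isIso_mapDerivedCategory_idTrans (F : A ⥤ B) [F.Additive] [PreservesFiniteLimits F]
    [PreservesFiniteColimits F] (h : ∀ M, IsIso (F.map (σ.app M))) (X : DerivedCategory A) :
    IsIso (F.mapDerivedCategory.map ((idTrans σ).app X)) := by
  let K := Q.objPreimage X
  let e : Q.obj K ≅ X := Q.objObjPreimageIso X
  suffices IsIso (F.mapDerivedCategory.map ((idTrans σ).app (Q.obj K))) by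
    have h1 : (idTrans σ).app X =
        e.inv ≫ (idTrans σ).app (Q.obj K) ≫ T.mapDerivedCategory.map e.hom := by
      have := (idTrans σ).naturality e.hom
      rw [← this]
      exact (e.inv_hom_id_assoc _).symm
    rw [h1, Functor.map_comp, Functor.map_comp]
    infer_instance
  rw [idTrans_app_Q, Functor.map_comp]
  have h1 : IsIso ((F.mapHomologicalComplex (ComplexShape.up ℤ)).map (homOfIdTrans σ K)) := by
    have (i : ℤ) : IsIso (((F.mapHomologicalComplex (ComplexShape.up ℤ)).map (homOfIdTrans σ K)).f i) :=
      h (K.X i)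
    exact HomologicalComplex.Hom.isIso_of_components _
  have h2 : IsIso (F.mapDerivedCategory.map (Q.map (homOfIdTrans σ K))) := by
    have := F.mapDerivedCategoryFactors_hom_naturality (homOfIdTrans σ K)
    have h3 : IsIso (F.mapDerivedCategory.map (Q.map (homOfIdTrans σ K)) ≫
      F.mapDerivedCategoryFactors.hom.app _) := by
        rw [this]
        infer_instance
    exact IsIso.of_isIso_comp_right _ (F.mapDerivedCategoryFactors.hom.app _)
  infer_instance

end

end DerivedCategory

end

/-! ### Lifting morphisms from an open subscheme by twisting -/

namespace AlgebraicGeometry.Scheme.Modules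
open DerivedCategory TStructure
variable {X Y : Scheme.{u}}

lemma isZero_restrict_iff' (j : X ⟶ Y) [IsOpenImmersion j] {N : Y.Modules} :
    IsZero (N.restrict j) ↔ ∀ O : Y.Opens, O ≤ j.opensRange → Subsingleton Γ(N, O) := by
  rw [isZero_iff_subsingleton]
  constructor
  · intro h W hW
    obtain ⟨U, rfl⟩ : ∃ U : X.Opens, j ''ᵁ U = W := ⟨j ⁻¹ᵁ W, by
      rw [Scheme.Hom.image_preimage_eq_opensRange_inf]
      exact inf_eq_right.2 hW⟩
    exact h U
  · exact fun h U => h _ (j.image_le_opensRange U)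

lemma isZero_cohRestrict_iff (j : X ⟶ Y) [IsOpenImmersion j] {N : Coh Y} :
    IsZero ((cohRestrict j).obj N) ↔ ∀ O : Y.Opens, O ≤ j.opensRange → Subsingleton Γ(N.obj, O) := by
  rw [← isZero_restrict_iff']
  constructor
  · exact fun h => (isCoherent X).ι.map_isZero h
  · intro h
    rw [IsZero.iff_id_eq_zero]
    exact (isCoherent X).ι.map_injective (h.eq_of_src _ _)

/-- The coherent sheaf `N` vanishes over the open subset `V`. -/
def VanishesOn (V : Y.Opens) (N : Coh Y) : Prop :=
  ∀ O : Y.Opens, O ≤ V → Subsingleton Γ(N.obj, O)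

lemma VanishesOn.iSup {ι : Type*} (V : ι → Y.Opens) {N : Coh Y} (h : ∀ i, VanishesOn (V i) N) :
    VanishesOn (⨆ i, V i) N := by
  refine fun O hO => ⟨fun a b => eq_of_forall_mem fun x hx => ?_⟩
  obtain ⟨i, hi⟩ := Opens.mem_iSup.1 (hO hx)
  exact ⟨O ⊓ V i, inf_le_left, ⟨hx, hi⟩, (h i _ inf_le_right).elim _ _⟩

lemma VanishesOn.mono {V V' : Y.Opens} (h : V' ≤ V) {N : Coh Y} (hN : VanishesOn V N) :
    VanishesOn V' N := fun O hO => hN O (hO.trans h)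

variable [IsLocallyNoetherian Y]

/-- All cohomology sheaves of a complex vanish over the open subset `V`. -/
def DerivedVanishesOn (V : Y.Opens) (F : DerivedCategory (Coh Y)) : Prop :=
  ∀ n : ℤ, VanishesOn V ((homologyFunctor (Coh Y) n).obj F)

lemma isZero_mapDerivedCategory_cohRestrict_iff [IsLocallyNoetherian X] (j : X ⟶ Y)
    [IsOpenImmersion j] (F : DerivedCategory (Coh Y)) :
    IsZero ((cohRestrict j).mapDerivedCategory.obj F) ↔ DerivedVanishesOn j.opensRange F := by
  rw [isZero_mapDerivedCategory_iff]
  exact forall_congr' fun n => isZero_cohRestrict_iff j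

/-- A property `P` of objects of the derived category has twists over `V'`, for sheaves vanishing
over `V`, if every such sheaf is annihilated by a natural transformation `σ : 𝟭 ⟶ T` to an exact
functor preserving `P` and vanishing loci, such that `σ` is an isomorphism over `V'`. -/
def HasTwists (P : ObjectProperty (DerivedCategory (Coh Y))) (V V' : Y.Opens) : Prop :=
  ∀ N : Coh Y, VanishesOn V N → ∃ (T : Coh Y ⥤ Coh Y) (_ : T.Additive)
    (_ : PreservesFiniteLimits T) (_ : PreservesFiniteColimits T) (σ : 𝟭 (Coh Y) ⟶ T),
    (∀ M, IsIso ((cohRestrict V'.ι).map (σ.app M))) ∧ σ.app N = 0 ∧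
    (∀ F, P F → P (T.mapDerivedCategory.obj F)) ∧
    ∀ (O : Y.Opens) (M : Coh Y), VanishesOn O M → VanishesOn O (T.obj M)

section
variable {P : ObjectProperty (DerivedCategory (Coh Y))} [P.IsClosedUnderIsomorphisms]
  [P.IsTriangulatedClosed₂] (hPs : ∀ F, P F → P (F⟦(-1 : ℤ)⟧)) (hP₀ : ∀ F, IsZero F → P F)
include hPs hP₀

/-- Induction over the open subsets `V' i`. The morphism `G ⟶ 0` kills everything; each application
of `exists_killing_extension` makes the morphism invertible over one more `V' i` while keeping `P`
and the vanishing of the composite. -/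
lemma exists_killing_single {V : Y.Opens} {ι : Type*} (s : Finset ι) (V' : ι → Y.Opens)
    (hT : ∀ i, HasTwists P V (V' i)) (n : ℤ) (N : Coh Y) (hN : VanishesOn V N)
    {G : DerivedCategory (Coh Y)} (hG : P G) (c : (singleFunctor (Coh Y) n).obj N ⟶ G) :
    ∃ (G' : DerivedCategory (Coh Y)) (f : G ⟶ G'), P G' ∧ c ≫ f = 0 ∧
      ∀ i ∈ s, IsIso ((cohRestrict (V' i).ι).mapDerivedCategory.map f) := by
  classical
  induction s using Finset.induction_on with
  | empty =>
    obtain ⟨Z, hZ⟩ := HasZeroObject.zero (C := DerivedCategory (Coh Y))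
    exact ⟨Z, 0, hP₀ Z hZ, comp_zero, by simp⟩
  | insert i s _ ih =>
    obtain ⟨G₁, s₁, hG₁, hc, hs₁⟩ := ih
    obtain ⟨T, _, _, _, σ, hσ, hσN, hTP, hTV⟩ := hT i N hN
    obtain ⟨Q, f, δ, hd, G₂, a, p, δ', hd', φ, h₁, h₃, hG₂, hcφ⟩ := exists_killing_extension (idTrans σ)
      (idTrans_app_single_eq_zero σ hσN n) c s₁ hc P hPs hTP hG hG₁
    refine ⟨G₂, φ.hom₂, hG₂, hcφ, fun k hk => ?_⟩
    let Φ := (cohRestrict (V' k).ι).mapDerivedCategory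
    suffices h : IsIso (Φ.map ((idTrans σ).app Q)) by
      refine Pretriangulated.isIso₂_of_isIso₁₃ (Φ.mapTriangle.map φ) (Φ.map_distinguished _ hd)
        (Φ.map_distinguished _ hd') ?_ ?_
      · change IsIso (Φ.map φ.hom₁)
        rw [h₁]
        exact h
      · change IsIso (Φ.map φ.hom₃)
        rw [h₃]
        exact inferInstanceAs (IsIso (Φ.map (𝟙 (show DerivedCategory (Coh Y) from G₁))))
    obtain rfl | hk := Finset.mem_insert.1 hk
    · exact isIso_mapDerivedCategory_idTrans σ _ hσ Q
    -- Over the open subsets already treated `s₁` is invertible, so its fibre `Q` vanishes there,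
    -- and so does the twist of `Q`.
    · have hz : IsZero (Φ.obj Q) := by
        have hiso : IsIso (Φ.map s₁) := hs₁ k hk
        exact (Triangle.isZero₁_iff_isIso₂ _ (Φ.map_distinguished _ hd)).2 hiso
      have hz' : IsZero (Φ.obj (T.mapDerivedCategory.obj Q)) := by
        rw [isZero_mapDerivedCategory_cohRestrict_iff] at hz ⊢
        intro m
        obtain ⟨e⟩ := nonempty_homology_mapDerivedCategory_iso T Q m
        intro O hO
        exact @Equiv.subsingleton _ _ ((sectionsFunctor O).mapIso
          ((isCoherent Y).ι.mapIso e)).addCommGroupIsoToAddEquiv.toEquiv (hTV _ _ (hz m) O hO)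
      exact ⟨0, hz.eq_of_src _ _, hz'.eq_of_src _ _⟩

variable [NoetherianSpace Y] [IsLocallyNoetherian X] (j : X ⟶ Y) [IsOpenImmersion j]
  (hT : ∀ x ∈ j.opensRange, ∃ V' : Y.Opens, x ∈ V' ∧ V' ≤ j.opensRange ∧ HasTwists P j.opensRange V')
include hT

/-- A morphism from a bounded complex that vanishes on an open subscheme to an object with the
property `P` becomes zero after composition with a morphism, to an object with the property `P`,
that is an isomorphism on this open subscheme. -/
theorem exists_killing {F G : DerivedCategory (Coh Y)} (hF : t.bounded F)
    (hF₀ : IsZero ((cohRestrict j).mapDerivedCategory.obj F)) (hG : P G) (c : F ⟶ G) :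
    ∃ (G' : DerivedCategory (Coh Y)) (f : G ⟶ G'), P G' ∧ c ≫ f = 0 ∧
      IsIso ((cohRestrict j).mapDerivedCategory.map f) := by
  let R : ObjectProperty (DerivedCategory (Coh Y)) := fun F =>
    ∀ ⦃G : DerivedCategory (Coh Y)⦄ (_ : P G) (c : F ⟶ G),
      ∃ (G' : DerivedCategory (Coh Y)) (f : G ⟶ G'), P G' ∧ c ≫ f = 0 ∧
        IsIso ((cohRestrict j).mapDerivedCategory.map f)
  have h1 : R.IsClosedUnderIsomorphisms := ⟨fun {F F'} e hF G hG c => by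
    obtain ⟨G', f, hG', h, h'⟩ := hF hG (e.hom ≫ c)
    refine ⟨G', f, hG', ?_, h'⟩
    rwa [Category.assoc, Preadditive.IsIso.comp_left_eq_zero] at h⟩
  -- First the restriction of `c` to `T.obj₁` is killed; what remains factors through `T.obj₃` and
  -- is killed next.
  have h2 : R.IsTriangulatedClosed₂ := .mk' fun T hT h₁ h₃ G hG c => by
    obtain ⟨G', f, hG', h, h'⟩ := h₁ hG (T.mor₁ ≫ c)
    obtain ⟨d, hd⟩ := T.yoneda_exact₂ hT (c ≫ f) (by rw [← Category.assoc, h])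
    obtain ⟨G'', f', hG'', k, k'⟩ := h₃ hG' d
    refine ⟨G'', f ≫ f', hG'', ?_, ?_⟩
    · rw [← Category.assoc, hd, Category.assoc, k, comp_zero]
    · rw [Functor.map_comp]
      infer_instance
  refine of_bounded_of_isZero (cohRestrict j) R ?_ ?_ F hF hF₀ hG c
  · intro Z hZ G hG c
    exact ⟨G, 𝟙 G, hG, hZ.eq_of_src _ _, by
      rw [CategoryTheory.Functor.map_id]; infer_instance⟩
  · intro n N hN G hG c
    rw [isZero_cohRestrict_iff] at hN
    choose V' hx hV' hT' using fun x : j.opensRange => hT x.1 x.2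
    obtain ⟨J, hJ⟩ := (NoetherianSpace.isCompact (j.opensRange : Set Y)).elim_finite_subcover
      (fun x => (V' x : Set Y)) (fun x => (V' x).isOpen)
      fun x hx' => Set.mem_iUnion.2 ⟨⟨x, hx'⟩, hx _⟩
    obtain ⟨G', f, hG', hcf, hiso⟩ := exists_killing_single hPs hP₀ J V' hT' n N hN hG c
    refine ⟨G', f, hG', hcf, ?_⟩
    -- Invertibility over the union of the `V' x` is tested on the cone, whose cohomology sheaves
    -- vanish over a union as soon as they vanish over its members.
    obtain ⟨Z, g, δ, hd⟩ := distinguished_cocone_triangle f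
    refine (Triangle.isZero₃_iff_isIso₁ _ ((cohRestrict j).mapDerivedCategory.map_distinguished _ hd)).1 ?_
    change IsZero ((cohRestrict j).mapDerivedCategory.obj Z)
    rw [isZero_mapDerivedCategory_cohRestrict_iff]
    intro m
    refine VanishesOn.mono (V := ⨆ x : J, V' x.1) ?_ (.iSup _ fun x => ?_)
    · intro x hx'
      obtain ⟨y, hy, hxy⟩ := Set.mem_iUnion₂.1 (hJ hx')
      exact Opens.mem_iSup.2 ⟨⟨y, hy⟩, hxy⟩
    · have hz : IsZero ((cohRestrict (V' x.1).ι).mapDerivedCategory.obj Z) :=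
        (Triangle.isZero₃_iff_isIso₁ _
          ((cohRestrict (V' x.1).ι).mapDerivedCategory.map_distinguished _ hd)).2 (hiso x.1 x.2)
      rw [isZero_mapDerivedCategory_cohRestrict_iff, Scheme.Opens.opensRange_ι] at hz
      exact hz m

/-- A morphism between the restrictions to an open subscheme of bounded complexes extends after
replacing the target by a complex with the same restriction, retaining the property `P`. -/
theorem exists_hom_extension_target [NoetherianSpace X] (hPb : P ≤ t.bounded)
    {F G : DerivedCategory (Coh Y)} (hF : t.bounded F) (hG : P G)
    (φ : (cohRestrict j).mapDerivedCategory.obj F ⟶ (cohRestrict j).mapDerivedCategory.obj G) :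
    ∃ (G' : DerivedCategory (Coh Y)) (f : G ⟶ G') (ψ : F ⟶ G'), P G' ∧
      IsIso ((cohRestrict j).mapDerivedCategory.map f) ∧
      (cohRestrict j).mapDerivedCategory.map ψ = φ ≫ (cohRestrict j).mapDerivedCategory.map f := by
  obtain ⟨N, a, b, hN, ha, hb⟩ := exists_roof_extension j hF (hPb _ hG) φ
  -- Once the morphism from the fibre `C` of `a` to `G` is killed in `G'`, the composite `b ≫ f`
  -- descends along `a` to a morphism from `F`.
  obtain ⟨C, i, δ, hd⟩ := distinguished_cocone_triangle₁ a
  have hC₀ : IsZero ((cohRestrict j).mapDerivedCategory.obj C) :=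
    (Triangle.isZero₁_iff_isIso₂ _ ((cohRestrict j).mapDerivedCategory.map_distinguished _ hd)).2 ha
  have hC : t.bounded C :=
    (t.bounded (C := DerivedCategory (Coh Y))).ext_of_isTriangulatedClosed₁ _ hd hN hF
  obtain ⟨G', f, hG', h, h'⟩ := exists_killing hPs hP₀ j hT hC hC₀ hG (i ≫ b)
  obtain ⟨ψ, h1⟩ : ∃ ψ : F ⟶ G', b ≫ f = a ≫ ψ :=
    Triangle.yoneda_exact₂ _ hd (b ≫ f) ((Category.assoc _ _ _).symm.trans h)
  refine ⟨G', f, ψ, hG', h', ?_⟩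
  rw [← cancel_epi ((cohRestrict j).mapDerivedCategory.map a), ← CategoryTheory.Functor.map_comp,
    ← h1, CategoryTheory.Functor.map_comp, hb, Category.assoc]

end

end AlgebraicGeometry.Scheme.Modules

/-! ### Sections of powers of a line bundle in local frames, and multiplication by them -/

namespace AlgebraicGeometry.Scheme.Modules
variable {X : Scheme.{u}} {M : X.Modules}

lemma tmul_smul_right {N : X.Modules} {W : X.Opens} (r : Γ(X, W)) (n : Γ(N, W)) (s : Γ(M, W)) :
    tmul n (r • s) = r • tmul n s :=
  (congrArg ((toTensor N M).app (op W)).hom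
    (TensorProduct.tmul_smul (R := Γ(X, W)) r n s)).trans
    (((toTensor N M).app (op W)).hom.map_smul r (n ⊗ₜ[Γ(X, W)] s))

lemma res_tmul {N : X.Modules} {U V : X.Opens} (h : U ≤ V) (n : Γ(N, V)) (s : Γ(M, V)) :
    res ((tensorFunctor M).obj N) h (tmul n s) = tmul (res N h n) (res M h s) :=
  map_tmul _ n s

lemma IsFrame.res {U V : X.Opens} {e : Γ(M, V)} (he : IsFrame e) (h : U ≤ V) :
    IsFrame (res M h e) := fun W hW => by
  have : M.presheaf.map (homOfLE hW).op (Modules.res M h e) = M.presheaf.map (homOfLE (hW.trans h)).op e :=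
    res_res hW h e
  rw [this]
  exact he W _

lemma IsFrame.exists_eq_smul {V : X.Opens} {e : Γ(M, V)} (he : IsFrame e) (m : Γ(M, V)) :
    ∃ u : Γ(X, V), m = u • e := by
  obtain ⟨u, hu⟩ := (he V le_rfl).2 m
  exact ⟨u, hu.symm.trans (congrArg (u • ·) (res_self e))⟩

lemma IsFrame.smul_left_injective {V : X.Opens} {e : Γ(M, V)} (he : IsFrame e) {u v : Γ(X, V)}
    (h : u • e = v • e) : u = v := by
  refine (he V le_rfl).1 ?_
  have h' : M.presheaf.map (homOfLE (le_refl V)).op e = e := res_self e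
  simpa only [h'] using h

/-- An operation `(x, e) ↦ x ⊗ e ⊗ ⋯ ⊗ e`, with `n` factors `e`, with values in a functor of
twisting by the `n`-th power of `M`. -/
structure PowStructure (M : X.Modules) (n : ℕ) (T : Coh X ⥤ Coh X) where
  /-- The operation `(x, e) ↦ x ⊗ e ⊗ ⋯ ⊗ e`. -/
  pw {N : Coh X} {O : X.Opens} (x : Γ(N.obj, O)) (e : Γ(M, O)) : Γ((T.obj N).obj, O)
  pw_add {N : Coh X} {O : X.Opens} (x y : Γ(N.obj, O)) (e : Γ(M, O)) :
    pw (x + y) e = pw x e + pw y e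
  pw_smul {N : Coh X} {O : X.Opens} (r : Γ(X, O)) (x : Γ(N.obj, O)) (e : Γ(M, O)) :
    pw (r • x) e = r • pw x e
  pw_smul_right {N : Coh X} {O : X.Opens} (r : Γ(X, O)) (x : Γ(N.obj, O)) (e : Γ(M, O)) :
    pw x (r • e) = r ^ n • pw x e
  res_pw {N : Coh X} {O O' : X.Opens} (h : O' ≤ O) (x : Γ(N.obj, O)) (e : Γ(M, O)) :
    res (T.obj N).obj h (pw x e) = pw (res N.obj h x) (res M h e)
  app_pw {N N' : Coh X} (φ : N ⟶ N') {O : X.Opens} (x : Γ(N.obj, O)) (e : Γ(M, O)) :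
    (T.map φ).hom.app O (pw x e) = pw (φ.hom.app O x) e
  bijective {N : Coh X} {O : X.Opens} {e : Γ(M, O)} (he : IsFrame e) :
    Function.Bijective fun x : Γ(N.obj, O) => pw x e

/-- The identity functor is the twist by the power with exponent zero. -/
def PowStructure.zero (M : X.Modules) : PowStructure M 0 (𝟭 (Coh X)) where
  pw x _ := x
  pw_add _ _ _ := rfl
  pw_smul _ _ _ := rfl
  pw_smul_right r x e := by rw [pow_zero, one_smul]
  res_pw _ _ _ := rfl
  app_pw _ _ _ _ := rfl
  bijective _ := Function.bijective_id

/-- The twist by the power with exponent `n + 1`. -/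
noncomputable def PowStructure.succ (hM : IsInvertible M) {n : ℕ} {T : Coh X ⥤ Coh X}
    (p : PowStructure M n T) : PowStructure M (n + 1) (T ⋙ cohTensor hM) where
  pw x e := tmul (p.pw x e) e
  pw_add x y e := (congrArg (tmul · e) (p.pw_add x y e)).trans (tmul_add_left _ _ _)
  pw_smul r x e := (congrArg (tmul · e) (p.pw_smul r x e)).trans (tmul_smul_left _ _ _)
  pw_smul_right r x e := by
    refine (congrArg (tmul · (r • e)) (p.pw_smul_right r x e)).trans ?_
    refine (tmul_smul_left _ _ _).trans ((congrArg (r ^ n • ·) (tmul_smul_right _ _ _)).trans ?_)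
    rw [smul_smul, pow_succ]
    rfl
  res_pw h x e := (res_tmul h _ _).trans (congrArg (tmul · _) (p.res_pw h x e))
  app_pw φ O x e := (app_tmul (T.map φ).hom _ _).trans (congrArg (tmul · _) (p.app_pw φ x e))
  bijective {N O e} he := by
    have h := (bijective_tmul (N := (T.obj N).obj) he le_rfl).comp (p.bijective (N := N) he)
    have h' : M.presheaf.map (homOfLE (le_refl O)).op e = e := res_self e
    rw [h'] at h
    exact h

/-- A cover by open subsets with frames of `M`. -/
structure FrameCover (M : X.Modules) (ι : Type*) where
  /-- The open subsets. -/
  V : ι → X.Opens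
  /-- The frames. -/
  e (i : ι) : Γ(M, V i)
  isFrame (i : ι) : IsFrame (e i)
  exists_mem (x : X) : ∃ i, x ∈ V i

namespace FrameCover
variable {ι : Type*} (c : FrameCover M ι)

/-- The functions `a i` are the local expressions of a section of the `n`-th power of `M`. -/
def IsSection (n : ℕ) (a : ∀ i, Γ(X, c.V i)) : Prop :=
  ∀ (i j : ι) (O : X.Opens) (hi : O ≤ c.V i) (hj : O ≤ c.V j) (u : Γ(X, O)),
    res M hi (c.e i) = u • res M hj (c.e j) → resO hj (a j) = u ^ n * resO hi (a i)

variable {c} {n m : ℕ} {a b : ∀ i, Γ(X, c.V i)}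

lemma IsSection.pow (ha : c.IsSection n a) (m : ℕ) : c.IsSection (n * m) (fun i => a i ^ m) := by
  intro i j O hi hj u hu
  rw [map_pow, map_pow, ha i j O hi hj u hu, mul_pow, pow_mul]

lemma IsSection.mul (ha : c.IsSection n a) (hb : c.IsSection m b) :
    c.IsSection (n + m) (fun i => a i * b i) := by
  intro i j O hi hj u hu
  rw [map_mul, map_mul, ha i j O hi hj u hu, hb i j O hi hj u hu, pow_add, mul_mul_mul_comm]

section
variable {T : Coh X ⥤ Coh X} (p : PowStructure M n T)

/-- Independence of the frame: if the `i`-th frame is `u` times the `j`-th, the power operation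
acquires `u ^ n`, which is exactly the ratio of `a j` to `a i`. -/
lemma smul_pw_eq (ha : c.IsSection n a) {N : Coh X} {O : X.Opens} (x : Γ(N.obj, O)) (i j : ι)
    (hi : O ≤ c.V i) (hj : O ≤ c.V j) :
    resO hi (a i) • p.pw x (res M hi (c.e i)) = resO hj (a j) • p.pw x (res M hj (c.e j)) := by
  obtain ⟨u, hu⟩ := ((c.isFrame j).res hj).exists_eq_smul (res M hi (c.e i))
  rw [hu, p.pw_smul_right, ha i j O hi hj u hu, smul_smul, mul_comm]

lemma exists_glue_smul_pw (ha : c.IsSection n a) {N : Coh X} {O : X.Opens} (x : Γ(N.obj, O)) :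
    ∃ y : Γ((T.obj N).obj, O), ∀ (i : ι) (O' : X.Opens) (hO : O' ≤ O) (hi : O' ≤ c.V i),
      res _ hO y = resO hi (a i) • p.pw (res _ hO x) (res M hi (c.e i)) := by
  obtain ⟨y, hy⟩ := exists_glue (M := (T.obj N).obj) (W := O) (fun i => O ⊓ c.V i) (fun i => inf_le_left)
    (fun x hx => by obtain ⟨i, hi⟩ := c.exists_mem x; exact ⟨i, hx, hi⟩)
    (fun i => resO inf_le_right (a i) • p.pw (res _ inf_le_left x) (res M inf_le_right (c.e i)))
    (fun i j => by
      rw [res_smul, res_smul, p.res_pw, p.res_pw, resO_resO, resO_resO, res_res, res_res, res_res,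
        res_res]
      exact smul_pw_eq p ha _ _ _ _ _)
  refine ⟨y, fun i O' hO hi => ?_⟩
  rw [← res_res (le_inf hO hi) inf_le_left, hy i, res_smul, p.res_pw, resO_resO, res_res, res_res]

/-- The section of the twist of `N` given by a section `x` of `N` and a section of the power of
`M`. -/
noncomputable def twist (ha : c.IsSection n a) {N : Coh X} {O : X.Opens} (x : Γ(N.obj, O)) :
    Γ((T.obj N).obj, O) := (exists_glue_smul_pw p ha x).choose

lemma res_twist (ha : c.IsSection n a) {N : Coh X} {O : X.Opens} (x : Γ(N.obj, O)) (i : ι)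
    {O' : X.Opens} (hO : O' ≤ O) (hi : O' ≤ c.V i) :
    res _ hO (twist p ha x) = resO hi (a i) • p.pw (res _ hO x) (res M hi (c.e i)) :=
  (exists_glue_smul_pw p ha x).choose_spec i O' hO hi

lemma twist_of_le (ha : c.IsSection n a) {N : Coh X} {O : X.Opens} (x : Γ(N.obj, O)) (i : ι)
    (hi : O ≤ c.V i) :
    twist p ha x = resO hi (a i) • p.pw x (res M hi (c.e i)) := by
  have := res_twist p ha x i le_rfl hi
  rwa [res_self, res_self] at this

lemma eq_of_forall_res (c : FrameCover M ι) {N : X.Modules} {O : X.Opens} {x y : Γ(N, O)}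
    (h : ∀ i (O' : X.Opens) (hO : O' ≤ O) (_ : O' ≤ c.V i), res N hO x = res N hO y) : x = y := by
  refine eq_of_forall_mem fun z hz => ?_
  obtain ⟨i, hi⟩ := c.exists_mem z
  exact ⟨O ⊓ c.V i, inf_le_left, ⟨hz, hi⟩, h i _ _ inf_le_right⟩

lemma twist_res (ha : c.IsSection n a) {N : Coh X} {O O' : X.Opens} (h : O' ≤ O) (x : Γ(N.obj, O)) :
    twist p ha (res _ h x) = res _ h (twist p ha x) := by
  refine c.eq_of_forall_res fun i O'' hO hi => ?_
  rw [res_twist p ha _ i hO hi, res_res, res_res, res_twist p ha _ i (hO.trans h) hi]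

lemma twist_add (ha : c.IsSection n a) {N : Coh X} {O : X.Opens} (x y : Γ(N.obj, O)) :
    twist p ha (x + y) = twist p ha x + twist p ha y := by
  refine c.eq_of_forall_res fun i O' hO hi => ?_
  rw [map_add, res_twist p ha _ i hO hi, res_twist p ha _ i hO hi, res_twist p ha _ i hO hi, map_add,
    p.pw_add, smul_add]

lemma twist_smul (ha : c.IsSection n a) {N : Coh X} {O : X.Opens} (r : Γ(X, O)) (x : Γ(N.obj, O)) :
    twist p ha (r • x) = r • twist p ha x := by
  refine c.eq_of_forall_res fun i O' hO hi => ?_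
  rw [res_smul, res_twist p ha _ i hO hi, res_twist p ha _ i hO hi, res_smul, p.pw_smul, smul_comm]

lemma app_twist (ha : c.IsSection n a) {N N' : Coh X} (φ : N ⟶ N') {O : X.Opens} (x : Γ(N.obj, O)) :
    (T.map φ).hom.app O (twist p ha x) = twist p ha (φ.hom.app O x) := by
  refine c.eq_of_forall_res fun i O' hO hi => ?_
  rw [← app_res, res_twist p ha _ i hO hi, res_twist p ha _ i hO hi, Hom.app_smul, p.app_pw, app_res]

/-- Multiplication by a section of a power of `M`. -/
noncomputable def twistTrans (ha : c.IsSection n a) : 𝟭 (Coh X) ⟶ T where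
  app N := ObjectProperty.homMk (homMk
    { app U := AddCommGrpCat.ofHom (AddMonoidHom.mk' (fun x : Γ(N.obj, U.unop) => twist p ha x)
        (twist_add p ha))
      naturality U V f := by
        ext x
        exact twist_res p ha f.unop.le x }
    fun U r x => twist_smul p ha r x)
  naturality N N' φ := by
    apply (isCoherent X).ι.map_injective
    apply hom_ext
    intro U
    ext x
    exact (app_twist p ha φ x).symm

end

end FrameCover

end AlgebraicGeometry.Scheme.Modules

namespace AlgebraicGeometry.Scheme.Modules
variable {X : Scheme.{u}} {M : X.Modules}

lemma isUnit_resO {O O' : X.Opens} (f : Γ(X, O)) (h : O' ≤ O) (h' : O' ≤ X.basicOpen f) :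
    IsUnit (resO h f) := by
  have h1 : IsUnit (resO (X.basicOpen_le f) f) :=
    RingedSpace.isUnit_res_basicOpen X.toLocallyRingedSpace.toRingedSpace f
  have := h1.map (resO h')
  rwa [resO_resO] at this

lemma bijective_app_of_forall_le {N N' : X.Modules} (φ : N ⟶ N') {ι : Type*} (V : ι → X.Opens)
    (h : ∀ i, ∀ O ≤ V i, Function.Bijective (φ.app O)) (O : X.Opens) (hO : O ≤ ⨆ i, V i) :
    Function.Bijective (φ.app O) := by
  have hinj : ∀ O ≤ ⨆ i, V i, Function.Injective (φ.app O) := by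
    intro O hO a b hab
    refine eq_of_forall_mem fun x hx => ?_
    obtain ⟨i, hi⟩ := Opens.mem_iSup.1 (hO hx)
    refine ⟨O ⊓ V i, inf_le_left, ⟨hx, hi⟩, (h i _ inf_le_right).1 ?_⟩
    rw [app_res, hab, app_res]
  refine ⟨hinj O hO, fun y => ?_⟩
  choose s hs using fun i => (h i (O ⊓ V i) inf_le_right).2 (res N' inf_le_left y)
  obtain ⟨t, ht⟩ := exists_glue (W := O) (fun i => O ⊓ V i) (fun i => inf_le_left)
    (fun x hx => by obtain ⟨i, hi⟩ := Opens.mem_iSup.1 (hO hx); exact ⟨i, hx, hi⟩) s (fun i j => by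
      refine hinj _ ((inf_le_left.trans inf_le_left).trans hO) ?_
      rw [app_res, app_res, hs, hs, res_res, res_res])
  refine ⟨t, eq_of_forall_mem fun x hx => ?_⟩
  obtain ⟨i, hi⟩ := Opens.mem_iSup.1 (hO hx)
  exact ⟨O ⊓ V i, inf_le_left, ⟨hx, hi⟩, by rw [← app_res, ht, hs]⟩

/-- The adjunction between `tilde` and global sections: no condition on the target `N'` is needed.
-/
lemma IsTildeFinite.hom_eq_zero {R : CommRingCat.{u}} {N N' : (Spec R).Modules}
    (hN : IsTildeFinite N) (φ : N ⟶ N') (h : ∀ x, φ.app ⊤ x = 0) : φ = 0 := by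
  obtain ⟨A, -, ⟨e⟩⟩ := hN
  let e' : N ≅ (tilde.functor R).obj A := e
  rw [← cancel_epi e'.inv, comp_zero]
  apply (tilde.adjunction.homEquiv _ _).injective
  rw [Adjunction.homEquiv_unit, Adjunction.homEquiv_unit, Functor.map_comp]
  have : moduleSpecΓFunctor.map φ = 0 := by
    ext x
    exact h x
  have h0 : moduleSpecΓFunctor.map (0 : (tilde.functor R).obj A ⟶ N') = 0 := rfl
  rw [this, h0, comp_zero]

lemma app_eq_zero_of_chart {R : CommRingCat.{u}} (i : Spec R ⟶ X) [IsOpenImmersion i]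
    {N N' : X.Modules} (hN : IsTildeFinite (N.restrict i)) (φ : N ⟶ N')
    (h : ∀ x, φ.app (i ''ᵁ ⊤) x = 0) {O : X.Opens} (hO : O ≤ i ''ᵁ ⊤) (x : Γ(N, O)) :
    φ.app O x = 0 := by
  have h0 : (restrictFunctor i).map φ = 0 := hN.hom_eq_zero _ h
  have hO' : i ''ᵁ i ⁻¹ᵁ O = O := by
    rw [Scheme.Hom.image_preimage_eq_opensRange_inf, ← Scheme.Hom.image_top_eq_opensRange]
    exact inf_eq_right.2 hO
  have h1 : φ.app (i ''ᵁ i ⁻¹ᵁ O) (res N hO'.le x) = 0 :=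
    congr(($h0).app (i ⁻¹ᵁ O) (res N hO'.le x))
  have h2 := congrArg (res N' hO'.ge) h1
  rwa [← app_res, res_res, res_self, map_zero] at h2

/-- Each of finitely many generators restricts to zero over the nonvanishing locus of `f`, so a
power of `f` annihilates it; the largest exponent serves the whole module. -/
lemma exists_pow_smul_eq_zero_of_finite {R : CommRingCat.{u}} (i : Spec R ⟶ X) [IsOpenImmersion i]
    {N : X.Modules} (hN : isCoherent X N) (hi : IsTildeFinite (N.restrict i)) (f : Γ(X, i ''ᵁ ⊤))
    (h : Subsingleton Γ(N, X.basicOpen f)) : ∃ m : ℕ, ∀ x : Γ(N, i ''ᵁ ⊤), f ^ m • x = 0 := by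
  obtain ⟨s, hs⟩ := (hi.finite_sections (B := i ''ᵁ ⊤) rfl).fg_top
  have hc : IsCompact ((i ''ᵁ ⊤ : X.Opens) : Set X) := isCompact_univ.image i.continuous
  choose m hm using fun x : Γ(N, i ''ᵁ ⊤) => isTorsionBounded_of_isCoherent hN _ hc f x (h.elim _ _)
  refine ⟨s.sup m, fun x => ?_⟩
  have hx : x ∈ Submodule.span Γ(X, i ''ᵁ ⊤) (s : Set Γ(N, i ''ᵁ ⊤)) := hs ▸ trivial
  induction hx using Submodule.span_induction with
  | mem x hx =>
    obtain ⟨d, hd⟩ := Nat.exists_eq_add_of_le (Finset.le_sup (f := m) hx)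
    rw [hd, add_comm, pow_add, mul_smul, hm, smul_zero]
  | zero => exact smul_zero _
  | add x y _ _ h₁ h₂ => rw [smul_add, h₁, h₂, add_zero]
  | smul r x _ h => rw [smul_comm, h, smul_zero]

namespace FrameCover
variable {ι : Type*} {c : FrameCover M ι} {n : ℕ} {a : ∀ i, Γ(X, c.V i)}

/-- Where `a i` is invertible, the map is a unit times the bijection `x ↦ p.pw x e` for a frame `e`.
-/
lemma isIso_map_twistTrans {T : Coh X ⥤ Coh X} (p : PowStructure M n T) (ha : c.IsSection n a)
    {V : X.Opens} (hV : V ≤ ⨆ i, X.basicOpen (a i)) (N : Coh X) :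
    IsIso ((cohRestrict V.ι).map ((twistTrans p ha).app N)) := by
  have : IsIso ((isCoherent V).ι.map ((cohRestrict V.ι).map ((twistTrans p ha).app N))) := by
    refine isIso_restrict_map V.ι ((twistTrans p ha).app N).hom fun O hO => ?_
    rw [Scheme.Opens.opensRange_ι] at hO
    refine bijective_app_of_forall_le _ (fun i => X.basicOpen (a i)) (fun i O hO => ?_) O (hO.trans hV)
    have hi := hO.trans (X.basicOpen_le (a i))
    obtain ⟨r, hr⟩ := isUnit_resO (a i) hi hO
    have hb := p.bijective (N := N) ((c.isFrame i).res hi)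
    have : (fun x => twist p ha x) = fun x : Γ(N.obj, O) => r • p.pw x (res M hi (c.e i)) := by
      funext x
      rw [twist_of_le p ha x i hi, ← hr]
      rfl
    change Function.Bijective fun x : Γ(N.obj, O) => twist p ha x
    rw [this]
    exact (MulAction.bijective r).comp hb
  exact isIso_of_reflects_iso _ (isCoherent V).ι

/-- Since `N` vanishes where `a i` is invertible, a power of `a i` annihilates `N` on each chart of
a finite cover. The exponent does not depend on the functor `T`, which can therefore be chosen
afterwards. -/
lemma exists_twistTrans_app_eq_zero [CompactSpace X] (ha : c.IsSection n a) {V : X.Opens}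
    {N : Coh X} (hN : VanishesOn V N) (hV : ∀ i, X.basicOpen (a i) ≤ V) :
    ∃ m : ℕ, ∀ {T : Coh X ⥤ Coh X} (p : PowStructure M (n * m) T),
      (twistTrans p (ha.pow m)).app N = 0 := by
  choose i hi using c.exists_mem
  choose R f hf hxf hfV hfN using fun x : X => exists_chart_le N.property x (hi x)
  have key : ∀ x, ∃ m : ℕ, ∀ y : Γ(N.obj, f x ''ᵁ ⊤), resO (hfV x) (a (i x)) ^ m • y = 0 := by
    intro x
    refine exists_pow_smul_eq_zero_of_finite (f x) N.property (hfN x) _ (hN _ ?_)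
    exact (X.basicOpen_res _ _).trans_le (inf_le_right.trans (hV _))
  choose m hm using key
  obtain ⟨J, hJ⟩ := isCompact_univ.elim_finite_subcover
    (fun x : X => ((f x ''ᵁ ⊤ : X.Opens) : Set X)) (fun x => (f x ''ᵁ ⊤).isOpen)
    fun x _ => Set.mem_iUnion.2 ⟨x, hxf x⟩
  refine ⟨J.sup m, fun {T} p => ?_⟩
  apply (isCoherent X).ι.map_injective
  apply hom_ext
  intro O
  ext y
  refine eq_of_forall_mem fun z hz => ?_
  obtain ⟨x, hxJ, hx⟩ := Set.mem_iUnion₂.1 (hJ (trivial : z ∈ Set.univ))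
  refine ⟨O ⊓ f x ''ᵁ ⊤, inf_le_left, ⟨hz, hx⟩, ?_⟩
  refine (app_res ((twistTrans p (ha.pow (J.sup m))).app N).hom _ y).symm.trans ?_
  refine (app_eq_zero_of_chart (f x) (hfN x) _ (fun y => ?_) inf_le_right _).trans (map_zero _).symm
  obtain ⟨d, hd⟩ := Nat.exists_eq_add_of_le (Finset.le_sup (f := m) hxJ)
  refine (twist_of_le p (ha.pow (J.sup m)) y (i x) (hfV x)).trans ?_
  have hy : resO (hfV x) (a (i x)) ^ J.sup m • y = 0 := by
    rw [hd, add_comm, pow_add, mul_smul, hm, smul_zero]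
  rw [map_pow, ← p.pw_smul, hy]
  have := p.pw_smul 0 (0 : Γ(N.obj, f x ''ᵁ ⊤)) (res M (hfV x) (c.e (i x)))
  rwa [zero_smul, zero_smul] at this

end FrameCover

lemma vanishesOn_cohTensor (hM : IsInvertible M) {O : X.Opens} {N : Coh X} (hN : VanishesOn O N) :
    VanishesOn O ((cohTensor hM).obj N) :=
  isZero_restrict_iff.1 (hM.subsingleton_tensor (isZero_restrict_iff.2 hN))

section
variable [IsLocallyNoetherian X]

/-- An isomorphism for each object, natural or not, suffices to test membership in classes closed
under isomorphisms. -/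
lemma nonempty_mapDerivedCategory_comp_iso {A B C : Type*} [Category* A] [Category* B] [Category* C]
    [Abelian A] [Abelian B] [Abelian C] [HasDerivedCategory A] [HasDerivedCategory B]
    [HasDerivedCategory C] (F : A ⥤ B) (G : B ⥤ C) (H : A ⥤ C) (e : H ≅ F ⋙ G) [F.Additive] [G.Additive]
    [H.Additive] [PreservesFiniteLimits F] [PreservesFiniteColimits F] [PreservesFiniteLimits G]
    [PreservesFiniteColimits G] [PreservesFiniteLimits H] [PreservesFiniteColimits H]
    (X : DerivedCategory A) :
    Nonempty (H.mapDerivedCategory.obj X ≅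
      G.mapDerivedCategory.obj (F.mapDerivedCategory.obj X)) := by
  let K := DerivedCategory.Q.objPreimage X
  let i : DerivedCategory.Q.obj K ≅ X := DerivedCategory.Q.objObjPreimageIso X
  refine ⟨H.mapDerivedCategory.mapIso i.symm ≪≫ H.mapDerivedCategoryFactors.app K ≪≫
    DerivedCategory.Q.mapIso ?_ ≪≫ (G.mapDerivedCategoryFactors.app _).symm ≪≫
    G.mapDerivedCategory.mapIso ((F.mapDerivedCategoryFactors.app K).symm ≪≫
      F.mapDerivedCategory.mapIso i)⟩
  exact HomologicalComplex.Hom.isoOfComponents (fun n => e.app (K.X n))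
    (fun n m _ => (e.hom.naturality (K.d n m)).symm)

lemma nonempty_mapDerivedCategory_id_iso {A : Type*} [Category* A] [Abelian A]
    [HasDerivedCategory A] (X : DerivedCategory A) :
    Nonempty ((𝟭 A).mapDerivedCategory.obj X ≅ X) := by
  let K := DerivedCategory.Q.objPreimage X
  let i : DerivedCategory.Q.obj K ≅ X := DerivedCategory.Q.objObjPreimageIso X
  refine ⟨(𝟭 A).mapDerivedCategory.mapIso i.symm ≪≫ (𝟭 A).mapDerivedCategoryFactors.app K ≪≫
    DerivedCategory.Q.mapIso ?_ ≪≫ i⟩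
  exact HomologicalComplex.Hom.isoOfComponents (fun n => Iso.refl _) (fun n m _ => by
    refine (Category.id_comp _).trans (Category.comp_id _).symm)

/-- Twisting by the powers of a line bundle, as exact functors on coherent sheaves. -/
lemma exists_powStructure (hM : IsInvertible M) (P : ObjectProperty (DerivedCategory (Coh X)))
    [P.IsClosedUnderIsomorphisms] (hP : ∀ F, P F → P ((cohTensor hM).mapDerivedCategory.obj F))
    (n : ℕ) :
    ∃ (T : Coh X ⥤ Coh X) (_ : T.Additive) (_ : PreservesFiniteLimits T)
      (_ : PreservesFiniteColimits T) (_ : PowStructure M n T),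
      (∀ F, P F → P (T.mapDerivedCategory.obj F)) ∧
      ∀ (O : X.Opens) (N : Coh X), VanishesOn O N → VanishesOn O (T.obj N) := by
  induction n with
  | zero =>
    refine ⟨𝟭 _, inferInstance, inferInstance, inferInstance, .zero M, fun F hF => ?_,
      fun _ _ h => h⟩
    obtain ⟨e⟩ := nonempty_mapDerivedCategory_id_iso F
    exact P.prop_of_iso e.symm hF
  | succ n ih =>
    obtain ⟨T, _, _, _, p, h₁, h₂⟩ := ih
    have i₁ : PreservesFiniteLimits (T ⋙ cohTensor hM) := comp_preservesFiniteLimits _ _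
    have i₂ : PreservesFiniteColimits (T ⋙ cohTensor hM) := comp_preservesFiniteColimits _ _
    refine ⟨T ⋙ cohTensor hM, inferInstance, i₁, i₂, p.succ hM, fun F hF => ?_,
      fun O N hN => vanishesOn_cohTensor hM (h₂ O N hN)⟩
    obtain ⟨e⟩ := nonempty_mapDerivedCategory_comp_iso T (cohTensor hM) _ (Iso.refl _) F
    exact P.prop_of_iso e.symm (hP _ (h₁ F hF))

/-- A section of a power of a line bundle `M` provides twists over its nonvanishing locus. -/
theorem FrameCover.IsSection.hasTwists [CompactSpace X] (hM : IsInvertible M)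
    (P : ObjectProperty (DerivedCategory (Coh X)))
    [P.IsClosedUnderIsomorphisms] (hP : ∀ F, P F → P ((cohTensor hM).mapDerivedCategory.obj F))
    {ι : Type*} {c : FrameCover M ι} {n : ℕ} {a : ∀ i, Γ(X, c.V i)} (ha : c.IsSection n a)
    {V : X.Opens} (hV : ∀ i, X.basicOpen (a i) ≤ V) :
    HasTwists P V (⨆ i, X.basicOpen (a i)) := by
  intro N hN
  obtain ⟨m, hm⟩ := exists_twistTrans_app_eq_zero ha hN hV
  obtain ⟨T, i₁, i₂, i₃, p, h₁, h₂⟩ := exists_powStructure hM P hP (n * m)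
  refine ⟨T, i₁, i₂, i₃, twistTrans p (ha.pow m), isIso_map_twistTrans p _ ?_, hm p, h₁, h₂⟩
  -- Passing from `a i` to its power with exponent `m` does not shrink the nonvanishing locus.
  refine iSup_mono fun i x hx => ?_
  have hx' := X.basicOpen_le _ hx
  rw [Scheme.mem_basicOpen _ _ _ hx'] at hx ⊢
  rw [map_pow]
  exact hx.pow m

end

end AlgebraicGeometry.Scheme.Modules

/-! ### Pullback of frames and of sections in local frames -/

namespace AlgebraicGeometry.Scheme.Modules

section
variable {X : Scheme.{u}} {M : X.Modules}

/-- A morphism of sheaves of modules given on sections. -/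
noncomputable def homOfSections {M N : X.Modules} (f : ∀ O : X.Opens, Γ(M, O) → Γ(N, O))
    (hadd : ∀ O m m', f O (m + m') = f O m + f O m')
    (hsmul : ∀ O (r : Γ(X, O)) m, f O (r • m) = r • f O m)
    (hres : ∀ (O O' : X.Opens) (h : O' ≤ O) m, f O' (res M h m) = res N h (f O m)) : M ⟶ N :=
  homMk
    { app O := AddCommGrpCat.ofHom (AddMonoidHom.mk' (fun m : Γ(M, O.unop) => f O.unop m) (hadd _))
      naturality O O' g := by
        ext m
        exact hres _ _ g.unop.le m }
    (fun O r m => hsmul O r m)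

lemma isFrame_of_bijective {V : X.Opens} {e : Γ(M, V)} (h : ∀ (W : X.Opens) (h : W ≤ V),
    Function.Bijective fun r : Γ(X, W) => r • res M h e) : IsFrame e := h

lemma IsFrame.bijective {V : X.Opens} {e : Γ(M, V)} (he : IsFrame e) {W : X.Opens} (h : W ≤ V) :
    Function.Bijective fun r : Γ(X, W) => r • Modules.res M h e := he W h

lemma IsFrame.tmul {N : X.Modules} {V : X.Opens} {f : Γ(N, V)} {e : Γ(M, V)} (hf : IsFrame f)
    (he : IsFrame e) : IsFrame (tmul f e) := isFrame_of_bijective fun W h => by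
  have := (bijective_tmul (N := N) (he.res h) le_rfl).comp (hf.bijective h)
  convert this using 2 with r
  rw [res_tmul, ← tmul_smul_left]
  exact (congrArg (Modules.tmul _) (res_self _).symm)

/-- The multiples `r • s` of a section `s` of `M`. -/
noncomputable def smulHom {V : X.Opens} (s : Γ(M, V)) : structureModule V ⟶ M.restrict V.ι :=
  homOfSections (fun U r => (show Γ(M, V.ι ''ᵁ U) from
      (show Γ(X, V.ι ''ᵁ U) from r) • res M (Scheme.Opens.ι_image_le V U) s))
    (fun U r r' => add_smul (R := Γ(X, V.ι ''ᵁ U)) (M := Γ(M, V.ι ''ᵁ U)) r r' _)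
    (fun U r r' => by
      have h : (V.ι.appIso U).inv r = (show Γ(X, V.ι ''ᵁ U) from r) := by
        rw [Scheme.Opens.ι_appIso]
        rfl
      exact (mul_smul (α := Γ(X, V.ι ''ᵁ U)) (β := Γ(M, V.ι ''ᵁ U)) r r' _).trans
        (congrArg (fun a : Γ(X, V.ι ''ᵁ U) => (show Γ(M, V.ι ''ᵁ U) from a • (show Γ(M, V.ι ''ᵁ U) from
          (show Γ(X, V.ι ''ᵁ U) from r') • res M (Scheme.Opens.ι_image_le V U) s))) h.symm))
    (fun U U' h r => by
      refine Eq.symm ((res_smul (M := M) (V.ι.image_mono h) (show Γ(X, V.ι ''ᵁ U) from r) _).trans ?_)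
      rw [res_res]
      rfl)

end

variable {W S : Scheme.{u}} (q : W ⟶ S)

/-- The pullback of sections. -/
noncomputable def pullSection {L : S.Modules} {V : S.Opens} :
    Γ(L, V) →+ Γ((pullback q).obj L, q ⁻¹ᵁ V) :=
  (((pullbackPushforwardAdjunction q).unit.app L).app V).hom

lemma pullSection_smul {L : S.Modules} {V : S.Opens} (r : Γ(S, V)) (m : Γ(L, V)) :
    pullSection q (r • m) = q.app V r • pullSection q m :=
  Hom.app_smul ((pullbackPushforwardAdjunction q).unit.app L) r m

lemma res_pullSection {L : S.Modules} {U V : S.Opens} (h : U ≤ V) (m : Γ(L, V)) :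
    res _ (q.preimage_mono h) (pullSection q m) = pullSection q (res L h m) :=
  (app_res ((pullbackPushforwardAdjunction q).unit.app L) h m).symm

lemma pullback_hom_ext {L : S.Modules} {N : W.Modules} {f g : (pullback q).obj L ⟶ N}
    (h : ∀ (V : S.Opens) (m : Γ(L, V)),
      f.app _ (pullSection q m) = g.app _ (pullSection q m)) : f = g := by
  apply ((pullbackPushforwardAdjunction q).homEquiv _ _).injective
  rw [Adjunction.homEquiv_unit, Adjunction.homEquiv_unit]
  apply hom_ext
  intro V
  ext m
  exact h V m

lemma exists_pullback_hom {L : S.Modules} {N : W.Modules} (l : L ⟶ (pushforward q).obj N) :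
    ∃ f : (pullback q).obj L ⟶ N, ∀ (V : S.Opens) (m : Γ(L, V)),
      f.app _ (pullSection q m) = l.app V m := by
  refine ⟨((pullbackPushforwardAdjunction q).homEquiv _ _).symm l, fun V m => ?_⟩
  have := ((pullbackPushforwardAdjunction q).homEquiv _ _).apply_symm_apply l
  rw [Adjunction.homEquiv_unit] at this
  exact congr(($this).app V m)

section
variable {L : S.Modules} {V : S.Opens} {e : Γ(L, V)} (he : IsFrame e)
include he

lemma IsFrame.exists_coord {O : S.Opens} (m : Γ(L, O)) : ∃ r : Γ(S, O ⊓ V),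
    Modules.res L inf_le_left m = r • Modules.res L inf_le_right e :=
  (he.res inf_le_right).exists_eq_smul _

/-- The coordinate of a section with respect to a frame. -/
noncomputable def IsFrame.coord {O : S.Opens} (m : Γ(L, O)) : Γ(S, O ⊓ V) := (he.exists_coord m).choose

lemma IsFrame.coord_spec {O : S.Opens} (m : Γ(L, O)) :
    Modules.res L inf_le_left m = he.coord m • Modules.res L inf_le_right e :=
  (he.exists_coord m).choose_spec

lemma IsFrame.coord_eq {O : S.Opens} {m : Γ(L, O)} {r : Γ(S, O ⊓ V)}
    (h : Modules.res L inf_le_left m = r • Modules.res L inf_le_right e) : he.coord m = r :=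
  (he.res inf_le_right).smul_left_injective ((he.coord_spec m).symm.trans h)

lemma IsFrame.coord_add {O : S.Opens} (m m' : Γ(L, O)) :
    he.coord (m + m') = he.coord m + he.coord m' :=
  he.coord_eq (by rw [map_add, add_smul, ← he.coord_spec, ← he.coord_spec])

lemma IsFrame.coord_smul {O : S.Opens} (r : Γ(S, O)) (m : Γ(L, O)) :
    he.coord (r • m) = resO inf_le_left r * he.coord m :=
  he.coord_eq (by rw [res_smul, mul_smul, ← he.coord_spec])

lemma IsFrame.coord_res {O O' : S.Opens} (h : O' ≤ O) (m : Γ(L, O)) :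
    he.coord (Modules.res L h m) = resO (inf_le_inf_right V h) (he.coord m) :=
  he.coord_eq (by
    rw [res_res, ← res_res (inf_le_inf_right V h) inf_le_left, he.coord_spec, res_smul, res_res])

lemma IsFrame.coord_self : he.coord e = 1 := he.coord_eq (one_smul _ _).symm

end

lemma image_preimage_ι_le (V O : S.Opens) :
    (q ⁻¹ᵁ V).ι ''ᵁ (q ⁻¹ᵁ V).ι ⁻¹ᵁ q ⁻¹ᵁ O ≤ q ⁻¹ᵁ (O ⊓ V) := by
  rw [Scheme.Hom.image_preimage_eq_opensRange_inf, Scheme.Opens.opensRange_ι]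
  exact fun x hx => ⟨hx.2, hx.1⟩

section
variable {L : S.Modules} {V : S.Opens} {e : Γ(L, V)} (he : IsFrame e)

/-- The pullback of the coordinate of a section with respect to a frame. -/
noncomputable def IsFrame.pullCoord {O : S.Opens} (m : Γ(L, O)) :
    Γ(W, (q ⁻¹ᵁ V).ι ''ᵁ (q ⁻¹ᵁ V).ι ⁻¹ᵁ q ⁻¹ᵁ O) :=
  resO (image_preimage_ι_le q V O) (q.app _ (he.coord m))

/-- The coordinates with respect to a frame, as a morphism of sheaves. -/
noncomputable def IsFrame.coordHom :
    L ⟶ (pushforward q).obj ((pushforward (q ⁻¹ᵁ V).ι).obj (structureModule (q ⁻¹ᵁ V))) :=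
  homOfSections (fun O m => he.pullCoord q m)
    (fun O m m' => by
      have : he.pullCoord q (m + m') = he.pullCoord q m + he.pullCoord q m' := by
        rw [pullCoord, he.coord_add, map_add, map_add]; rfl
      exact this)
    (fun O r m => by
      have : he.pullCoord q (r • m) = resO ((q ⁻¹ᵁ V).ι.image_preimage_le _) (q.app O r) * he.pullCoord q m := by
        rw [pullCoord, he.coord_smul, map_mul, map_mul, resO_app, resO_resO]; rfl
      exact this)
    (fun O O' h m => by
      have : he.pullCoord q (Modules.res L h m) =
          resO ((q ⁻¹ᵁ V).ι.image_mono ((q ⁻¹ᵁ V).ι.preimage_mono (q.preimage_mono h)))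
            (he.pullCoord q m) := by
        rw [pullCoord, he.coord_res, resO_app, resO_resO, pullCoord, resO_resO]
      exact this)

include he in
/-- The pullback of a frame is a frame. -/
theorem IsFrame.pullSection : IsFrame (pullSection q e) := by
  -- `ψ` is the coordinate map on the pullback. By adjunction it is given by the coordinate map on
  -- `L`, so sections of the pullback never have to be described.
  obtain ⟨ψ, hψ⟩ := exists_pullback_hom q (he.coordHom q)
  let P := (Modules.pullback q).obj L
  let ι := (q ⁻¹ᵁ V).ι
  let ε : Γ(P, q ⁻¹ᵁ V) := Modules.pullSection q e
  have hB (O : W.Opens) : ι ''ᵁ ι ⁻¹ᵁ O ≤ q ⁻¹ᵁ V := Scheme.Opens.ι_image_le _ _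
  have hB' (O : W.Opens) : ι ''ᵁ ι ⁻¹ᵁ O ≤ O := ι.image_preimage_le _
  -- Multiplying the coordinate by `ε` gives back the restriction of the section to `q ⁻¹ᵁ V`. It is
  -- enough to check this on pulled back sections.
  have key : ψ ≫ (pushforward ι).map (smulHom ε) = (restrictAdjunction ι).unit.app P := by
    refine pullback_hom_ext q fun O m => ?_
    have hOV : O ⊓ V ≤ O := inf_le_left
    have h1 : Modules.res P (hB' _) (Modules.pullSection q m) =
        he.pullCoord q m • Modules.res P (hB _) ε := by
      rw [← res_res (image_preimage_ι_le q V O) (q.preimage_mono hOV), res_pullSection q hOV,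
        he.coord_spec, pullSection_smul, res_smul, ← res_pullSection, res_res]
      rfl
    have h2 : ψ.app (q ⁻¹ᵁ O) (Modules.pullSection q m) = he.pullCoord q m := hψ O m
    refine Eq.trans ?_ h1.symm
    exact congrArg (fun a : Γ(W, ι ''ᵁ ι ⁻¹ᵁ q ⁻¹ᵁ O) => a • Modules.res P (hB (q ⁻¹ᵁ O)) ε) h2
  have key' (O : W.Opens) (m : Γ(P, O)) :
      (show Γ(W, ι ''ᵁ ι ⁻¹ᵁ O) from ψ.app O m) • Modules.res P (hB O) ε = Modules.res P (hB' O) m :=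
    congr(($key).app O m)
  have hι : ∀ {O : W.Opens}, O ≤ q ⁻¹ᵁ V → O ≤ ι ''ᵁ ι ⁻¹ᵁ O := fun {O} h => by
    rw [Scheme.Hom.image_preimage_eq_opensRange_inf, Scheme.Opens.opensRange_ι]
    exact le_inf h le_rfl
  refine isFrame_of_bijective fun O hO => ?_
  let c (m : Γ(P, O)) : Γ(W, O) := resO (hι hO) (show Γ(W, ι ''ᵁ ι ⁻¹ᵁ O) from ψ.app O m)
  have h1 (m : Γ(P, O)) : c m • Modules.res P hO ε = m := by
    have := congrArg (Modules.res P (hι hO)) (key' O m)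
    rwa [res_smul, res_res, res_res, res_self] at this
  have h2 (r : Γ(W, O)) (m : Γ(P, O)) : c (r • m) = r * c m := by
    have : (show Γ(W, ι ''ᵁ ι ⁻¹ᵁ O) from ψ.app O (r • m)) =
        resO (hB' O) r * (show Γ(W, ι ''ᵁ ι ⁻¹ᵁ O) from ψ.app O m) := Hom.app_smul ψ r m
    change resO (hι hO) (show Γ(W, ι ''ᵁ ι ⁻¹ᵁ O) from ψ.app O (r • m)) = _
    rw [this, map_mul, resO_resO, resO_self]
  -- `h1` gives surjectivity; linearity of `c` and the coordinate `1` of `ε` itself give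
  -- injectivity.
  have h3 : c (Modules.res P hO ε) = 1 := by
    have h4 : (show Γ(W, ι ''ᵁ ι ⁻¹ᵁ O) from ψ.app O (Modules.res P hO ε)) =
        resO (ι.image_mono (ι.preimage_mono hO)) (he.pullCoord q e) :=
      (app_res ψ hO ε).trans (congrArg (resO (ι.image_mono (ι.preimage_mono hO))) (hψ V e))
    change resO (hι hO) (show Γ(W, ι ''ᵁ ι ⁻¹ᵁ O) from ψ.app O (Modules.res P hO ε)) = _
    rw [h4, pullCoord, he.coord_self, map_one, map_one, map_one, map_one]
  refine ⟨fun r r' hr => ?_, fun m => ⟨c m, h1 m⟩⟩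
  have h4 (r : Γ(W, O)) : c (r • Modules.res P hO ε) = r :=
    (h2 _ _).trans ((congrArg (r * ·) h3).trans (mul_one r))
  exact (h4 r).symm.trans ((congrArg c hr).trans (h4 r'))

end

/-- The pullback of a cover by frames. -/
noncomputable def FrameCover.pull {L : S.Modules} {ι : Type*} (c : FrameCover L ι) :
    FrameCover ((Modules.pullback q).obj L) ι where
  V i := q ⁻¹ᵁ c.V i
  e i := pullSection q (c.e i)
  isFrame i := (c.isFrame i).pullSection q
  exists_mem x := c.exists_mem (q x)

/-- The pulled back transition functions relate the pulled back frames, and a transition function is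
determined by the frames. -/
lemma FrameCover.IsSection.pull {L : S.Modules} {ι : Type*} {c : FrameCover L ι} {n : ℕ}
    {a : ∀ i, Γ(S, c.V i)} (ha : c.IsSection n a) :
    (c.pull q).IsSection n (fun i => q.app (c.V i) (a i)) := by
  intro i j O hi hj u hu
  obtain ⟨v, hv⟩ := ((c.isFrame j).res inf_le_right).exists_eq_smul
    (res L (inf_le_left : c.V i ⊓ c.V j ≤ _) (c.e i))
  have hO : O ≤ q ⁻¹ᵁ (c.V i ⊓ c.V j) := fun x hx => ⟨hi hx, hj hx⟩
  have h := congrArg (fun m => res ((pullback q).obj L) hO (pullSection q m)) hv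
  simp only [pullSection_smul, res_smul, ← res_pullSection, res_res] at h
  have huv : u = resO hO (q.app _ v) :=
    (((c.pull q).isFrame j).res hj).smul_left_injective (hu.symm.trans h)
  have h' := congrArg (fun r => resO hO (q.app _ r)) (ha i j _ inf_le_left inf_le_right v hv)
  simp only [resO_app, resO_resO, map_mul, map_pow] at h'
  rw [huv]
  exact h'

end AlgebraicGeometry.Scheme.Modules

/-! ### Ample line bundles and bases of nonvanishing loci -/

namespace AlgebraicGeometry.Scheme.Modules
variable {S : Scheme.{u}} {L : S.Modules}

/-- The `n`-th power of a section of `L`. -/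
noncomputable def framePow {V : S.Opens} (e : Γ(L, V)) : ∀ n : ℕ, Γ(tensorPow L n, V)
  | 0 => ofSection 1
  | n + 1 => tmul (framePow e n) e

lemma res_framePow {U V : S.Opens} (h : U ≤ V) (e : Γ(L, V)) (n : ℕ) :
    res (tensorPow L n) h (framePow e n) = framePow (res L h e) n := by
  induction n with
  | zero => exact (map_ofSection (homOfLE h) 1).trans (congrArg ofSection (map_one (resO h)))
  | succ n ih => exact (res_tmul h _ _).trans (congrArg (tmul · _) ih)

lemma framePow_smul {V : S.Opens} (u : Γ(S, V)) (e : Γ(L, V)) (n : ℕ) :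
    framePow (u • e) n = u ^ n • framePow e n := by
  induction n with
  | zero => rw [pow_zero, one_smul]; rfl
  | succ n ih =>
    refine (congrArg (tmul · _) ih).trans ((tmul_smul_left _ _ _).trans
      ((congrArg (u ^ n • ·) (tmul_smul_right _ _ _)).trans ?_))
    rw [smul_smul, pow_succ]
    rfl

lemma IsFrame.framePow {V : S.Opens} {e : Γ(L, V)} (he : IsFrame e) (n : ℕ) :
    IsFrame (framePow e n) := by
  induction n with
  | zero =>
    refine isFrame_of_bijective fun W h => ?_
    have h1 : Modules.res (tensorPow L 0) h (Modules.framePow e 0) = ofSection 1 :=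
      (map_ofSection (homOfLE h) 1).trans (congrArg ofSection (map_one (resO h)))
    rw [h1]
    have h2 : (fun r : Γ(S, W) => r • (show Γ(tensorPow L 0, W) from ofSection 1)) =
        ofSection := by
      funext r
      exact (smul_ofSection r 1).trans (congrArg ofSection (mul_one r))
    exact (congrArg Function.Bijective h2).mpr ofSection_bijective
  | succ n ih => exact ih.tmul he

lemma IsFrame.smul_of_isUnit {M : S.Modules} {V : S.Opens} {e : Γ(M, V)} (he : IsFrame e)
    {u : Γ(S, V)} (hu : IsUnit u) : IsFrame (u • e) := isFrame_of_bijective fun W h => by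
  obtain ⟨v, hv⟩ := hu.map (resO h)
  have := (he.bijective h).comp (v.mulRight.bijective)
  convert this using 2 with r
  rw [res_smul, ← hv, smul_smul]
  rfl

lemma IsFrame.isUnit_of_smul {M : S.Modules} {V : S.Opens} {e : Γ(M, V)} (he : IsFrame e)
    {u : Γ(S, V)} (hu : IsFrame (u • e)) : IsUnit u := by
  obtain ⟨v, hv⟩ := hu.exists_eq_smul e
  refine IsUnit.of_mul_eq_one v (he.smul_left_injective ?_)
  rw [one_smul, mul_comm, mul_smul]
  exact hv.symm

lemma mem_nonvanishingLocus_iff {M : S.Modules} (s : Γ(M, ⊤)) (x : S) :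
    x ∈ nonvanishingLocus s ↔ ∃ V : S.Opens, x ∈ V ∧ IsFrame (res M (le_top (a := V)) s) := by
  refine (Opens.mem_sSup).trans ?_
  exact ⟨fun ⟨V, h, hx⟩ => ⟨V, hx, h⟩, fun ⟨V, hx, h⟩ => ⟨V, h, hx⟩⟩

/-- The multiple `a • e` of a frame is again a frame exactly over the open subsets on which `a` is a
unit. -/
lemma nonvanishingLocus_inf {M : S.Modules} (s : Γ(M, ⊤)) {V : S.Opens} {e : Γ(M, V)}
    (he : IsFrame e) {a : Γ(S, V)} (h : res M le_top s = a • e) :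
    nonvanishingLocus s ⊓ V = S.basicOpen a := by
  ext x
  refine Iff.trans (and_congr_left fun _ => mem_nonvanishingLocus_iff s x) ?_
  constructor
  · rintro ⟨⟨V', hx', hs⟩, hx⟩
    have hu : IsUnit (resO (inf_le_right : V' ⊓ V ≤ V) a) := by
      refine (he.res inf_le_right).isUnit_of_smul ?_
      rw [← res_smul, ← h, res_res]
      have := hs.res (inf_le_left : V' ⊓ V ≤ V')
      rwa [res_res] at this
    have h1 := (S.basicOpen_res a (homOfLE (inf_le_right : V' ⊓ V ≤ V)).op).symm.trans
      (S.basicOpen_of_isUnit hu)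
    exact (h1.ge ⟨hx', hx⟩ : x ∈ _ ⊓ _).2
  · intro hx
    refine ⟨⟨S.basicOpen a, hx, ?_⟩, S.basicOpen_le a hx⟩
    have := (he.res (S.basicOpen_le a)).smul_of_isUnit (isUnit_resO a (S.basicOpen_le a) le_rfl)
    rwa [← res_smul, ← h, res_res] at this

namespace FrameCover
variable {ι : Type*} (c : FrameCover L ι)

/-- The transition functions between the frames. -/
noncomputable def trans (i j : ι) : Γ(S, c.V i ⊓ c.V j) :=
  (((c.isFrame j).res inf_le_right).exists_eq_smul (res L inf_le_left (c.e i))).choose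

lemma trans_spec (i j : ι) :
    res L (inf_le_left : c.V i ⊓ c.V j ≤ c.V i) (c.e i) = c.trans i j • res L inf_le_right (c.e j) :=
  (((c.isFrame j).res inf_le_right).exists_eq_smul (res L inf_le_left (c.e i))).choose_spec

variable {c}

/-- The factor `u` between two frames over a smaller open subset is unique, hence is the restriction
of the transition function. -/
lemma isSection_of_trans {n : ℕ} {a : ∀ i, Γ(S, c.V i)}
    (h : ∀ i j, resO (inf_le_right : c.V i ⊓ c.V j ≤ c.V j) (a j) =
      c.trans i j ^ n * resO inf_le_left (a i)) : c.IsSection n a := by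
  intro i j O hi hj u hu
  have hO : O ≤ c.V i ⊓ c.V j := le_inf hi hj
  have h1 := congrArg (res L hO) (c.trans_spec i j)
  rw [res_smul, res_res, res_res, hu] at h1
  have h2 : u = resO hO (c.trans i j) := ((c.isFrame j).res hj).smul_left_injective h1
  have h3 := congrArg (resO hO) (h i j)
  rwa [map_mul, map_pow, resO_resO, resO_resO, ← h2] at h3

/-- The functions are the coordinates of `s` in the `n`-th powers of the frames; a factor `u`
between frames becomes `u ^ n` between their powers. -/
lemma exists_isSection {n : ℕ} (s : Γ(tensorPow L n, ⊤)) : ∃ a : ∀ i, Γ(S, c.V i),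
    c.IsSection n a ∧ ∀ i, nonvanishingLocus s ⊓ c.V i = S.basicOpen (a i) := by
  choose a ha using fun i => ((c.isFrame i).framePow n).exists_eq_smul (res _ le_top s)
  refine ⟨a, fun i j O hi hj u hu => ?_, fun i => nonvanishingLocus_inf s ((c.isFrame i).framePow n) (ha i)⟩
  have h1 := congrArg (res _ hi) (ha i)
  have h2 := congrArg (res _ hj) (ha j)
  rw [res_res, res_smul, res_framePow] at h1 h2
  rw [hu, framePow_smul, smul_smul, h2] at h1
  rw [mul_comm]
  exact (((c.isFrame j).res hj).framePow n).smul_left_injective h1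

section
variable [NoetherianSpace S] [Finite ι]

lemma _root_.AlgebraicGeometry.Scheme.isQuasiSeparated_of_noetherianSpace (O : Set S) :
    IsQuasiSeparated O := fun _ _ _ _ _ _ _ _ => NoetherianSpace.isCompact _

/-- A function on the nonvanishing locus of a section of a power of `L` has the same nonvanishing
locus as a section of a power of `L`. -/
theorem IsSection.exists_basicOpen_eq {n : ℕ} {a : ∀ i, Γ(S, c.V i)} (ha : c.IsSection n a)
    {Z : S.Opens} (hZ : ∀ i, Z ⊓ c.V i = S.basicOpen (a i)) (g : Γ(S, Z)) :
    ∃ (m : ℕ) (b : ∀ i, Γ(S, c.V i)), c.IsSection m b ∧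
      ∀ i, S.basicOpen (b i) = S.basicOpen g ⊓ c.V i := by
  have := Fintype.ofFinite ι
  have hZ' (i) : S.basicOpen (a i) ≤ Z := (hZ i).ge.trans inf_le_left
  have H (i) : ∃ (k : ℕ) (y : Γ(S, c.V i)), resO (S.basicOpen_le (a i)) y =
      resO (S.basicOpen_le (a i)) (a i) ^ k * resO (hZ' i) g :=
    exists_eq_pow_mul_of_isCompact_of_isQuasiSeparated S (c.V i) (NoetherianSpace.isCompact _)
      (isQuasiSeparated_of_noetherianSpace _) (a i) (resO (hZ' i) g)
  choose k y hy using H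
  let N := Finset.univ.sup k
  have hN (i) : k i ≤ N := Finset.le_sup (Finset.mem_univ i)
  -- `b i` extends to `c.V i` the function `a i ^ N * g`, with one exponent `N` for all `i`.
  let b (i : ι) : Γ(S, c.V i) := a i ^ (N - k i) * y i
  have hb (i) : resO (S.basicOpen_le (a i)) (b i) =
      resO (S.basicOpen_le (a i)) (a i) ^ N * resO (hZ' i) g := by
    rw [map_mul, map_pow, hy, ← mul_assoc, ← pow_add, Nat.sub_add_cancel (hN i)]
  -- The failure of the `b i` to be a section of the power `n * N`. It vanishes where `a j` is
  -- invertible, so a power of `a j` annihilates it.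
  let x (i j : ι) : Γ(S, c.V i ⊓ c.V j) :=
    resO inf_le_right (b j) - c.trans i j ^ (n * N) * resO inf_le_left (b i)
  have hx (i j) : ∃ l : ℕ, resO inf_le_right (a j) ^ l * x i j = 0 := by
    refine exists_of_res_zero_of_qcqs (NoetherianSpace.isCompact _)
      (isQuasiSeparated_of_noetherianSpace _) ?_
    let B := S.basicOpen (resO (inf_le_right : c.V i ⊓ c.V j ≤ c.V j) (a j))
    have hB : B = (c.V i ⊓ c.V j) ⊓ S.basicOpen (a j) := S.basicOpen_res _ _
    have hBj : B ≤ S.basicOpen (a j) := hB.le.trans inf_le_right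
    have hBV : B ≤ c.V i ⊓ c.V j := hB.le.trans inf_le_left
    have hBi : B ≤ S.basicOpen (a i) := by
      rw [← hZ i]
      exact le_inf (hBj.trans (hZ' j)) (hBV.trans inf_le_left)
    change resO hBV (x i j) = 0
    have h1 := congrArg (resO hBj) (hb j)
    have h2 := congrArg (resO hBi) (hb i)
    have h3 := congrArg (resO hBV) (ha i j _ inf_le_left inf_le_right _ (c.trans_spec i j))
    simp only [map_mul, map_pow, resO_resO] at h1 h2 h3
    simp only [x, map_sub, map_mul, map_pow, resO_resO]
    rw [h1, h2, h3, mul_pow, ← pow_mul, mul_assoc, sub_self]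
  choose l hl using hx
  let K := Finset.univ.sup fun p : ι × ι => l p.1 p.2
  have hK (i j) : l i j ≤ K := Finset.le_sup (f := fun p : ι × ι => l p.1 p.2) (Finset.mem_univ (i, j))
  have hK' (i j) : resO inf_le_right (a j) ^ K * x i j = 0 := by
    rw [← Nat.sub_add_cancel (hK i j), pow_add, mul_assoc, hl, mul_zero]
  have hsec : c.IsSection (n * (N + K)) (fun i => a i ^ K * b i) := by
    refine isSection_of_trans fun i j => ?_
    have h1 := hK' i j
    have h3 := ha i j _ inf_le_left inf_le_right _ (c.trans_spec i j)
    rw [mul_sub, sub_eq_zero] at h1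
    have h4 : resO (inf_le_left : c.V i ⊓ c.V j ≤ c.V i) (a i ^ K * b i) =
        resO inf_le_left (a i) ^ K * resO inf_le_left (b i) := by rw [map_mul, map_pow]
    rw [map_mul, map_pow, h1, h3, h4]
    ring
  -- The additional factor `a i` forces the nonvanishing locus into that of `a i`, outside which
  -- nothing is known about `b i`; with `K = 0` the factor `a i ^ K` would not do so.
  refine ⟨_, _, ha.mul hsec, fun i => ?_⟩
  have hu := isUnit_resO (a i) (S.basicOpen_le (a i)) le_rfl
  have h1 : S.basicOpen (a i * (a i ^ K * b i)) ≤ S.basicOpen (a i) := by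
    rw [S.basicOpen_mul]
    exact inf_le_left
  have h2 : S.basicOpen (resO (S.basicOpen_le (a i)) (a i * (a i ^ K * b i))) =
      S.basicOpen (a i) ⊓ S.basicOpen (a i * (a i ^ K * b i)) := S.basicOpen_res _ _
  have h3 : S.basicOpen (resO (hZ' i) g) = S.basicOpen (a i) ⊓ S.basicOpen g := S.basicOpen_res _ _
  rw [inf_eq_right.2 h1] at h2
  rw [← h2, map_mul, map_mul, map_pow, hb, S.basicOpen_mul, S.basicOpen_mul, S.basicOpen_mul,
    S.basicOpen_of_isUnit hu, S.basicOpen_of_isUnit (hu.pow _), S.basicOpen_of_isUnit (hu.pow _), h3,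
    ← hZ i]
  have := S.basicOpen_le g
  ext z
  simp only [Opens.coe_inf, Set.mem_inter_iff, SetLike.mem_coe]
  have : z ∈ S.basicOpen g → z ∈ Z := fun h => this h
  tauto

end

end FrameCover

lemma IsInvertible.exists_frameCover [CompactSpace S] (hL : IsInvertible L) :
    ∃ (ι : Type u) (_ : Finite ι), Nonempty (FrameCover L ι) := by
  choose V e hx he using hL.exists_isFrame
  obtain ⟨J, hJ⟩ := isCompact_univ.elim_finite_subcover (fun x => (V x : Set S)) (fun x => (V x).isOpen)
    fun x _ => Set.mem_iUnion.2 ⟨x, hx x⟩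
  refine ⟨J, inferInstance, ⟨⟨fun i => V i.1, fun i => e i.1, fun i => he i.1, fun x => ?_⟩⟩⟩
  obtain ⟨y, hy, hxy⟩ := Set.mem_iUnion₂.1 (hJ (trivial : x ∈ Set.univ))
  exact ⟨⟨y, hy⟩, hxy⟩

/-- The nonvanishing loci of the sections of the powers of an ample line bundle form a basis of the
topology. -/
theorem IsAmple.exists_isSection [NoetherianSpace S] (hL : IsAmple L) :
    ∃ (ι : Type u) (c : FrameCover L ι), ∀ (U : S.Opens) (x : S), x ∈ U →
      ∃ (n : ℕ) (a : ∀ i, Γ(S, c.V i)), c.IsSection n a ∧ (∀ i, S.basicOpen (a i) ≤ U) ∧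
        x ∈ ⨆ i, S.basicOpen (a i) := by
  obtain ⟨ι, _, ⟨c⟩⟩ := hL.isInvertible.exists_frameCover
  refine ⟨ι, c, fun U x hx => ?_⟩
  obtain ⟨n, s, -, hxs, hs⟩ := hL.exists_section x
  obtain ⟨a, ha, haZ⟩ := c.exists_isSection s
  -- The nonvanishing locus of `s` is affine, so loci of functions on it are fine enough to fit
  -- inside `U`.
  obtain ⟨g, hgU, hxg⟩ := hs.exists_basicOpen_le ⟨x, hx⟩ hxs
  obtain ⟨m, b, hb, hbg⟩ := ha.exists_basicOpen_eq haZ g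
  refine ⟨m, b, hb, fun i => (hbg i).le.trans (inf_le_left.trans hgU), ?_⟩
  obtain ⟨i, hi⟩ := c.exists_mem x
  exact Opens.mem_iSup.2 ⟨i, (hbg i).ge ⟨hxg, hi⟩⟩

/-- For an ample line bundle `L` on `S`, the pullback of `L` to a scheme `W` over `S` provides
twists over small neighbourhoods of the points of the preimage of an open subset of `S`. -/
theorem IsAmple.exists_hasTwists [NoetherianSpace S] (hL : IsAmple L) {W : Scheme.{u}}
    [CompactSpace W] [IsLocallyNoetherian W] (q : W ⟶ S) (P : ObjectProperty (DerivedCategory (Coh W)))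
    [P.IsClosedUnderIsomorphisms]
    (hP : ∀ F, P F → P ((cohTensor (hL.isInvertible.pullback q)).mapDerivedCategory.obj F))
    (U : S.Opens) (x : W) (hx : x ∈ q ⁻¹ᵁ U) :
    ∃ V' : W.Opens, x ∈ V' ∧ V' ≤ q ⁻¹ᵁ U ∧ HasTwists P (q ⁻¹ᵁ U) V' := by
  obtain ⟨ι, c, hc⟩ := hL.exists_isSection
  obtain ⟨n, a, ha, haU, hxa⟩ := hc U (q x) hx
  have h (i) : W.basicOpen (q.app (c.V i) (a i)) = q ⁻¹ᵁ S.basicOpen (a i) :=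
    (Scheme.preimage_basicOpen q (a i)).symm
  have hU (i) : W.basicOpen (q.app (c.V i) (a i)) ≤ q ⁻¹ᵁ U :=
    (h i).le.trans (q.preimage_mono (haU i))
  refine ⟨_, ?_, iSup_le hU, (ha.pull q).hasTwists (hL.isInvertible.pullback q) P hP hU⟩
  obtain ⟨i, hi⟩ := Opens.mem_iSup.1 hxa
  exact Opens.mem_iSup.2 ⟨i, (h i).ge hi⟩

end AlgebraicGeometry.Scheme.Modules

/-! ### The t-structure on an essential image -/

namespace CategoryTheory.Triangulated.TStructure
open Pretriangulated
variable {C D : Type*} [Category* C] [Preadditive C] [HasZeroObject C] [HasShift C ℤ]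
  [∀ n : ℤ, (shiftFunctor C n).Additive] [Pretriangulated C]
  [Category* D] [Preadditive D] [HasZeroObject D] [HasShift D ℤ]
  [∀ n : ℤ, (shiftFunctor D n).Additive] [Pretriangulated D]
  (t : TStructure C) (R : C ⥤ D) [R.CommShift ℤ] [R.IsTriangulated]

/-- The essential images of `D^{≤ n}` and `D^{≥ n}` under an essentially surjective triangulated
functor `R` form a t-structure, if the morphisms between objects in the image of `R` can be lifted
after replacing the target by an object with the same image. -/
noncomputable def ofEssImage (hR : ∀ X : D, ∃ F : C, Nonempty (X ≅ R.obj F))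
    (H : ∀ (F G : C) (_ : t.ge 1 G) (φ : R.obj F ⟶ R.obj G), ∃ (G' : C) (f : G ⟶ G') (ψ : F ⟶ G'),
      t.ge 1 G' ∧ IsIso (R.map f) ∧ R.map ψ = φ ≫ R.map f) : TStructure D where
  le n X := ∃ F : C, t.le n F ∧ Nonempty (X ≅ R.obj F)
  ge n X := ∃ F : C, t.ge n F ∧ Nonempty (X ≅ R.obj F)
  le_isClosedUnderIsomorphisms n := ⟨fun e ⟨F, hF, ⟨i⟩⟩ => ⟨F, hF, ⟨e.symm ≪≫ i⟩⟩⟩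
  ge_isClosedUnderIsomorphisms n := ⟨fun e ⟨F, hF, ⟨i⟩⟩ => ⟨F, hF, ⟨e.symm ≪≫ i⟩⟩⟩
  le_shift n a n' h X := fun ⟨F, hF, ⟨i⟩⟩ => ⟨F⟦a⟧, t.le_shift n a n' h F hF,
    ⟨(shiftFunctor D a).mapIso i ≪≫ ((R.commShiftIso a).app F).symm⟩⟩
  ge_shift n a n' h X := fun ⟨F, hF, ⟨i⟩⟩ => ⟨F⟦a⟧, t.ge_shift n a n' h F hF,
    ⟨(shiftFunctor D a).mapIso i ≪≫ ((R.commShiftIso a).app F).symm⟩⟩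
  zero' X Y φ := by
    rintro ⟨F, hF, ⟨i⟩⟩ ⟨G, hG, ⟨e⟩⟩
    -- The lift `ψ` goes from `D^{≤ 0}` to `D^{≥ 1}`, so it is zero, and `R.map f` is invertible.
    obtain ⟨G', f, ψ, hG', hf, h⟩ := H F G hG (i.inv ≫ φ ≫ e.hom)
    rw [t.zero' ψ hF hG', R.map_zero] at h
    have h' : (i.inv ≫ φ ≫ e.hom) ≫ R.map f = 0 := h.symm
    rwa [Preadditive.IsIso.comp_right_eq_zero, Preadditive.IsIso.comp_left_eq_zero,
      Preadditive.IsIso.comp_right_eq_zero] at h'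
  le_zero_le X := fun ⟨F, hF, i⟩ => ⟨F, t.le_zero_le F hF, i⟩
  ge_one_le X := fun ⟨F, hF, i⟩ => ⟨F, t.ge_one_le F hF, i⟩
  exists_triangle_zero_one X := by
    obtain ⟨F, ⟨i⟩⟩ := hR X
    obtain ⟨A, B, hA, hB, f, g, h, hT⟩ := t.exists_triangle_zero_one F
    refine ⟨R.obj A, R.obj B, ⟨A, hA, ⟨Iso.refl _⟩⟩, ⟨B, hB, ⟨Iso.refl _⟩⟩, R.map f ≫ i.inv,
      i.hom ≫ R.map g, R.map h ≫ (R.commShiftIso (1 : ℤ)).hom.app A, ?_⟩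
    exact isomorphic_distinguished _ (R.map_distinguished _ hT) _
      (Triangle.isoMk _ _ (Iso.refl _) i (Iso.refl _)
        ((Category.assoc _ _ _).trans ((congrArg (R.map f ≫ ·) i.inv_hom_id).trans
          ((Category.comp_id _).trans (Category.id_comp _).symm)))
        (Category.comp_id _)
        ((congrArg (_ ≫ ·) ((shiftFunctor D (1 : ℤ)).map_id _)).trans
          ((Category.comp_id _).trans (Category.id_comp _).symm)))

variable {t R}

/-- A lift in `D^{≥ a}` need not lie in `D^{≤ b}`, but its truncation `A` to degrees at most `b` has
the same image: the image of the other truncation lies both in degrees at most `b` and in degrees at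
least `b + 1`. For `a ≤ b`, truncating does not leave `D^{≥ a}`. -/
lemma exists_ge_le_of_ofEssImage
    (hR : ∀ X : D, ∃ F : C, Nonempty (X ≅ R.obj F))
    (H : ∀ (F G : C) (_ : t.ge 1 G) (φ : R.obj F ⟶ R.obj G), ∃ (G' : C) (f : G ⟶ G') (ψ : F ⟶ G'),
      t.ge 1 G' ∧ IsIso (R.map f) ∧ R.map ψ = φ ≫ R.map f) {a b : ℤ} {X : D}
    (ha : (t.ofEssImage R hR H).ge a X) (hb : (t.ofEssImage R hR H).le b X) :
    ∃ F : C, (t.ge a F ∧ t.le b F) ∧ Nonempty (X ≅ R.obj F) := by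
  let τ := t.ofEssImage R hR H
  have ia : τ.IsGE X a := ⟨ha⟩
  have ib : τ.IsLE X b := ⟨hb⟩
  -- For `b < a` the object is zero and the truncation argument is replaced by a zero lift.
  obtain hab | hab := lt_or_ge b a
  · have hX : IsZero X := τ.isZero X b a hab
    obtain ⟨Z, hZ⟩ := HasZeroObject.zero (C := C)
    have h1 := t.isLE_of_isZero hZ b
    have h2 := t.isGE_of_isZero hZ a
    exact ⟨Z, ⟨h2.ge, h1.le⟩, ⟨hX.iso (R.map_isZero hZ)⟩⟩
  · obtain ⟨F, hF, ⟨i⟩⟩ := ha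
    obtain ⟨A, B, hA, hB, f, g, h, hT⟩ := t.exists_triangle F b (b + 1) rfl
    have hT' := R.map_distinguished _ hT
    have iA : t.IsLE A b := ⟨hA⟩
    have iB : t.IsGE B (b + 1) := ⟨hB⟩
    have iF : t.IsGE F a := ⟨hF⟩
    have jA : τ.IsLE (R.obj A) b := ⟨A, hA, ⟨Iso.refl _⟩⟩
    have jB : τ.IsGE (R.obj B) (b + 1) := ⟨B, hB, ⟨Iso.refl _⟩⟩
    have jF : τ.IsLE (R.obj F) b := τ.isLE_of_iso i b
    have hz : IsZero (R.obj B) := by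
      have : τ.IsLE (R.obj B) b := by
        refine τ.isLE₂ _ (rot_of_distTriang _ hT') b jF ?_
        have := τ.isLE_shift (R.obj A) b 1 (b - 1)
        exact τ.isLE_of_le ((R.obj A)⟦(1 : ℤ)⟧) (b - 1) b
      exact τ.isZero _ b (b + 1)
    have hiso : IsIso (R.map f) := (Triangle.isZero₃_iff_isIso₁ _ hT').1 hz
    refine ⟨A, ⟨?_, hA⟩, ⟨i ≪≫ (asIso (R.map f)).symm⟩⟩
    have : t.IsGE A a := by
      refine t.isGE₂ _ (inv_rot_of_distTriang _ hT) a ?_ iF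
      have := t.isGE_shift B (b + 1) (-1) (b + 2)
      exact t.isGE_of_ge (B⟦(-1 : ℤ)⟧) a (b + 2)
    exact this.ge

lemma isBoundedTStructure_ofEssImage (hR : ∀ X : D, ∃ F : C, Nonempty (X ≅ R.obj F))
    (H : ∀ (F G : C) (_ : t.ge 1 G) (φ : R.obj F ⟶ R.obj G), ∃ (G' : C) (f : G ⟶ G') (ψ : F ⟶ G'),
      t.ge 1 G' ∧ IsIso (R.map f) ∧ R.map ψ = φ ≫ R.map f) (ht : IsBoundedTStructure t) :
    IsBoundedTStructure (t.ofEssImage R hR H) := by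
  constructor
  · intro X
    obtain ⟨F, i⟩ := hR X
    obtain ⟨n, hn⟩ := ht.1 F
    exact ⟨n, F, hn, i⟩
  · intro X
    obtain ⟨F, i⟩ := hR X
    obtain ⟨n, hn⟩ := ht.2 F
    exact ⟨n, F, hn, i⟩

end CategoryTheory.Triangulated.TStructure

/-! ### Noetherian products and their open subschemes -/

namespace AlgebraicGeometry
variable {k : Type u} [Field k] (Y : Over (Spec (.of k)))

lemma opensRange_prodMap {T T' : Over (Spec (.of k))} (g : T' ⟶ T) [IsOpenImmersion g.left] :
    (prodMap Y g).opensRange = prodSnd Y T ⁻¹ᵁ g.left.opensRange := by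
  ext x
  have := Set.ext_iff.1 (Pullback.range_map Y.hom T'.hom Y.hom T.hom (𝟙 Y.left) g.left (𝟙 _) (by simp) (by simp)) x
  refine this.trans ?_
  simp

variable [LocallyOfFiniteType Y.hom] [QuasiCompact Y.hom]
variable (S : Over (Spec (.of k))) [LocallyOfFiniteType S.hom] [QuasiCompact S.hom]

instance : CompactSpace S.left := QuasiCompact.compactSpace_of_compactSpace S.hom

instance noetherianSpace_left : NoetherianSpace S.left := by
  have : IsLocallyNoetherian S.left := LocallyOfFiniteType.isLocallyNoetherian S.hom
  have : IsNoetherian S.left := { }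
  infer_instance

instance noetherianSpace_prodScheme : NoetherianSpace (prodScheme Y S) := by
  have : CompactSpace (prodScheme Y S) := QuasiCompact.compactSpace_of_compactSpace (prodSnd Y S)
  have : IsNoetherian (prodScheme Y S) := { }
  infer_instance

instance noetherianSpace_prodScheme_openOver (U : S.left.Opens) :
    NoetherianSpace (prodScheme Y (openOver S U)) :=
  (prodMap Y (openIncl S U)).isOpenEmbedding.isInducing.noetherianSpace

end AlgebraicGeometry

open Pretriangulated

lemma CategoryTheory.eq_comp_of_iso {C : Type*} [Category* C] {A B B' M N P : C} (e : A ≅ B)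
    (c : B' ≅ B) (m : A ⟶ M) (i : M ⟶ N) (g : N ⟶ P) :
    m ≫ i ≫ g = (e.hom ≫ c.inv) ≫ (c.hom ≫ e.inv ≫ m ≫ i) ≫ g := by simp

/-! ### Extension of bounded complexes with control of the support -/

namespace AlgebraicGeometry.Scheme.Modules
open DerivedCategory TStructure
variable {X W : Scheme.{u}} [IsLocallyNoetherian W]

/-- The bounded complexes that vanish over the open subset `V`. -/
def boundedVanishing (V : W.Opens) : ObjectProperty (DerivedCategory (Coh W)) := fun F =>
  t.bounded F ∧ IsZero ((cohRestrict V.ι).mapDerivedCategory.obj F)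

instance (V : W.Opens) : (boundedVanishing V).IsClosedUnderIsomorphisms where
  of_iso e h := ⟨t.bounded.prop_of_iso e h.1,
    h.2.of_iso ((cohRestrict V.ι).mapDerivedCategory.mapIso e.symm)⟩

instance (V : W.Opens) : (boundedVanishing V).IsTriangulatedClosed₂ := .mk' fun T hT h₁ h₃ =>
  ⟨t.bounded.ext_of_isTriangulatedClosed₂ T hT h₁.1 h₃.1,
    Triangle.isZero₂_of_isZero₁₃ _ ((cohRestrict V.ι).mapDerivedCategory.map_distinguished T hT)
      h₁.2 h₃.2⟩

lemma boundedVanishing_shift (V : W.Opens) (n : ℤ) (F : DerivedCategory (Coh W))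
    (h : boundedVanishing V F) : boundedVanishing V (F⟦n⟧) :=
  ⟨t.bounded.le_shift n F h.1, ((shiftFunctor _ n).map_isZero h.2).of_iso
    (((cohRestrict V.ι).mapDerivedCategory.commShiftIso n).app F)⟩

lemma boundedVanishing_of_isZero (V : W.Opens) (F : DerivedCategory (Coh W)) (h : IsZero F) :
    boundedVanishing V F := by
  obtain ⟨Z, hZ, hZ'⟩ := ObjectProperty.exists_prop_of_containsZero (t.bounded (C := DerivedCategory (Coh W)))
  exact ⟨t.bounded.prop_of_iso (hZ.iso h) hZ', Functor.map_isZero _ h⟩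

lemma boundedVanishing_iff (V : W.Opens) (F : DerivedCategory (Coh W)) :
    boundedVanishing V F ↔ t.bounded F ∧ DerivedVanishesOn V F := by
  refine and_congr_right fun _ => ?_
  rw [isZero_mapDerivedCategory_cohRestrict_iff, Scheme.Opens.opensRange_ι]

lemma boundedVanishing_mapDerivedCategory (V : W.Opens) (T : Coh W ⥤ Coh W) [T.Additive]
    [PreservesFiniteLimits T] [PreservesFiniteColimits T]
    (hT : ∀ N, VanishesOn V N → VanishesOn V (T.obj N))
    (F : DerivedCategory (Coh W)) (h : boundedVanishing V F) :
    boundedVanishing V (T.mapDerivedCategory.obj F) := by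
  rw [boundedVanishing_iff] at h ⊢
  refine ⟨bounded_mapDerivedCategory T h.1, fun n O hO => ?_⟩
  obtain ⟨e⟩ := nonempty_homology_mapDerivedCategory_iso T F n
  exact @Equiv.subsingleton _ _ ((sectionsFunctor O).mapIso
    ((isCoherent W).ι.mapIso e)).addCommGroupIsoToAddEquiv.toEquiv (hT _ (h.2 n) O hO)

variable [NoetherianSpace W] [NoetherianSpace X] (j : X ⟶ W) [IsOpenImmersion j]

/-- The coherent extension is a subsheaf of the direct image of `H`, so it vanishes wherever the
direct image does. -/
lemma exists_coherent_lift (V : W.Opens) (H : Coh X) (hH : VanishesOn (j ⁻¹ᵁ V) H) :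
    ∃ N : Coh W, VanishesOn V N ∧ Nonempty ((cohRestrict j).obj N ≅ H) := by
  obtain ⟨N, i, hN, hi, hb⟩ := exists_coherent_extension j H.property
  refine ⟨⟨N, hN⟩, fun O hO => ?_, ⟨(isCoherent X).isoMk ?_⟩⟩
  · have : Subsingleton Γ((pushforward j).obj H.obj, O) := hH (j ⁻¹ᵁ O) (j.preimage_mono hO)
    exact (app_injective_of_mono i O).subsingleton
  · have := isIso_restrict_map j i hb
    exact @asIso _ _ _ _ ((restrictFunctor j).map i) this ≪≫ asIso ((restrictAdjunction j).counit.app H.obj)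

/-- A bounded complex on an open subscheme extends to a bounded complex with the corresponding
support. -/
theorem exists_derived_lift [IsLocallyNoetherian X] (V : W.Opens)
    (hT : ∀ x ∈ j.opensRange, ∃ V' : W.Opens, x ∈ V' ∧ V' ≤ j.opensRange ∧
      HasTwists (boundedVanishing V) j.opensRange V')
    (F₀ : DerivedCategory (Coh X)) (hF₀ : boundedVanishing (j ⁻¹ᵁ V) F₀) :
    ∃ F, boundedVanishing V F ∧ Nonempty (F₀ ≅ (cohRestrict j).mapDerivedCategory.obj F) := by
  let Φ := (cohRestrict j).mapDerivedCategory
  let P : ObjectProperty (DerivedCategory (Coh X)) := fun F₀ =>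
    ∃ F, boundedVanishing V F ∧ Nonempty (F₀ ≅ Φ.obj F)
  have h1 : P.IsClosedUnderIsomorphisms := ⟨fun e ⟨F, hF, ⟨i⟩⟩ => ⟨F, hF, ⟨e.symm ≪≫ i⟩⟩⟩
  have h2 : P.IsTriangulatedClosed₂ := .mk' fun T hT' ⟨F, hF, ⟨i⟩⟩ ⟨G, hG, ⟨e⟩⟩ => by
    -- The middle term of the triangle is the cone of `φ`. After `F` is replaced by some `F'` with
    -- the same restriction, still vanishing over `V`, the morphism lifts, and the cone of the lift
    -- restricts to the middle term.
    let φ : Φ.obj (G⟦(-1 : ℤ)⟧) ⟶ Φ.obj F := (Φ.commShiftIso (-1 : ℤ)).hom.app G ≫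
      e.inv⟦(-1 : ℤ)⟧' ≫ T.invRotate.mor₁ ≫ i.hom
    obtain ⟨F', f, ψ, hF', hf, hψ⟩ := exists_hom_extension_target (boundedVanishing_shift V (-1))
      (boundedVanishing_of_isZero V) j hT (fun _ h => h.1)
      (boundedVanishing_shift V (-1) G hG).1 hF φ
    obtain ⟨E, g, δ, hd⟩ := distinguished_cocone_triangle ψ
    have hd' := rot_of_distTriang _ hd
    have hE : boundedVanishing V E :=
      (boundedVanishing V).ext_of_isTriangulatedClosed₂ _ hd' hF'
        ((boundedVanishing V).prop_of_iso ((shiftEquiv _ (1 : ℤ)).counitIso.symm.app G) hG)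
    refine ⟨E, hE, ⟨?_⟩⟩
    let a : T.invRotate.obj₁ ≅ Φ.obj (G⟦(-1 : ℤ)⟧) :=
      (shiftFunctor _ (-1 : ℤ)).mapIso e ≪≫ ((Φ.commShiftIso (-1 : ℤ)).app G).symm
    let b : T.invRotate.obj₂ ≅ Φ.obj F' := i ≪≫ asIso (Φ.map f)
    refine Triangle.π₃.mapIso (isoTriangleOfIso₁₂ T.invRotate (Φ.mapTriangle.obj (Triangle.mk ψ g δ))
      (inv_rot_of_distTriang _ hT') (Φ.map_distinguished _ hd) a b ?_)
    exact (eq_comp_of_iso ((shiftFunctor _ (-1 : ℤ)).mapIso e) ((Φ.commShiftIso (-1 : ℤ)).app G)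
      T.invRotate.mor₁ i.hom (Φ.map f)).trans (congrArg (a.hom ≫ ·) hψ).symm
  refine of_bounded_of_isZero (cohRestrict (j ⁻¹ᵁ V).ι) P ?_ ?_ F₀ hF₀.1 hF₀.2
  · intro Z hZ
    obtain ⟨Z', hZ'⟩ := HasZeroObject.zero (C := DerivedCategory (Coh W))
    exact ⟨Z', boundedVanishing_of_isZero V Z' hZ', ⟨hZ.iso (Functor.map_isZero _ hZ')⟩⟩
  · intro n H hH
    rw [isZero_cohRestrict_iff, Scheme.Opens.opensRange_ι] at hH
    obtain ⟨N, hN, ⟨e⟩⟩ := exists_coherent_lift j V H hH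
    refine ⟨(singleFunctor (Coh W) n).obj N, ⟨⟨⟨n, ?_⟩, ⟨n, ?_⟩⟩, ?_⟩,
      ⟨((singleFunctor (Coh X) n).mapIso e).symm ≪≫ ((cohRestrict j).mapDerivedCategorySingleFunctor n).symm.app N⟩⟩
    · exact inferInstanceAs (DerivedCategory.IsGE _ n)
    · exact inferInstanceAs (DerivedCategory.IsLE _ n)
    · have : IsZero ((cohRestrict V.ι).obj N) := by
        rw [isZero_cohRestrict_iff, Scheme.Opens.opensRange_ι]
        exact hN
      exact ((singleFunctor (Coh V) n).map_isZero this).of_iso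
        (((cohRestrict V.ι).mapDerivedCategorySingleFunctor n).app N)

end AlgebraicGeometry.Scheme.Modules

/-! ### Left-compact complexes: restriction, twist and lifting -/

namespace AlgebraicGeometry
open DerivedCategory Pretriangulated

section
variable {C D : Type*} [Category* C] [Preadditive C] [HasZeroObject C] [HasShift C ℤ]
  [∀ n : ℤ, (shiftFunctor C n).Additive] [Pretriangulated C]
  [Category* D] [Preadditive D] [HasZeroObject D] [HasShift D ℤ]
  [∀ n : ℤ, (shiftFunctor D n).Additive] [Pretriangulated D]

lemma IsTExact.ge {t : TStructure C} {t' : TStructure D} {Φ : C ⥤ D} (h : IsTExact t t' Φ)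
    [Φ.CommShift ℤ] (n : ℤ) (X : C) (hX : t.ge n X) : t'.ge n (Φ.obj X) := by
  have h1 := h.2 _ (t.ge_shift n n 0 (add_zero n) X hX)
  have : t'.IsGE ((Φ.obj X)⟦n⟧) 0 := ⟨(t'.ge 0).prop_of_iso ((Φ.commShiftIso n).app X) h1⟩
  exact (t'.isGE_of_shift (Φ.obj X) n n 0).ge
end

lemma prodMap_snd {k : Type u} [Field k] (Y : Over (Spec (.of k))) {T' T : Over (Spec (.of k))}
    (g : T' ⟶ T) : prodMap Y g ≫ Limits.pullback.snd Y.hom T.hom =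
      Limits.pullback.snd Y.hom T'.hom ≫ g.left :=
  Limits.pullback.lift_snd _ _ _

variable {k : Type u} [Field k] {Y S : Over (Spec (.of k))} [LocallyOfFiniteType Y.hom]
  [LocallyOfFiniteType S.hom]

section
variable {T' T : Over (Spec (.of k))} [LocallyOfFiniteType T.hom] [LocallyOfFiniteType T'.hom]
  [IsSeparated Y.hom] (g : T' ⟶ T) [IsOpenImmersion g.left]

variable (Y) in
/-- The restriction of left-compact complexes is computed in the ambient derived categories. -/
noncomputable def lcRestrictCompι : lcRestrict Y g ⋙ (isLeftCompact Y T').ι ≅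
    (isLeftCompact Y T).ι ⋙ (cohRestrict (prodMap Y g)).mapDerivedCategory :=
  Iso.refl _

noncomputable instance : (lcRestrict Y g).CommShift ℤ :=
  Functor.CommShift.ofComp (lcRestrictCompι Y g) ℤ

instance : NatTrans.CommShift (lcRestrictCompι Y g).hom ℤ :=
  Functor.CommShift.ofComp_compatibility _ _

/-- The shift structure comes from the ambient derived categories, so distinguished triangles may be
tested there. -/
instance : (lcRestrict Y g).IsTriangulated := by
  rw [Functor.isTriangulated_iff_comp_right (lcRestrictCompι Y g)]
  infer_instance

/-- The twist of left-compact complexes is computed in the ambient derived category. -/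
noncomputable def lcTwistCompι {L : (prodScheme Y T).Modules} (hL : IsInvertible L) :
    lcTwist hL ⋙ (isLeftCompact Y T).ι ≅
      (isLeftCompact Y T).ι ⋙ (cohTensor hL).mapDerivedCategory :=
  Iso.refl _

noncomputable instance {L : (prodScheme Y T).Modules} (hL : IsInvertible L) :
    (lcTwist hL).CommShift ℤ :=
  Functor.CommShift.ofComp (lcTwistCompι hL) ℤ
end

section
variable {X₁ X₂ X₃ : Scheme.{u}}

/-- Restriction of coherent sheaves is functorial in the open immersion. -/
noncomputable def cohRestrictComp (f : X₁ ⟶ X₂) (g : X₂ ⟶ X₃) (h : X₁ ⟶ X₃) [IsOpenImmersion f]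
    [IsOpenImmersion g] [IsOpenImmersion h] (w : f ≫ g = h) :
    cohRestrict h ≅ cohRestrict g ⋙ cohRestrict f :=
  let e : restrictFunctor h ≅ restrictFunctor g ⋙ restrictFunctor f :=
    restrictFunctorCongr w.symm ≪≫ restrictFunctorComp f g
  NatIso.ofComponents (fun N => (isCoherent X₁).isoMk (e.app N.obj)) fun φ => by
    apply (isCoherent X₁).ι.map_injective
    exact e.hom.naturality φ.hom
end

lemma nonempty_lcRestrict_comp_iso {T₁ T₂ T₃ : Over (Spec (.of k))} [LocallyOfFiniteType T₁.hom]
    [LocallyOfFiniteType T₂.hom] [LocallyOfFiniteType T₃.hom] (f : T₁ ⟶ T₂) (g : T₂ ⟶ T₃)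
    (h : T₁ ⟶ T₃) [IsOpenImmersion f.left] [IsOpenImmersion g.left] [IsOpenImmersion h.left]
    (w : f ≫ g = h) (F : DLc Y T₃) :
    Nonempty ((lcRestrict Y h).obj F ≅ (lcRestrict Y f).obj ((lcRestrict Y g).obj F)) := by
  have w' : prodMap Y f ≫ prodMap Y g = prodMap Y h := by
    subst w
    refine Limits.pullback.hom_ext ?_ ?_
    · exact (Category.assoc _ _ _).trans <| (congrArg (prodMap Y f ≫ ·) (prodMap_fst Y g)).trans <|
        (prodMap_fst Y f).trans (prodMap_fst Y (f ≫ g)).symm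
    · refine (Category.assoc _ _ _).trans <| (congrArg (prodMap Y f ≫ ·) (prodMap_snd Y g)).trans <|
        (Category.assoc _ _ _).symm.trans <| (congrArg (· ≫ g.left) (prodMap_snd Y f)).trans <|
        (Category.assoc _ _ _).trans (prodMap_snd Y (f ≫ g)).symm
  obtain ⟨e⟩ := nonempty_mapDerivedCategory_comp_iso _ _ _ (cohRestrictComp _ _ _ w') F.obj
  exact ⟨(isLeftCompact Y T₁).isoMk e⟩

lemma exists_hasTwists_prodMap [QuasiCompact Y.hom] [QuasiCompact S.hom]
    {L : S.left.Modules} (hL : IsAmple L) (U : S.left.Opens)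
    (P : ObjectProperty (DerivedCategory (Coh (prodScheme Y S)))) [P.IsClosedUnderIsomorphisms]
    (hP : ∀ F, P F →
      P ((cohTensor (hL.isInvertible.pullback (prodSnd Y S))).mapDerivedCategory.obj F)) :
    ∀ x ∈ (prodMap Y (openIncl S U)).opensRange, ∃ V' : (prodScheme Y S).Opens, x ∈ V' ∧
      V' ≤ (prodMap Y (openIncl S U)).opensRange ∧
      HasTwists P (prodMap Y (openIncl S U)).opensRange V' := by
  have h : (openIncl S U).left.opensRange = U := Scheme.Opens.opensRange_ι U
  rw [opensRange_prodMap, h]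
  exact fun x hx => hL.exists_hasTwists (prodSnd Y S) P hP U x hx

/-- The proper subset `A` of `Y` that bounds the support over `U` also bounds that of the lift: the
complement of its preimage in `Y × S` restricts to the one in `Y × U`, and vanishing over it is
stable under twists. -/
lemma exists_lcRestrict_iso [QuasiCompact Y.hom] [QuasiCompact S.hom]
    {L : S.left.Modules} (hL : IsAmple L) (U : S.left.Opens) (F₀ : DLc Y (openOver S U)) :
    ∃ F : DLc Y S, Nonempty (F₀ ≅ (lcRestrict Y (openIncl S U)).obj F) := by
  let j := prodMap Y (openIncl S U)
  obtain ⟨V', hz, A, hA, hV'⟩ := (isSupportedOver_iff _ _).1 F₀.property.2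
  let V : (prodScheme Y S).Opens := ⟨(prodFst Y S ⁻¹' A)ᶜ,
    (hA.isClosed.preimage (prodFst Y S).continuous).isOpen_compl⟩
  have hV : (V : Set (prodScheme Y S))ᶜ = prodFst Y S ⁻¹' A := compl_compl _
  obtain rfl : V' = j ⁻¹ᵁ V := by
    apply SetLike.coe_injective
    rw [← compl_inj_iff, hV', ← prodMap_fst Y (openIncl S U)]
    exact (compl_compl _).symm
  obtain ⟨F, hF, ⟨e⟩⟩ := exists_derived_lift j V (exists_hasTwists_prodMap hL U _
    (boundedVanishing_mapDerivedCategory V _ fun N hN => vanishesOn_cohTensor _ hN)) F₀.obj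
    ⟨F₀.property.1, hz⟩
  exact ⟨⟨F, hF.1, (isSupportedOver_iff _ _).2 ⟨V, hF.2, A, hA, hV⟩⟩,
    ⟨(isLeftCompact Y (openOver S U)).isoMk e⟩⟩

section
variable [IsSeparated Y.hom] (t : TStructure (DLc Y S))

/-- The property of the objects of the ambient derived category of being in `D_lc^{≥ n}`. -/
def lcGe (n : ℤ) : ObjectProperty (DerivedCategory (Coh (prodScheme Y S))) := fun X =>
  ∃ h : isLeftCompact Y S X, t.ge n ⟨X, h⟩

instance : (isLeftCompact Y S).IsClosedUnderIsomorphisms := by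
  unfold isLeftCompact; infer_instance

instance (n : ℤ) : (lcGe t n).IsClosedUnderIsomorphisms where
  of_iso e h := ⟨(isLeftCompact Y S).prop_of_iso e h.1,
    (t.ge n).prop_of_iso ((isLeftCompact Y S).isoMk e) h.2⟩

/-- `D^{≥ n}` is the right orthogonal of `D^{≤ n - 1}`, and orthogonality passes to extensions by
the long exact sequence of the ambient triangle. -/
instance (n : ℤ) : (lcGe t n).IsTriangulatedClosed₂ := .mk' fun T hT ⟨h₁, h₁'⟩ ⟨h₃, h₃'⟩ => by
  have h₂ := (isLeftCompact Y S).ext_of_isTriangulatedClosed₂ T hT h₁ h₃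
  refine ⟨h₂, TStructure.IsGE.ge (self := ?_)⟩
  rw [t.isGE_iff_orthogonal (n - 1) n (by lia)]
  intro Z f hZ
  have i₁ : t.IsGE (⟨T.obj₁, h₁⟩ : DLc Y S) n := ⟨h₁'⟩
  have i₃ : t.IsGE (⟨T.obj₃, h₃⟩ : DLc Y S) n := ⟨h₃'⟩
  have h : f.hom ≫ T.mor₂ = 0 := congrArg InducedCategory.Hom.hom
    (t.zero (ObjectProperty.homMk (f.hom ≫ T.mor₂) : Z ⟶ (⟨T.obj₃, h₃⟩ : DLc Y S)) (n - 1) n)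
  obtain ⟨g, hg⟩ := Triangle.coyoneda_exact₂ T hT f.hom h
  have hg₀ : g = 0 := congrArg InducedCategory.Hom.hom
    (t.zero (ObjectProperty.homMk g : Z ⟶ (⟨T.obj₁, h₁⟩ : DLc Y S)) (n - 1) n)
  apply (isLeftCompact Y S).ι.map_injective
  refine hg.trans ?_
  rw [hg₀]
  exact zero_comp

/-- The shift by `-1` maps `D^{≥ n}` to `D^{≥ n + 1}`. Hence fibres of morphisms in `D^{≥ n}` remain
in it, which is why the targets of morphisms, and not the sources, are modified. -/
lemma lcGe_shift (n : ℤ) (F : DerivedCategory (Coh (prodScheme Y S))) (h : lcGe t n F) :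
    lcGe t n (F⟦(-1 : ℤ)⟧) := by
  obtain ⟨h₁, h₂⟩ := h
  refine ⟨(isLeftCompact Y S).le_shift (-1) F h₁, ?_⟩
  have h₃ := t.ge_antitone (by lia : n ≤ n + 1) _ (t.ge_shift n (-1) (n + 1) (by lia) _ h₂)
  exact (t.ge n).prop_of_iso ((isLeftCompact Y S).isoMk
    (((isLeftCompact Y S).ι.commShiftIso (-1 : ℤ)).app ⟨F, h₁⟩)) h₃

lemma lcGe_of_isZero (n : ℤ) (F : DerivedCategory (Coh (prodScheme Y S))) (h : IsZero F) :
    lcGe t n F := by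
  obtain ⟨Z, hZ, hZ'⟩ := ObjectProperty.exists_prop_of_containsZero (isLeftCompact Y S)
  have hF := (isLeftCompact Y S).prop_of_iso (hZ.iso h) hZ'
  have hF₀ : IsZero (⟨F, hF⟩ : DLc Y S) := by
    rw [IsZero.iff_id_eq_zero]
    exact (isLeftCompact Y S).ι.map_injective (h.eq_of_src _ _)
  exact ⟨hF, (t.isGE_of_isZero hF₀ n).ge⟩

variable [QuasiCompact Y.hom] [QuasiCompact S.hom] {L : S.left.Modules} (hL : IsAmple L)

variable {t}

/-- This is `exists_hom_extension_target` for the property `lcGe t n`. The t-exactness of the twist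
enters here: it makes `D^{≥ n}` stable under multiplication by sections of powers of the line
bundle. -/
lemma exists_lcRestrict_hom_extension
    (htL : IsTExact t t (lcTwist (hL.isInvertible.pullback (prodSnd Y S)))) (U : S.left.Opens)
    (n : ℤ) (F G : DLc Y S) (hG : t.ge n G)
    (φ : (lcRestrict Y (openIncl S U)).obj F ⟶ (lcRestrict Y (openIncl S U)).obj G) :
    ∃ (G' : DLc Y S) (f : G ⟶ G') (ψ : F ⟶ G'), t.ge n G' ∧
      IsIso ((lcRestrict Y (openIncl S U)).map f) ∧
      (lcRestrict Y (openIncl S U)).map ψ = φ ≫ (lcRestrict Y (openIncl S U)).map f := by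
  obtain ⟨G', f, ψ, ⟨hG', hG''⟩, hf, hψ⟩ := exists_hom_extension_target (lcGe_shift t n)
    (lcGe_of_isZero t n) (prodMap Y (openIncl S U)) (exists_hasTwists_prodMap hL U (lcGe t n)
      fun F ⟨h, h'⟩ => ⟨_, htL.ge n _ h'⟩) (fun _ h => h.1.1)
    F.property.1 (G := G.obj) ⟨G.property, hG⟩ φ.hom
  refine ⟨⟨G', hG'⟩, ObjectProperty.homMk f, ObjectProperty.homMk ψ, hG'', ?_, ?_⟩
  · have : IsIso ((isLeftCompact Y (openOver S U)).ι.map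
      ((lcRestrict Y (openIncl S U)).map (ObjectProperty.homMk f : G ⟶ ⟨G', hG'⟩))) := hf
    exact isIso_of_reflects_iso _ (isLeftCompact Y (openOver S U)).ι
  · apply (isLeftCompact Y (openOver S U)).ι.map_injective
    exact hψ

end

end AlgebraicGeometry

theorem theorem2p15 {k : Type u} [Field k] [IsAlgClosed k] (Y S : Over (Spec (.of k)))
    [IsSeparated Y.hom] [LocallyOfFiniteType Y.hom] [QuasiCompact Y.hom]
    [IsSeparated S.hom] [LocallyOfFiniteType S.hom] [QuasiCompact S.hom]
    (hS : IsQuasiProjective S) (L : S.left.Modules) (hL : IsAmple L)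
    (t : TStructure (DLc Y S)) (ht : IsBoundedTStructure t)
    (htL : IsTExact t t (lcTwist (hL.isInvertible.pullback (prodSnd Y S)))) :
    ∃ τ : SheafOfTStructures Y S, ∀ (U : S.left.Opens) (F₀ : DLc Y (openOver S U)),
      (∀ b : ℤ, (τ.t U).le b F₀ ↔
        ∃ F : DLc Y S, t.le b F ∧ Nonempty (F₀ ≅ (lcRestrict Y (openIncl S U)).obj F)) ∧
      (∀ a : ℤ, (τ.t U).ge a F₀ ↔
        ∃ F : DLc Y S, t.ge a F ∧ Nonempty (F₀ ≅ (lcRestrict Y (openIncl S U)).obj F)) ∧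
      (∀ a b : ℤ, (τ.t U).ge a F₀ ∧ (τ.t U).le b F₀ ↔
        ∃ F : DLc Y S, (t.ge a F ∧ t.le b F) ∧
          Nonempty (F₀ ≅ (lcRestrict Y (openIncl S U)).obj F)) := by
  let R (U : S.left.Opens) := lcRestrict Y (openIncl S U)
  have hR (U : S.left.Opens) := exists_lcRestrict_iso (Y := Y) hL U
  -- Only morphisms into `D^{≥ 1}` have to be lifted, for the vanishing of morphisms from `D^{≤ 0}`.
  have H (U : S.left.Opens) := exists_lcRestrict_hom_extension hL htL U 1
  let τ : SheafOfTStructures Y S :=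
    { t U := t.ofEssImage (R U) (hR U) (H U)
      isBounded U := TStructure.isBoundedTStructure_ofEssImage (hR U) (H U) ht
      isTExact {U' U} h := by
        -- A lift of an object over `U` is also a lift of its restriction to `U'`, so t-exactness
        -- holds by construction.
        have key (F₀ : DLc Y (openOver S U)) (F : DLc Y S) (e : Nonempty (F₀ ≅ (R U).obj F)) :
            Nonempty ((lcRestrict Y (openHomOfLE h)).obj F₀ ≅ (R U').obj F) := by
          obtain ⟨e⟩ := e
          obtain ⟨e'⟩ := nonempty_lcRestrict_comp_iso (Y := Y) (openHomOfLE h) (openIncl S U)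
            (openIncl S U') (by ext1; exact S.left.homOfLE_ι h) F
          exact ⟨(lcRestrict Y (openHomOfLE h)).mapIso e ≪≫ e'.symm⟩
        exact ⟨fun X ⟨F, hF, e⟩ => ⟨F, hF, key X F e⟩, fun X ⟨F, hF, e⟩ => ⟨F, hF, key X F e⟩⟩ }
  exact ⟨τ, fun U F₀ => ⟨fun b => Iff.rfl, fun a => Iff.rfl, fun a b =>
    ⟨fun h => TStructure.exists_ge_le_of_ofEssImage (hR U) (H U) h.1 h.2,
      fun ⟨F, h, i⟩ => ⟨⟨F, h.1, i⟩, ⟨F, h.2, i⟩⟩⟩⟩⟩
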